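/- **Setting.** For a real symmetric array $(\theta_{uv})_{u\ne v}$, $u,v\in\{1,\dots,n\}$, the Ising model without external field is the distribution $p(x)=\exp\big(\sum_{u<v}\theta_{uv}x_ux_v-\Phi(\theta)\big)$ on $\{-1,1\}^n$. It is in the high-temperature regime with margin $\eta>0$ if $\max_v\sum_{u\ne v}\tanh|\theta_{uv}|\le 1-\eta$. Let $\mathcal I_n$ be the set of product distributions on $\{-1,1\}^n$, $d_{\mathrm{SKL}}(p,q)=d_{\mathrm{KL}}(p,q)+d_{\mathrm{KL}}(q,p)\in[0,\infty]$, and $d_{\mathrm{SKL}}(p,\mathcal I_n)=\inf_{q\in\mathcal I_n}d_{\mathrm{SKL}}(p,q)$. **The learn-then-test algorithm.** Given $n$, $\beta\ge 0$, $\varepsilon>0$ and i.i.d. samples from $p$, it uses a parameter $\tau$, chosen as $\tau=4/3$, and positive integer constants $A_0,\dots,A_4,D$. Put $k_0=\lfloor A_0 n^{2\tau}\tfrac{\beta^2}{\varepsilon^2}(\lfloor\log_2 n\rfloor+1)\rfloor$ (with $\lfloor\log_2 0\rfloor:=0$), $L=\lceil A_1n^{2-\tau}\rceil$, $k_1=\max\big(0,\,2\lfloor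 A_2 n^{2\tau}\tfrac{\beta^2}{\varepsilon^2}\rfloor-1\big)$, $R=A_3(\lfloor\log_2 n\rfloor+1)$, $k_2=\lfloor A_4 n^{6-2\tau}\tfrac{\beta^2}{\varepsilon^2}\rfloor$. 1. (Localization) From $k_0$ samples compute the empirical covariance $\hat\lambda_{uv}$ of $X_u,X_v$ for every pair; if $2\beta n^{\tau}|\hat\lambda_{uv}|\ge\varepsilon$ for some pair, output "far". 2. (Weak learning) For each $\ell=1,\dots,L$, from $k_1$ fresh samples let $\Gamma^{(\ell)}_{uv}\in\{\pm1\}$ be the sign of the empirical mean of $X_uX_v$ (the sign of $0$ being $+1$; no tie occurs for $k_1>0$, as $k_1$ is then odd). 3. (Testing) Draw $R$ blocks of $k_2$ fresh samples, the same for all $\ell$. Block $r$ votes against $\ell$ if the empirical mean $\bar Z$ over the block of $\sum_{u<v}\Gamma^{(\ell)}_{uv}X_uX_v$ satisfies $D\beta n^{2-\tau}\bar Z>\varepsilon$. If for some $\ell$ more than half of the blocks vote against $\ell$, output "far"; otherwise output "independent". Empirical means over no samples are $0$. The algorithm uses $N=k_0+Lk_1+Rk_2$ samples. **Theorem.** For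 every $\eta>0$ there are positive integers $A_0,\dots,A_4,D$, a real $C$ and $d\in\mathbb N$, depending only on $\eta$, such that the following holds. * *(Sample complexity)* For all $n\in\mathbb N$, $\beta\ge0$, $\varepsilon>0$ (with $\log 0:=0$), $$N\le C(1+\log n)^d\,\frac{n^{10/3}\beta^2}{\varepsilon^2}\qquad\text{and}\qquad N\le C(1+\log n)^d\,\big(n^{2+\tau'}+n^{6-2\tau'}\big)\frac{\beta^2}{\varepsilon^2}\quad\text{for every }\tau'>0 ;$$ that is, $N=\tilde O(n^{10/3}\beta^2/\varepsilon^2)$ and $N=\tilde O\big(\min_{\tau'>0}(n^{2+\tau'}+n^{6-2\tau'})\beta^2/\varepsilon^2\big)$. * *(Correctness)* Let $p$ be an Ising model on $n$ vertices without external field, in the high-temperature regime with margin $\eta$, with $|\theta_{uv}|\le\beta$ for all $u\neq v$. Given $N$ i.i.d. samples from $p$, the algorithm outputs "independent" with probability at least $9/10$ if $p\in\mathcal I_n$, and outputs "far" with probability at least $9/10$ if $d_{\mathrm{SKL}}(p,\mathcal I_n)\ge\varepsilon$. * *(Running time)* On rational inputs $\beta\ge 0$, $\varepsilon>0$ the algorithm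 runs in polynomial time: one program of a random access machine with logarithmic cost, given $n$, the numerators and denominators of $\beta$ and $\varepsilon$, and the $N$ samples, computes the output at a cost that is bounded by a polynomial in $n$ and the bit length of this input. -/

import Mathlib

open MeasureTheory
open scoped ENNReal

noncomputable section

namespace IsingTest

/-! ### Ising models on `{-1, 1}ⁿ` -/

/-- A configuration; `true` stands for the spin `+1`, `false` for the spin `-1`. -/
abbrev Config (n : ℕ) : Type := Fin n → Bool

/-- The numerical value of a spin. -/
def spin (b : Bool) : ℝ := if b then 1 else -1

/-- Parameters of an Ising model on the vertex set `Fin n`. Every pair `u ≠ v` is an edge, an edge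
parameter may be `0`; the diagonal of `edge` plays no role. -/
structure IsingModel (n : ℕ) where
  node : Fin n → ℝ
  edge : Fin n → Fin n → ℝ
  edge_symm : ∀ u v, edge u v = edge v u

namespace IsingModel

variable {n : ℕ} (p : IsingModel n)

/-- `∑_v θ_v x_v + ∑_{u < v} θ_{uv} x_u x_v`. -/
def energy (x : Config n) : ℝ :=
  ∑ v, p.node v * spin (x v) + ∑ u, ∑ v ∈ Finset.Ioi u, p.edge u v * (spin (x u) * spin (x v))

/-- The log-partition function `Φ(θ)`. -/
def logPartition : ℝ := Real.log (∑ x : Config n, Real.exp (p.energy x))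

/-- The probability `exp (energy x - Φ(θ))` of a configuration. -/
def prob (x : Config n) : ℝ := Real.exp (p.energy x - p.logPartition)

theorem sum_prob : ∑ x : Config n, p.prob x = 1 := by
  have h : 0 < ∑ x : Config n, Real.exp (p.energy x) :=
    Finset.sum_pos (fun x _ => Real.exp_pos _) Finset.univ_nonempty
  simp only [prob, logPartition, Real.exp_sub, Real.exp_log h]
  rw [← Finset.sum_div, div_self h.ne']

/-- The Ising model as a probability mass function. -/
def pmf : PMF (Config n) :=
  PMF.ofFintype (fun x => ENNReal.ofReal (p.prob x)) (by
    have h : ∀ x ∈ Finset.univ, 0 ≤ p.prob x := fun x _ => (Real.exp_pos _).le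
    rw [← ENNReal.ofReal_sum_of_nonneg h, p.sum_prob, ENNReal.ofReal_one])

/-- The Ising model as a probability measure. -/
def law : Measure (Config n) := p.pmf.toMeasure

/-- No external field. -/
def NoExternalField : Prop := ∀ v, p.node v = 0

/-- Dobrushin's uniqueness condition (the high-temperature regime) with margin `η`:
`max_v ∑_{u ≠ v} tanh |θ_{uv}| ≤ 1 - η`. -/
def HighTemperature (η : ℝ) : Prop :=
  ∀ v, ∑ u ∈ Finset.univ.erase v, Real.tanh |p.edge u v| ≤ 1 - η

/-- `β` bounds the absolute values of all edge parameters. -/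
def EdgeBound (β : ℝ) : Prop := ∀ u v, u ≠ v → |p.edge u v| ≤ β

end IsingModel

/-- The set of product distributions on `{-1, 1}ⁿ`. -/
def productLaws (n : ℕ) : Set (Measure (Config n)) :=
  {q | ∃ r : Fin n → Measure Bool, (∀ v, IsProbabilityMeasure (r v)) ∧ q = Measure.pi r}

/-- Symmetric Kullback-Leibler divergence, with values in `[0, ∞]`. -/
def dSKL {n : ℕ} (p q : Measure (Config n)) : ℝ≥0∞ :=
  InformationTheory.klDiv p q + InformationTheory.klDiv q p

/-- The smallest symmetric Kullback-Leibler divergence to a product distribution. -/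
def dSKLProduct {n : ℕ} (p : Measure (Config n)) : ℝ≥0∞ := ⨅ q ∈ productLaws n, dSKL p q

/-! ### The learn-then-test algorithm

Everything below is phrased through the first terms of a sequence `x 0, x 1, …` of samples. -/

section Algorithm

variable {n : ℕ}

/-- Empirical mean of `X_u` over the first `k` samples. -/
def empNode (k : ℕ) (x : ℕ → Config n) (u : Fin n) : ℝ :=
  (∑ i ∈ Finset.range k, spin (x i u)) / k

/-- Empirical mean of `X_u X_v` over the first `k` samples. -/
def empEdge (k : ℕ) (x : ℕ → Config n) (u v : Fin n) : ℝ :=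
  (∑ i ∈ Finset.range k, spin (x i u) * spin (x i v)) / k

/-- Localization: some empirical covariance has absolute value at least `ε / (2 β n^τ)`. -/
def LocalizationRejects (τ β ε : ℝ) (k : ℕ) (x : ℕ → Config n) : Prop :=
  ∃ u v : Fin n, u < v ∧
    ε ≤ 2 * β * (n : ℝ) ^ τ * |empEdge k x u v - empNode k x u * empNode k x v|

/-- Weak learning: the sign of the empirical mean of `X_u X_v` over `k` samples. (No tie occurs
when `k` is odd.) -/
def weakLearn (k : ℕ) (x : ℕ → Config n) (u v : Fin n) : ℝ :=
  if 0 ≤ empEdge k x u v then 1 else -1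

/-- The global statistic `(1/k) ∑_{i < k} ∑_{u < v} Γ_{uv} X_u^{(i)} X_v^{(i)}`. -/
def globalStatistic (Γ : Fin n → Fin n → ℝ) (k : ℕ) (x : ℕ → Config n) : ℝ :=
  (∑ i ∈ Finset.range k, ∑ u, ∑ v ∈ Finset.Ioi u, Γ u v * (spin (x i u) * spin (x i v))) / k

/-- One threshold test of a hypothesis `Γ`: the global statistic exceeds `ε / (D β n^(2-τ))`. -/
def ThresholdRejects (D : ℕ) (τ β ε : ℝ) (Γ : Fin n → Fin n → ℝ) (k : ℕ) (x : ℕ → Config n) :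
    Prop :=
  ε < D * β * (n : ℝ) ^ (2 - τ) * globalStatistic Γ k x

open Classical in
/-- Majority vote over `R` threshold tests, each on its own block of `k` samples. -/
def VoteRejects (D : ℕ) (τ β ε : ℝ) (Γ : Fin n → Fin n → ℝ) (R k : ℕ) (x : ℕ → Config n) :
    Prop :=
  R < 2 * ((Finset.range R).filter fun r =>
    ThresholdRejects D τ β ε Γ k fun i => x (r * k + i)).card

end Algorithm

/-- The constants hidden in the `O(·)`'s of the algorithm. -/
structure Constants where
  loc : ℕ
  rep : ℕ
  learn : ℕ
  vote : ℕ
  test : ℕ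
  thr : ℕ
  loc_pos : 0 < loc
  rep_pos : 0 < rep
  learn_pos : 0 < learn
  vote_pos : 0 < vote
  test_pos : 0 < test
  thr_pos : 0 < thr

namespace Constants

variable (a : Constants) (n : ℕ) (τ β ε : ℝ)

/-- Number of samples for localization, `O(n^(2τ) β² log n / ε²)`. -/
def locSamples : ℕ :=
  ⌊a.loc * (n : ℝ) ^ (2 * τ) * β ^ 2 / ε ^ 2 * ((Nat.log 2 n + 1 : ℕ) : ℝ)⌋₊

/-- Number of weakly learned hypotheses, `O(n^(2-τ))`. -/
def repetitions : ℕ := ⌈a.rep * (n : ℝ) ^ (2 - τ)⌉₊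

/-- Number of samples for each hypothesis, `O(n^(2τ) β² / ε²)`; it is odd unless it is `0`. -/
def learnSamples : ℕ := 2 * ⌊a.learn * (n : ℝ) ^ (2 * τ) * β ^ 2 / ε ^ 2⌋₊ - 1

/-- Number of voting rounds, `O(log n)`. -/
def rounds : ℕ := a.vote * (Nat.log 2 n + 1)

/-- Number of samples for each voting round, `O(n² · n^(4-2τ) β² / ε²)`. -/
def testSamples : ℕ := ⌊a.test * (n : ℝ) ^ (6 - 2 * τ) * β ^ 2 / ε ^ 2⌋₊

/-- Total number of samples. -/
def samples : ℕ :=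
  a.locSamples n τ β ε + a.repetitions n τ * a.learnSamples n τ β ε
    + a.rounds n * a.testSamples n τ β ε

end Constants

/-- The learn-then-test algorithm on a sequence of samples: output "far from independent" if
localization finds a correlated pair, or if one of the weakly learned sign vectors is rejected
by the majority vote. Localization, the weak learners, and the voting rounds use
disjoint blocks of samples; the votes on different hypotheses use the same samples. -/
def SequenceRejects (a : Constants) (τ β ε : ℝ) {n : ℕ} (x : ℕ → Config n) : Prop :=
  let k₀ := a.locSamples n τ β ε
  let L := a.repetitions n τ
  let k₁ := a.learnSamples n τ β ε
  let R := a.rounds n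
  let k₂ := a.testSamples n τ β ε
  LocalizationRejects τ β ε k₀ x ∨
    ∃ l < L, VoteRejects a.thr τ β ε (weakLearn k₁ fun i => x (k₀ + l * k₁ + i)) R k₂
      fun i => x (k₀ + L * k₁ + i)

/-- The learn-then-test algorithm on its finite sample; the padding is never inspected. -/
def LearnThenTestRejects (a : Constants) (τ β ε : ℝ) {n : ℕ}
    (x : Fin (a.samples n τ β ε) → Config n) : Prop :=
  SequenceRejects a τ β ε fun i => if h : i < a.samples n τ β ε then x ⟨i, h⟩ else fun _ => true

/-! ### Random access machines with logarithmic cost -/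

inductive ArithOp
  | add | sub | mul | div

def ArithOp.eval : ArithOp → ℕ → ℕ → ℕ
  | .add, a, b => a + b
  | .sub, a, b => a - b
  | .mul, a, b => a * b
  | .div, a, b => a / b

/-- Registers and random access memory, both holding natural numbers. -/
structure RamState where
  reg : ℕ → ℕ
  mem : ℕ → ℕ

/-- Programs of a structured random access machine. -/
inductive Program
  /-- `reg r := c` -/
  | const (r c : ℕ)
  /-- `reg r := reg a op reg b` -/
  | arith (o : ArithOp) (r a b : ℕ)
  /-- `reg r := mem (reg a)` -/
  | load (r a : ℕ)
  /-- `mem (reg a) := reg b` -/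
  | store (a b : ℕ)
  | seq (P Q : Program)
  /-- if `reg a ≠ 0` then `P` else `Q` -/
  | cond (a : ℕ) (P Q : Program)
  /-- while `reg a ≠ 0` do `P` -/
  | loop (a : ℕ) (P : Program)

/-- `Exec P s t s'`: started in state `s`, the program `P` halts in state `s'` at total cost `t`.
Each elementary operation costs one plus the bit lengths of the numbers that it handles
(the logarithmic cost criterion). -/
inductive Exec : Program → RamState → ℕ → RamState → Prop
  | const (r c : ℕ) (s : RamState) :
      Exec (.const r c) s (1 + c.size) ⟨Function.update s.reg r c, s.mem⟩
  | arith (o : ArithOp) (r a b : ℕ) (s : RamState) :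
      Exec (.arith o r a b) s (1 + (s.reg a).size + (s.reg b).size)
        ⟨Function.update s.reg r (o.eval (s.reg a) (s.reg b)), s.mem⟩
  | load (r a : ℕ) (s : RamState) :
      Exec (.load r a) s (1 + (s.reg a).size + (s.mem (s.reg a)).size)
        ⟨Function.update s.reg r (s.mem (s.reg a)), s.mem⟩
  | store (a b : ℕ) (s : RamState) :
      Exec (.store a b) s (1 + (s.reg a).size + (s.reg b).size)
        ⟨s.reg, Function.update s.mem (s.reg a) (s.reg b)⟩
  | seq {P Q : Program} {s s' s'' : RamState} {t t' : ℕ} :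
      Exec P s t s' → Exec Q s' t' s'' → Exec (.seq P Q) s (t + t') s''
  | cond_true {a : ℕ} {P Q : Program} {s s' : RamState} {t : ℕ} :
      s.reg a ≠ 0 → Exec P s t s' → Exec (.cond a P Q) s (1 + (s.reg a).size + t) s'
  | cond_false {a : ℕ} {P Q : Program} {s s' : RamState} {t : ℕ} :
      s.reg a = 0 → Exec Q s t s' → Exec (.cond a P Q) s (1 + t) s'
  | loop_stop {a : ℕ} {P : Program} {s : RamState} :
      s.reg a = 0 → Exec (.loop a P) s 1 s
  | loop_step {a : ℕ} {P : Program} {s s' s'' : RamState} {t t' : ℕ} :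
      s.reg a ≠ 0 → Exec P s t s' → Exec (.loop a P) s' t' s'' →
        Exec (.loop a P) s (1 + (s.reg a).size + t + t') s''

/-- The input of the machine: `n`, numerators and denominators of the two nonnegative rationals `β`
and `ε`, then the samples one after the other, one cell (`1` or `0`) for each spin. -/
def inputList {n N : ℕ} (β ε : ℚ) (x : Fin N → Config n) : List ℕ :=
  [n, β.num.toNat, β.den, ε.num.toNat, ε.den] ++
    List.ofFn fun j : Fin (N * n) => (x j.divNat j.modNat).toNat

/-- Initial state: the input is in the memory, everything else is `0`. -/
def initState (input : List ℕ) : RamState := ⟨fun _ => 0, fun i => input.getD i 0⟩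

/-- Length of an input in bits, plus one per number. -/
def bitLength (input : List ℕ) : ℕ := (input.map fun m => m.size + 1).sum

/-- The learn-then-test algorithm with parameter `τ` runs in polynomial time: a single program
computes its answer (`1` for "far", `0` for "independent", in register `0`) at a cost polynomial
in the number `n` of vertices and the length of the input, which contains the samples. -/
def RunsInPolynomialTime (a : Constants) (τ : ℝ) : Prop :=
  ∃ (P : Program) (f : Polynomial ℕ), ∀ (n : ℕ) (β ε : ℚ), 0 ≤ β → 0 < ε →
    ∀ x : Fin (a.samples n τ β ε) → Config n,
      ∃ (t : ℕ) (s : RamState),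
        Exec P (initState (inputList β ε x)) t s ∧
        t ≤ f.eval (n + bitLength (inputList β ε x)) ∧
        (LearnThenTestRejects a τ β ε x → s.reg 0 = 1) ∧
        (¬ LearnThenTestRejects a τ β ε x → s.reg 0 = 0)

/-- Probability of an event under `N` independent samples from `p`. -/
def sampleProb {n : ℕ} (p : IsingModel n) (N : ℕ) (S : Set (Fin N → Config n)) : ℝ≥0∞ :=
  Measure.pi (fun _ : Fin N => p.law) S

end IsingTest

end

noncomputable section

namespace IsingTest

open Finset

/-! ### Quadratic forms in the spins -/

/-! Write λ_uv = E[X_u X_v], T = ∑_{u<v} |λ_uv|, b = β/ε, s = n^(2/3), w = s² b, and let K be a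
positive integer with 1/η ≤ K. The exponent τ = 4/3 enters through n^τ = s², n^(2-τ) = s and s³ =
n².

Structure of p. Under Dobrushin's condition one step of Glauber dynamics contracts the maximal
oscillation of a function by 1 - η/n (`HighTemperature.oscLE_glauber`). Reversibility turns this
into a spectral gap (`HighTemperature.poincare`), and summing the increments along the dynamics
gives ∑_v |λ_uv| ≤ 1/η (`HighTemperature.sum_abs_corr_le`). Together they bound the variance of
every quadratic form with coefficients in [-1, 1] by (n/η)² (`HighTemperature.variance_quad_le`).
Comparison with the uniform distribution shows d_SKL(p, I_n) ≤ ∑ θ_uv λ_uv ≤ βT. So p far from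
independent means bT ≥ 1, while for a product distribution all λ_uv with u ≠ v vanish.

The far case. If some |λ_uv| ≥ 1/w, localization sees it by Hoeffding's inequality. Otherwise all
correlations are below 1/w, and with about K² w² samples the sign Γ_uv of the empirical mean is only
slightly biased towards the sign of λ_uv: E[Γ_uv λ_uv] ≥ (w/6) λ_uv² (`walk_sign_mul_ge`,
`IsSample.weakLearn_mean`). By Cauchy-Schwarz the sum over pairs has expectation at least (w/6)
T²/n², and it never exceeds T. A reverse Markov inequality gives a value of at least wT²/(12n²) ≥
1/(12sb) with probability at least wT/(12n²) = bT/(12s) ≥ 1/(12s). Hence one of 60s independent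
learners succeeds except with probability e^(-5).

Testing. A sign vector whose statistic has mean 0 and one whose mean is at least 1/(12sb) are
separated by the threshold 1/(24sb). By the variance bound and Chebyshev's inequality, a block of
order K² n² (sb)² samples errs with probability at most 1/4. A majority vote over a logarithmic
number of blocks makes the error small enough for a union bound over the learners. The votes are
independent of the learned vectors (`measureReal_select_le`), so reusing the test samples does no
harm. Learning costs n^(2-τ) n^(2τ) and testing n^(6-2τ), up to logarithms and b²; they balance at τ
= 4/3.

Running time. Arithmetic terms with sums up to a common bound M compile to polynomial-time programs
as long as M itself, not just its bit length, is polynomial in the input length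
(`Term.exists_yields`). The whole algorithm is such a term: powers of s disappear on cubing, since
s³ = n², and a suitable M is linear in the number of vertices and of sampled spins
(`Constants.ramBound_le`). -/

theorem abs_spin (b : Bool) : |spin b| = 1 := by cases b <;> simp [spin]

theorem spin_not (b : Bool) : spin (!b) = -spin b := by cases b <;> simp [spin]

/-- Separates the pairs that contain `w` from the others, which exhibits a quadratic form as an
affine function of the single spin at `w`. -/
theorem sum_Ioi_eq {n : ℕ} (F : Fin n → Fin n → ℝ) (hF : ∀ u v, F u v = F v u) (w : Fin n) :
    ∑ u, ∑ v ∈ Ioi u, F u v =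
      ∑ u ∈ univ.erase w, F w u + ∑ u ∈ univ.erase w, ∑ v ∈ (Ioi u).erase w, F u v := by
  rw [← add_sum_erase univ _ (mem_univ w)]
  have h1 : ∀ u ∈ univ.erase w, ∑ v ∈ Ioi u, F u v =
      (if u < w then F w u else 0) + ∑ v ∈ (Ioi u).erase w, F u v := by
    intro u _
    split_ifs with h
    · rw [← add_sum_erase (Ioi u) _ (mem_Ioi.2 h), hF u w]
    · rw [erase_eq_of_notMem (by simpa using h), zero_add]
  rw [sum_congr rfl h1, sum_add_distrib, ← add_assoc]
  congr 1
  have h2 : univ.erase w = Ioi w ∪ (univ.erase w).filter (· < w) := by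
    ext u; simp only [mem_erase, mem_univ, mem_union, mem_Ioi, mem_filter]
    constructor
    · rintro ⟨h, _⟩; rcases lt_or_gt_of_ne h with h | h
      · exact Or.inr ⟨⟨h.ne, trivial⟩, h⟩
      · exact Or.inl h
    · rintro (h | ⟨h, _⟩)
      · exact ⟨h.ne', trivial⟩
      · exact h
  rw [← sum_filter]
  conv_rhs => rw [h2]
  rw [sum_union]
  rw [disjoint_left]
  intro u hu hu'
  simp only [mem_Ioi, mem_filter] at hu hu'
  exact absurd hu'.2 hu.le.not_gt

/-- The quadratic form `∑_{u < v} A_{uv} x_u x_v`. -/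
def quad {n : ℕ} (A : Fin n → Fin n → ℝ) (x : Config n) : ℝ :=
  ∑ u, ∑ v ∈ Ioi u, A u v * (spin (x u) * spin (x v))

/-- The part of a quadratic form that does not involve the vertex `w`. -/
def quadOff {n : ℕ} (A : Fin n → Fin n → ℝ) (w : Fin n) (x : Config n) : ℝ :=
  ∑ u ∈ univ.erase w, ∑ v ∈ (Ioi u).erase w, A u v * (spin (x u) * spin (x v))

theorem quad_update {n : ℕ} (A : Fin n → Fin n → ℝ) (hA : ∀ u v, A u v = A v u) (w : Fin n)
    (x : Config n) (b : Bool) :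
    quad A (Function.update x w b) =
      spin b * ∑ u ∈ univ.erase w, A w u * spin (x u) + quadOff A w x := by
  unfold quad quadOff
  rw [sum_Ioi_eq _ (fun u v => by rw [hA, mul_comm (spin _)]) w, mul_sum]
  congr 1
  · refine sum_congr rfl fun u hu => ?_
    rw [Function.update_self, Function.update_of_ne (ne_of_mem_erase hu)]; ring
  · refine sum_congr rfl fun u hu => sum_congr rfl fun v hv => ?_
    rw [Function.update_of_ne (ne_of_mem_erase hu), Function.update_of_ne (ne_of_mem_erase hv)]

/-! ### Sums over configurations -/

/-- Flipping the spin at `v` is an involution on configurations. This reduces identities about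
expectations to identities on pairs of configurations that differ only at `v`. -/
theorem sum_config_update {n : ℕ} (v : Fin n) (F : Config n → ℝ) :
    ∑ x, F x = (∑ x, (F (Function.update x v true) + F (Function.update x v false))) / 2 := by
  have h1 : ∀ x : Config n, F (Function.update x v true) + F (Function.update x v false) =
      F x + F (Function.update x v (!x v)) := by
    intro x
    cases h : x v
    · have : Function.update x v false = x := by rw [← h, Function.update_eq_self]
      rw [this, add_comm]; rfl
    · have : Function.update x v true = x := by rw [← h, Function.update_eq_self]
      rw [this]; rfl
  have hinv : Function.Involutive fun x : Config n => Function.update x v (!x v) := by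
    intro x; simp
  have h2 : ∑ x, F (Function.update x v (!x v)) = ∑ x, F x :=
    Equiv.sum_comp hinv.toPerm F
  rw [sum_congr rfl fun x _ => h1 x, sum_add_distrib, h2]; ring

namespace IsingModel

variable {n : ℕ} (p : IsingModel n)

/-- Expectation under an Ising model. -/
def expect (f : Config n → ℝ) : ℝ := ∑ x, p.prob x * f x

theorem prob_pos (x : Config n) : 0 < p.prob x := Real.exp_pos _

theorem expect_add (f g : Config n → ℝ) :
    p.expect (fun x => f x + g x) = p.expect f + p.expect g := by
  simp [expect, mul_add, sum_add_distrib]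

theorem expect_sub (f g : Config n → ℝ) :
    p.expect (fun x => f x - g x) = p.expect f - p.expect g := by
  simp [expect, mul_sub, sum_sub_distrib]

theorem expect_const_mul (c : ℝ) (f : Config n → ℝ) :
    p.expect (fun x => c * f x) = c * p.expect f := by
  simp only [expect, mul_sum]
  exact sum_congr rfl fun x _ => by ring

theorem expect_const (c : ℝ) : p.expect (fun _ => c) = c := by
  simp [expect, ← sum_mul, p.sum_prob]

theorem expect_sum {ι : Type*} (s : Finset ι) (f : ι → Config n → ℝ) :
    p.expect (fun x => ∑ i ∈ s, f i x) = ∑ i ∈ s, p.expect (f i) := by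
  simp only [expect, mul_sum]
  exact sum_comm

theorem expect_mono {f g : Config n → ℝ} (h : ∀ x, f x ≤ g x) : p.expect f ≤ p.expect g :=
  sum_le_sum fun x _ => mul_le_mul_of_nonneg_left (h x) (p.prob_pos x).le

theorem expect_nonneg {f : Config n → ℝ} (h : ∀ x, 0 ≤ f x) : 0 ≤ p.expect f :=
  sum_nonneg fun x _ => mul_nonneg (p.prob_pos x).le (h x)

theorem abs_expect_le {f : Config n → ℝ} {b : ℝ} (h : ∀ x, |f x| ≤ b) : |p.expect f| ≤ b := by
  rw [abs_le]
  constructor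
  · rw [← p.expect_const (-b)]; exact p.expect_mono fun x => (abs_le.1 (h x)).1
  · rw [← p.expect_const b]; exact p.expect_mono fun x => (abs_le.1 (h x)).2

theorem expect_mul_sq_le (f g : Config n → ℝ) :
    p.expect (fun x => f x * g x) ^ 2 ≤
      p.expect (fun x => f x ^ 2) * p.expect (fun x => g x ^ 2) := by
  have h := sum_mul_sq_le_sq_mul_sq univ (fun x => √(p.prob x) * f x) (fun x => √(p.prob x) * g x)
  have hs : ∀ x, √(p.prob x) * √(p.prob x) = p.prob x := fun x =>
    Real.mul_self_sqrt (p.prob_pos x).le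
  have h1 : ∀ x, √(p.prob x) * f x * (√(p.prob x) * g x) = p.prob x * (f x * g x) := by
    intro x; linear_combination (f x * g x) * hs x
  have h2 : ∀ (f : Config n → ℝ) (x), (√(p.prob x) * f x) ^ 2 = p.prob x * f x ^ 2 := by
    intro f x; linear_combination (f x ^ 2) * hs x
  simpa only [h1, h2, expect] using h

/-! ### Heat-bath updates -/

/-- The field at `v` caused by the other spins. -/
def field (v : Fin n) (x : Config n) : ℝ :=
  p.node v + ∑ u ∈ univ.erase v, p.edge v u * spin (x u)

theorem field_update_self (v : Fin n) (x : Config n) (b : Bool) :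
    p.field v (Function.update x v b) = p.field v x := by
  unfold field
  congr 1
  exact sum_congr rfl fun u hu => by rw [Function.update_of_ne (ne_of_mem_erase hu)]

theorem field_update (u v : Fin n) (h : u ≠ v) (x : Config n) (b : Bool) :
    p.field v (Function.update x u b) = p.field v (Function.update x u true)
      - p.edge v u + p.edge v u * spin b := by
  unfold field
  have hu : u ∈ univ.erase v := mem_erase.2 ⟨h, mem_univ u⟩
  rw [← add_sum_erase _ _ hu, ← add_sum_erase _ _ hu]
  have : ∀ c, ∑ w ∈ (univ.erase v).erase u, p.edge v w * spin (Function.update x u c w) =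
      ∑ w ∈ (univ.erase v).erase u, p.edge v w * spin (x w) := fun c =>
    sum_congr rfl fun w hw => by rw [Function.update_of_ne (ne_of_mem_erase hw)]
  simp only [this, Function.update_self]
  simp [spin]; ring

theorem energy_update (v : Fin n) (x : Config n) (b : Bool) :
    p.energy (Function.update x v b) = spin b * p.field v x +
      (∑ u ∈ univ.erase v, p.node u * spin (x u) + quadOff p.edge v x) := by
  unfold energy
  have h := quad_update p.edge p.edge_symm v x b
  rw [quad] at h
  rw [h, ← add_sum_erase _ _ (mem_univ v), Function.update_self]
  have : ∑ w ∈ univ.erase v, p.node w * spin (Function.update x v b w) =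
      ∑ w ∈ univ.erase v, p.node w * spin (x w) :=
    sum_congr rfl fun w hw => by rw [Function.update_of_ne (ne_of_mem_erase hw)]
  rw [this, field]; ring

/-- The probability of all spins but the one at `v`. -/
def pairProb (v : Fin n) (x : Config n) : ℝ :=
  p.prob (Function.update x v true) + p.prob (Function.update x v false)

/-- The energy is affine in the spin at `v` with slope the local field h, so given the other spins
this spin has weights e^(±h) / (e^h + e^(-h)), that is, conditional mean tanh h. -/
theorem prob_update (v : Fin n) (x : Config n) (b : Bool) :
    p.prob (Function.update x v b) =
      p.pairProb v x * ((1 + spin b * Real.tanh (p.field v x)) / 2) := by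
  unfold pairProb prob
  simp only [energy_update]
  set r := ∑ u ∈ univ.erase v, p.node u * spin (x u) + quadOff p.edge v x
  set h := p.field v x
  have hc : Real.exp h + Real.exp (-h) ≠ 0 := by positivity
  rw [Real.tanh_eq]
  cases b <;> simp only [spin, Bool.false_eq_true, if_true, if_false, sub_eq_add_neg, add_assoc,
    Real.exp_add, neg_mul, one_mul] <;> field_simp <;> ring

/-- Resampling of the spin at `v`, acting on functions. -/
def heat (v : Fin n) (f : Config n → ℝ) (x : Config n) : ℝ :=
  (1 + Real.tanh (p.field v x)) / 2 * f (Function.update x v true) +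
    (1 - Real.tanh (p.field v x)) / 2 * f (Function.update x v false)

theorem heat_update_self (v : Fin n) (f : Config n → ℝ) (x : Config n) (b : Bool) :
    p.heat v f (Function.update x v b) = p.heat v f x := by
  simp [heat, field_update_self]

/-- Resampling is conditional expectation given the other spins. The right side is symmetric in `f`
and `g`, which is reversibility. -/
theorem expect_mul_heat (v : Fin n) (f g : Config n → ℝ) :
    p.expect (fun x => g x * p.heat v f x) =
      (∑ x, p.pairProb v x * (p.heat v g x * p.heat v f x)) / 2 := by
  unfold expect
  rw [sum_config_update v]
  congr 1
  refine sum_congr rfl fun x _ => ?_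
  simp only [heat_update_self, prob_update]
  simp only [heat, spin, if_true, Bool.false_eq_true, if_false]
  ring

theorem expect_heat_comm (v : Fin n) (f g : Config n → ℝ) :
    p.expect (fun x => g x * p.heat v f x) = p.expect (fun x => p.heat v g x * f x) := by
  have h : (fun x => p.heat v g x * f x) = fun x => f x * p.heat v g x := by ext; ring
  rw [h, expect_mul_heat, expect_mul_heat]
  simp only [mul_comm (p.heat v g _)]

/-- The difference of a function in the direction `v`. -/
def diff (v : Fin n) (f : Config n → ℝ) (x : Config n) : ℝ :=
  f (Function.update x v true) - f (Function.update x v false)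

/-- Both sides average the conditional covariance of `f` and `g` given the spins off `v`: there each
function is affine in the spin with slope half its difference, and a sign of mean t has variance 1 -
t². -/
theorem expect_mul_sub_heat (v : Fin n) (f g : Config n → ℝ) :
    p.expect (fun x => g x * (f x - p.heat v f x)) =
      p.expect (fun x => (1 - Real.tanh (p.field v x) ^ 2) / 4 * (diff v g x * diff v f x)) := by
  unfold expect
  rw [sum_config_update v (fun x => p.prob x * (g x * _)),
    sum_config_update v (fun x => p.prob x * (_ / 4 * _))]
  congr 1
  refine sum_congr rfl fun x _ => ?_
  simp only [heat_update_self, prob_update, diff, field_update_self, Function.update_idem]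
  simp only [heat, spin, if_true, Bool.false_eq_true, if_false]
  ring

theorem heat_const (v : Fin n) (c : ℝ) (x : Config n) : p.heat v (fun _ => c) x = c := by
  simp only [heat]; ring

/-- One step of Glauber dynamics, acting on functions. -/
def glauber (f : Config n → ℝ) (x : Config n) : ℝ := (∑ v, p.heat v f x) / n

theorem expect_glauber_comm (f g : Config n → ℝ) :
    p.expect (fun x => g x * p.glauber f x) = p.expect (fun x => p.glauber g x * f x) := by
  have h1 : (fun x => g x * p.glauber f x) = fun x => ∑ v, (1 / n : ℝ) * (g x * p.heat v f x) := by
    ext x; rw [glauber, ← mul_sum, ← mul_sum]; ring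
  have h2 : (fun x => p.glauber g x * f x) = fun x => ∑ v, (1 / n : ℝ) * (p.heat v g x * f x) := by
    ext x; rw [glauber, ← mul_sum, ← sum_mul]; ring
  rw [h1, h2, expect_sum, expect_sum]
  exact sum_congr rfl fun v _ => by
    rw [expect_const_mul, expect_const_mul, expect_heat_comm]

theorem expect_glauber (hn : 0 < n) (f : Config n → ℝ) :
    p.expect (p.glauber f) = p.expect f := by
  have h := p.expect_glauber_comm f (fun _ => 1)
  have h1 : p.glauber (fun _ => 1) = fun _ => 1 := by
    ext x; simp [glauber, heat_const, hn.ne']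
  simpa [h1] using h

/-! ### Contraction of the maximal oscillation -/

end IsingModel

/-- The difference is sinh 2t / (cosh(a+t) cosh(a-t)), and the denominator cosh² t + sinh² a is
least at a = 0. -/
theorem abs_tanh_add_sub_le (a t : ℝ) :
    |Real.tanh (a + t) - Real.tanh (a - t)| ≤ 2 * Real.tanh |t| := by
  wlog ht : 0 ≤ t generalizing t
  · have := this (-t) (by linarith)
    rw [abs_neg] at this
    rw [abs_sub_comm]; simpa [sub_eq_add_neg] using this
  rw [abs_of_nonneg ht, Real.tanh_eq_sinh_div_cosh, Real.tanh_eq_sinh_div_cosh,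
    Real.tanh_eq_sinh_div_cosh, div_sub_div _ _ (Real.cosh_pos _).ne' (Real.cosh_pos _).ne',
    ← Real.sinh_sub, abs_div, abs_of_pos (mul_pos (Real.cosh_pos _) (Real.cosh_pos _)),
    div_le_iff₀ (mul_pos (Real.cosh_pos _) (Real.cosh_pos _))]
  have e : a + t - (a - t) = 2 * t := by ring
  have hs : 0 ≤ Real.sinh t := Real.sinh_nonneg_iff.2 ht
  rw [e, Real.sinh_two_mul, abs_of_nonneg (by positivity), Real.cosh_add, Real.cosh_sub]
  have hc := Real.cosh_pos t
  have h1 := Real.cosh_sq a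
  have h2 := Real.cosh_sq t
  have : (Real.cosh a * Real.cosh t + Real.sinh a * Real.sinh t) *
      (Real.cosh a * Real.cosh t - Real.sinh a * Real.sinh t) =
      Real.cosh t ^ 2 + Real.sinh a ^ 2 := by
    have : (Real.cosh a * Real.cosh t + Real.sinh a * Real.sinh t) *
      (Real.cosh a * Real.cosh t - Real.sinh a * Real.sinh t) =
      Real.cosh a ^ 2 * Real.cosh t ^ 2 - Real.sinh a ^ 2 * Real.sinh t ^ 2 := by ring
    rw [this, h1, h2]; ring
  rw [this]
  have h3 : 2 * Real.sinh t * Real.cosh t = 2 * (Real.sinh t / Real.cosh t) * Real.cosh t ^ 2 := by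
    field_simp
  rw [h3]
  have : 0 ≤ 2 * (Real.sinh t / Real.cosh t) := by positivity
  exact mul_le_mul_of_nonneg_left (by nlinarith [sq_nonneg (Real.sinh a)]) this

theorem tanh_abs_nonneg (a : ℝ) : 0 ≤ Real.tanh |a| := by
  rw [Real.tanh_eq_sinh_div_cosh]
  exact div_nonneg (Real.sinh_nonneg_iff.2 (abs_nonneg a)) (Real.cosh_pos _).le

theorem abs_tanh_lt_one (a : ℝ) : |Real.tanh a| < 1 :=
  abs_lt.2 ⟨Real.neg_one_lt_tanh a, Real.tanh_lt_one a⟩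

namespace IsingModel

variable {n : ℕ} (p : IsingModel n)

/-- All differences of `f` are bounded by `b`. -/
def OscLE (f : Config n → ℝ) (b : ℝ) : Prop := ∀ v x, |diff v f x| ≤ b

/-- A change of the spin at `u` acts on the resampled function in two ways: directly, by at most
`b`, and through the law of the new spin at `v`, whose probabilities move by at most tanh |θ_uv|,
which costs a difference in direction `v`. -/
theorem abs_diff_heat_le {f : Config n → ℝ} {b : ℝ} (hf : OscLE f b) {u v : Fin n}
    (h : u ≠ v) (x : Config n) :
    |diff u (p.heat v f) x| ≤ b + Real.tanh |p.edge u v| * b := by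
  have hb : 0 ≤ b := (abs_nonneg _).trans (hf v x)
  simp only [diff, heat]
  have e1 : p.field v (Function.update x u false) =
      p.field v (Function.update x u true) - p.edge v u - p.edge v u := by
    rw [p.field_update u v h x false]; simp [spin]; ring
  set F1 := p.field v (Function.update x u true) with hF1
  have htanh := abs_tanh_add_sub_le (F1 - p.edge v u) (p.edge v u)
  rw [e1]
  rw [sub_add_cancel] at htanh
  rw [p.edge_symm u v]
  set s := Real.tanh F1
  set t := Real.tanh (F1 - p.edge v u - p.edge v u)
  have d1 := hf u (Function.update x v true)
  have d2 := hf u (Function.update x v false)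
  have d3 := hf v (Function.update x u false)
  simp only [diff] at d1 d2 d3
  rw [Function.update_comm h.symm, Function.update_comm h.symm] at d1 d2
  have hs := abs_lt.1 (abs_tanh_lt_one F1)
  set A := f (Function.update (Function.update x u true) v true)
  set B := f (Function.update (Function.update x u true) v false)
  set C := f (Function.update (Function.update x u false) v true)
  set D := f (Function.update (Function.update x u false) v false)
  have e : (1 + s) / 2 * A + (1 - s) / 2 * B - ((1 + t) / 2 * C + (1 - t) / 2 * D) =
      (1 + s) / 2 * (A - C) + (1 - s) / 2 * (B - D) + (s - t) / 2 * (C - D) := by ring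
  rw [e]
  have hs1 : 0 ≤ (1 + s) / 2 := by linarith
  have hs2 : 0 ≤ (1 - s) / 2 := by linarith
  calc _ ≤ |(1 + s) / 2 * (A - C)| + |(1 - s) / 2 * (B - D)| + |(s - t) / 2 * (C - D)| :=
        abs_add_three _ _ _
    _ ≤ (1 + s) / 2 * b + (1 - s) / 2 * b + Real.tanh |p.edge v u| * b := by
        rw [abs_mul, abs_mul, abs_mul, abs_of_nonneg hs1, abs_of_nonneg hs2, abs_div,
          abs_of_pos (two_pos : (0 : ℝ) < 2)]
        have : |s - t| / 2 ≤ Real.tanh |p.edge v u| := by linarith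
        gcongr
        exact tanh_abs_nonneg _
    _ = _ := by ring

/-- The update at `u` erases the difference in direction `u`; each of the other n - 1 updates
retains it and adds a tanh term. Dobrushin's condition bounds the added terms by 1 - η in total, so
the n updates keep (n - η) b. -/
theorem HighTemperature.oscLE_glauber {p : IsingModel n} {η : ℝ} (hp : p.HighTemperature η)
    {f : Config n → ℝ} {b : ℝ} (hf : OscLE f b) : OscLE (p.glauber f) (b * (1 - η / n)) := by
  intro u x
  have hn : (0 : ℝ) < n := by exact_mod_cast u.pos
  have hb : 0 ≤ b := (abs_nonneg _).trans (hf u x)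
  have h1 : diff u (p.glauber f) x = (∑ v, diff u (p.heat v f) x) / n := by
    simp only [diff, glauber, ← sum_sub_distrib, ← sub_div]
  rw [h1, abs_div, abs_of_pos hn, div_le_iff₀ hn]
  have h0 : diff u (p.heat u f) x = 0 := by simp [diff, heat_update_self]
  rw [← add_sum_erase _ _ (mem_univ u), h0, zero_add]
  calc _ ≤ ∑ v ∈ univ.erase u, |diff u (p.heat v f) x| := abs_sum_le_sum_abs _ _
    _ ≤ ∑ v ∈ univ.erase u, (b + Real.tanh |p.edge v u| * b) := by
        refine sum_le_sum fun v hv => ?_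
        rw [p.edge_symm v u]
        exact p.abs_diff_heat_le hf (ne_of_mem_erase hv).symm x
    _ = (n - 1 : ℝ) * b + (∑ v ∈ univ.erase u, Real.tanh |p.edge v u|) * b := by
        rw [sum_add_distrib, ← sum_mul]
        simp only [sum_const, card_erase_of_mem (mem_univ u), card_univ, Fintype.card_fin,
          nsmul_eq_mul]
        rw [Nat.cast_sub u.pos, Nat.cast_one]
    _ ≤ (n - 1 : ℝ) * b + (1 - η) * b := by gcongr; exact hp u
    _ = _ := by field_simp; ring

/-- Pass from `y` to `x` by changing one coordinate at a time. -/
theorem OscLE.abs_sub_le {f : Config n → ℝ} {b : ℝ} (hf : OscLE f b) (x y : Config n) :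
    |f x - f y| ≤ n * b := by
  have key : ∀ s : Finset (Fin n), |f (s.piecewise x y) - f y| ≤ #s * b := by
    intro s
    induction s using Finset.induction_on with
    | empty => simp
    | insert a s ha ih =>
      have hstep : |f ((insert a s).piecewise x y) - f (s.piecewise x y)| ≤ b := by
        rw [piecewise_insert]
        have h := hf a (s.piecewise x y)
        have hb : 0 ≤ b := (abs_nonneg _).trans h
        have hself : s.piecewise x y = Function.update (s.piecewise x y) a (y a) := by
          rw [eq_comm, Function.update_eq_self_iff, piecewise_eq_of_notMem _ _ _ ha]
        conv_lhs => rw [hself, Function.update_idem]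
        simp only [diff] at h
        cases x a <;> cases y a
        · simpa using hb
        · rwa [abs_sub_comm]
        · exact h
        · simpa using hb
      rw [card_insert_of_notMem ha]; push_cast
      calc _ ≤ |f ((insert a s).piecewise x y) - f (s.piecewise x y)| +
            |f (s.piecewise x y) - f y| := _root_.abs_sub_le _ _ _
        _ ≤ _ := by linarith
  simpa using key univ

theorem OscLE.abs_le_of_expect_eq_zero {p : IsingModel n} {f : Config n → ℝ} {b : ℝ}
    (hf : OscLE f b) (h0 : p.expect f = 0) (x : Config n) : |f x| ≤ n * b := by
  have h : f x = p.expect fun y => f x - f y := by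
    rw [p.expect_sub (fun _ => f x) f, p.expect_const, h0, sub_zero]
  rw [h]
  exact p.abs_expect_le fun y => hf.abs_sub_le x y

theorem exists_oscLE (f : Config n → ℝ) : ∃ b, 0 ≤ b ∧ OscLE f b := by
  refine ⟨∑ v, ∑ x, |diff v f x|, by positivity, fun v x => ?_⟩
  calc |diff v f x| ≤ ∑ x, |diff v f x| :=
        single_le_sum (f := fun x => |diff v f x|) (fun _ _ => abs_nonneg _) (mem_univ x)
    _ ≤ _ := single_le_sum (f := fun v => ∑ x, |diff v f x|)
        (fun _ _ => by positivity) (mem_univ v)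

theorem HighTemperature.oscLE_iterate {p : IsingModel n} {η : ℝ} (hp : p.HighTemperature η)
    {f : Config n → ℝ} {b : ℝ} (hf : OscLE f b) (t : ℕ) :
    OscLE (p.glauber^[t] f) (b * (1 - η / n) ^ t) := by
  induction t with
  | zero => simpa using hf
  | succ t ih =>
    rw [Function.iterate_succ_apply']
    have := hp.oscLE_glauber ih
    rwa [mul_assoc, ← pow_succ] at this

theorem expect_iterate (hn : 0 < n) (f : Config n → ℝ) (t : ℕ) :
    p.expect (p.glauber^[t] f) = p.expect f := by
  induction t with
  | zero => rfl
  | succ t ih => rw [Function.iterate_succ_apply', p.expect_glauber hn, ih]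

theorem HighTemperature.le_one {p : IsingModel n} {η : ℝ} (hp : p.HighTemperature η)
    (hn : 0 < n) : η ≤ 1 := by
  have := hp ⟨0, hn⟩
  have h2 : 0 ≤ ∑ u ∈ univ.erase (⟨0, hn⟩ : Fin n), Real.tanh |p.edge u ⟨0, hn⟩| :=
    sum_nonneg fun u _ => tanh_abs_nonneg _
  linarith

end IsingModel

/-- Log-convexity makes the ratios of successive terms nondecreasing. If the first ratio exceeded
`q`, the sequence would outgrow every multiple of q^t. -/
theorem ratio_le_of_log_convex {b : ℕ → ℝ} {C q : ℝ} (hb : ∀ t, 0 ≤ b t) (hq : 0 ≤ q)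
    (hconv : ∀ t, b (t + 1) ^ 2 ≤ b t * b (t + 2)) (hC : ∀ t, b t ≤ C * q ^ t) :
    b 1 ≤ q * b 0 := by
  by_contra! h
  have hb1 : 0 < b 1 := lt_of_le_of_lt (mul_nonneg hq (hb 0)) h
  have hb0 : 0 < b 0 := by
    rcases (hb 0).eq_or_lt with h0 | h0
    · have := hconv 0; rw [← h0] at this; nlinarith
    · exact h0
  set r := b 1 / b 0 with hr
  have hr0 : 0 < r := div_pos hb1 hb0
  have hqr : q < r := by rw [hr, lt_div_iff₀ hb0]; exact h
  have hstep : ∀ t, 0 < b t ∧ r * b t ≤ b (t + 1) := by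
    intro t
    induction t with
    | zero => exact ⟨hb0, by rw [hr]; field_simp; exact le_rfl⟩
    | succ t ih =>
      have hpos : 0 < b (t + 1) := lt_of_lt_of_le (mul_pos hr0 ih.1) ih.2
      refine ⟨hpos, ?_⟩
      have := hconv t
      have h3 : r * b t * b (t + 1) ≤ b t * b (t + 2) := by nlinarith
      have h4 : b t * (r * b (t + 1)) ≤ b t * b (t + 2) := by linarith
      exact le_of_mul_le_mul_left h4 ih.1
  have hpow : ∀ t, r ^ t * b 0 ≤ b t := by
    intro t
    induction t with
    | zero => simp
    | succ t ih =>
      calc r ^ (t + 1) * b 0 = r * (r ^ t * b 0) := by ring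
        _ ≤ r * b t := by gcongr
        _ ≤ _ := (hstep t).2
  have hlim : Filter.Tendsto (fun t => C * (q / r) ^ t) Filter.atTop (nhds (C * 0)) :=
    (tendsto_pow_atTop_nhds_zero_of_lt_one (by positivity)
      ((div_lt_one hr0).2 hqr)).const_mul C
  have : b 0 ≤ C * 0 := by
    refine ge_of_tendsto' hlim fun t => ?_
    rw [div_pow, ← mul_div_assoc, le_div_iff₀ (by positivity)]
    linarith [hpow t, hC t]
  linarith

/-! ### Poincaré inequality at high temperature -/

namespace IsingModel

variable {n : ℕ} {p : IsingModel n}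

/-- Let P be the Glauber operator. As P is self-adjoint, t ↦ ‖P^t f‖² is log-convex, and contraction
of the oscillation bounds it by a multiple of (1 - η/n)^(2t). Hence already ‖Pf‖ ≤ (1 - η/n) ‖f‖,
with no constant lost, and E[f (f - Pf)] ≥ (η/n) E[f²]. The left side is the Dirichlet form. -/
theorem HighTemperature.poincare {η : ℝ} (hp : p.HighTemperature η) (hη : 0 < η) (hn : 0 < n)
    {f : Config n → ℝ} (h0 : p.expect f = 0) :
    p.expect (fun x => f x ^ 2) ≤ (1 / (4 * η)) * ∑ v, p.expect (fun x => diff v f x ^ 2) := by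
  have hn' : (0 : ℝ) < n := by exact_mod_cast hn
  have hq : 0 ≤ 1 - η / n := by
    have : η / n ≤ 1 := by
      rw [div_le_one hn']; exact (hp.le_one hn).trans (by exact_mod_cast hn)
    linarith
  obtain ⟨b, hb0, hb⟩ := exists_oscLE f
  have hconv : ∀ t, p.expect (fun x => p.glauber^[t + 1] f x ^ 2) ^ 2 ≤
      p.expect (fun x => p.glauber^[t] f x ^ 2) *
        p.expect (fun x => p.glauber^[t + 2] f x ^ 2) := by
    intro t
    have h := p.expect_mul_sq_le (p.glauber^[t] f) (p.glauber^[t + 2] f)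
    have h2 : p.expect (fun x => p.glauber^[t] f x * p.glauber^[t + 2] f x) =
        p.expect (fun x => p.glauber^[t + 1] f x ^ 2) := by
      rw [Function.iterate_succ_apply' _ (t + 1), p.expect_glauber_comm,
        ← Function.iterate_succ_apply' p.glauber t]
      simp only [pow_two]
    rwa [h2] at h
  have h1 := ratio_le_of_log_convex (b := fun t => p.expect (fun x => p.glauber^[t] f x ^ 2))
    (C := (n * b) ^ 2) (q := (1 - η / n) ^ 2)
    (fun t => p.expect_nonneg fun x => sq_nonneg _) (sq_nonneg _) hconv (by
      intro t
      have : ∀ x, |p.glauber^[t] f x ^ 2| ≤ (n * b) ^ 2 * ((1 - η / n) ^ 2) ^ t := by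
        intro x
        have := (hp.oscLE_iterate hb t).abs_le_of_expect_eq_zero
          ((p.expect_iterate hn f t).trans h0) x
        rw [abs_pow]
        calc _ ≤ (n * (b * (1 - η / n) ^ t)) ^ 2 := by gcongr
          _ = _ := by rw [← pow_mul, mul_comm 2 t, pow_mul]; ring
      exact (le_abs_self _).trans (p.abs_expect_le this))
  simp only [Function.iterate_one, Function.iterate_zero, id] at h1
  set V := p.expect (fun x => f x ^ 2) with hV
  have hV0 : 0 ≤ V := p.expect_nonneg fun x => sq_nonneg _
  have h2 : p.expect (fun x => f x * p.glauber f x) ≤ (1 - η / n) * V := by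
    have := p.expect_mul_sq_le f (p.glauber f)
    refine abs_le_of_sq_le_sq' ?_ (by positivity) |>.2
    calc _ ≤ V * ((1 - η / n) ^ 2 * V) := this.trans (by gcongr)
      _ = _ := by ring
  have h3 : ∑ v, p.expect (fun x => f x * (f x - p.heat v f x)) =
      n * (V - p.expect (fun x => f x * p.glauber f x)) := by
    rw [← expect_sum, hV, ← expect_sub, ← expect_const_mul]
    congr 1; ext x
    rw [← mul_sum, sum_sub_distrib, glauber]
    simp only [sum_const, card_univ, Fintype.card_fin, nsmul_eq_mul]
    field_simp
  have h4 : η * V ≤ ∑ v, p.expect (fun x => f x * (f x - p.heat v f x)) := by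
    rw [h3]
    have : η * V = n * (V - (1 - η / n) * V) := by field_simp; ring
    rw [this]; gcongr
  have h5 : ∑ v, p.expect (fun x => f x * (f x - p.heat v f x)) ≤
      (1 / 4) * ∑ v, p.expect (fun x => diff v f x ^ 2) := by
    rw [mul_sum]
    refine sum_le_sum fun v _ => ?_
    rw [p.expect_mul_sub_heat, ← expect_const_mul]
    refine p.expect_mono fun x => ?_
    nlinarith [sq_nonneg (Real.tanh (p.field v x)), sq_nonneg (diff v f x),
      mul_nonneg (sq_nonneg (Real.tanh (p.field v x))) (sq_nonneg (diff v f x))]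
  have h6 : V ≤ (1 / η) * ((1 / 4) * ∑ v, p.expect (fun x => diff v f x ^ 2)) := by
    rw [one_div, ← div_eq_inv_mul, le_div_iff₀ hη]; linarith
  calc V ≤ _ := h6
    _ = _ := by field_simp

/-! ### Consequences for covariances and quadratic forms -/

/-- The correlation `E[X_u X_v]`. -/
def corr (p : IsingModel n) (u v : Fin n) : ℝ := p.expect fun x => spin (x u) * spin (x v)

theorem NoExternalField.expect_spin (hp : p.NoExternalField) (u : Fin n) :
    p.expect (fun x => spin (x u)) = 0 := by
  have hinv : Function.Involutive fun x : Config n => fun v => !x v := by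
    intro x; ext; simp
  have he : ∀ x : Config n, p.prob (fun v => !x v) = p.prob x := by
    intro x
    simp only [prob, energy, spin_not, hp _]
    simp
  have h : p.expect (fun x => spin (x u)) = p.expect (fun x => -spin (x u)) := by
    unfold expect
    rw [← Equiv.sum_comp hinv.toPerm]
    exact sum_congr rfl fun x _ => by
      simp only [Function.Involutive.coe_toPerm, he, spin_not]
  have h2 := p.expect_const_mul (-1) (fun x => spin (x u))
  simp only [neg_mul, one_mul] at h2
  linarith

theorem diff_spin_of_ne {u v : Fin n} (h : u ≠ v) (x : Config n) :
    diff v (fun x => spin (x u)) x = 0 := by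
  simp [diff, Function.update_of_ne h]

theorem diff_spin_self (u : Fin n) (x : Config n) : diff u (fun x => spin (x u)) x = 2 := by
  simp [diff, spin]; norm_num

/-- Telescope along g, Pg, P²g, …. In E[X_u (G - PG)] only the update at `u` contributes, since X_u
has no difference in other directions, so the t-th increment is at most b (1 - η/n)^t / (2n). These
sum to b / (2η). The remainder tends to 0, because E[X_u] = 0 permits centring P^t g, whose
oscillation decays. -/
theorem HighTemperature.abs_expect_spin_mul_le {η : ℝ} (hp : p.HighTemperature η) (hη : 0 < η)
    (hf : p.NoExternalField) {g : Config n → ℝ} {b : ℝ} (hg : OscLE g b) (u : Fin n) :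
    |p.expect (fun x => spin (x u) * g x)| ≤ b / (2 * η) := by
  have hn : (0 : ℝ) < n := by exact_mod_cast u.pos
  have hb : 0 ≤ b := (abs_nonneg _).trans (hg u fun _ => true)
  have hq : 0 ≤ 1 - η / n := by
    have : η / n ≤ 1 := by
      rw [div_le_one hn]; exact (hp.le_one u.pos).trans (by exact_mod_cast u.pos)
    linarith
  have hq1 : 1 - η / n < 1 := by have := div_pos hη hn; linarith
  -- one step
  have hone : ∀ {g : Config n → ℝ} {b : ℝ}, OscLE g b →
      |p.expect (fun x => spin (x u) * (g x - p.glauber g x))| ≤ b / (2 * n) := by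
    intro g b hg
    have e1 : (fun x => spin (x u) * (g x - p.glauber g x)) =
        fun x => (1 / n : ℝ) * ∑ v, spin (x u) * (g x - p.heat v g x) := by
      ext x
      rw [← mul_sum, sum_sub_distrib, glauber]
      simp only [sum_const, card_univ, Fintype.card_fin, nsmul_eq_mul]
      field_simp
    rw [e1, expect_const_mul, expect_sum, sum_eq_single u]
    · rw [p.expect_mul_sub_heat u g (fun x => spin (x u)), abs_mul,
        abs_of_pos (one_div_pos.2 hn)]
      have : |p.expect fun x => (1 - Real.tanh (p.field u x) ^ 2) / 4 *
          (diff u (fun x => spin (x u)) x * diff u g x)| ≤ b / 2 := by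
        refine p.abs_expect_le fun x => ?_
        rw [diff_spin_self, abs_mul, abs_mul]
        have h1 : |(1 - Real.tanh (p.field u x) ^ 2) / 4| ≤ 1 / 4 := by
          have h0 := (sq_lt_one_iff_abs_lt_one _).2 (abs_tanh_lt_one (p.field u x))
          rw [abs_of_nonneg (by linarith)]
          nlinarith [sq_nonneg (Real.tanh (p.field u x))]
        calc _ ≤ 1 / 4 * (|2| * b) := by gcongr; exact hg u x
          _ = b / 2 := by norm_num; ring
      calc 1 / (n : ℝ) * _ ≤ 1 / (n : ℝ) * (b / 2) := by gcongr
        _ = _ := by field_simp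
    · intro v _ hv
      rw [p.expect_mul_sub_heat v g (fun x => spin (x u))]
      simp only [diff_spin_of_ne hv.symm, zero_mul, mul_zero]
      exact p.expect_const 0
    · intro h; exact absurd (mem_univ u) h
  have hiter : ∀ t : ℕ, |p.expect (fun x => spin (x u) * g x)| ≤
      b / (2 * η) * (1 - (1 - η / n) ^ t) +
        |p.expect (fun x => spin (x u) * p.glauber^[t] g x)| := by
    intro t
    induction t with
    | zero => simp
    | succ t ih =>
      have h1 := hone (hp.oscLE_iterate hg t)
      simp only [mul_sub] at h1
      rw [p.expect_sub] at h1
      rw [Function.iterate_succ_apply']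
      set A := p.expect (fun x => spin (x u) * p.glauber^[t] g x)
      set B := p.expect (fun x => spin (x u) * p.glauber (p.glauber^[t] g) x)
      have h2 : |A| ≤ |B| + |A - B| := by
        have := abs_add_le B (A - B); rwa [add_sub_cancel] at this
      have e : b / (2 * η) * (1 - (1 - η / n) ^ (t + 1)) =
          b / (2 * η) * (1 - (1 - η / n) ^ t) + b * (1 - η / n) ^ t / (2 * n) := by
        rw [pow_succ]; field_simp; ring
      rw [e]; linarith
  have hcent : ∀ t : ℕ, |p.expect (fun x => spin (x u) * p.glauber^[t] g x)| ≤
      n * b * (1 - η / n) ^ t := by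
    intro t
    have hosc := hp.oscLE_iterate hg t
    set G := p.glauber^[t] g
    have e : p.expect (fun x => spin (x u) * G x) =
        p.expect (fun x => spin (x u) * (G x - p.expect G)) := by
      simp only [mul_sub]
      rw [p.expect_sub]
      have : (fun x : Config n => spin (x u) * p.expect G) =
          fun x => p.expect G * spin (x u) := by ext; ring
      rw [this, p.expect_const_mul, hf.expect_spin, mul_zero, sub_zero]
    rw [e]
    refine p.abs_expect_le fun x => ?_
    rw [abs_mul, abs_spin, one_mul]
    have hosc' : OscLE (fun x => G x - p.expect G) (b * (1 - η / n) ^ t) := by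
      intro v x; simpa [diff] using hosc v x
    have := hosc'.abs_le_of_expect_eq_zero (p := p)
      (by rw [p.expect_sub G fun _ => p.expect G, p.expect_const, sub_self]) x
    linarith
  have hlim : Filter.Tendsto (fun t : ℕ => b / (2 * η) * (1 - (1 - η / n) ^ t) +
      n * b * (1 - η / n) ^ t) Filter.atTop
      (nhds (b / (2 * η) * (1 - 0) + n * b * 0)) := by
    have := tendsto_pow_atTop_nhds_zero_of_lt_one hq hq1
    exact ((this.const_sub 1).const_mul _).add (this.const_mul _)
  have := ge_of_tendsto' hlim fun t => (hiter t).trans (add_le_add_right (hcent t) _)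
  simpa using this

/-- Test X_u against the linear form with the signs of the correlations as coefficients; its
differences are ±2. -/
theorem HighTemperature.sum_abs_corr_le {η : ℝ} (hp : p.HighTemperature η) (hη : 0 < η)
    (hf : p.NoExternalField) (u : Fin n) : ∑ v, |p.corr u v| ≤ 1 / η := by
  set s : Fin n → ℝ := fun v => if 0 ≤ p.corr u v then 1 else -1
  have hs : ∀ v, |s v| = 1 := by intro v; simp only [s]; split_ifs <;> simp
  have h1 : ∀ v, |p.corr u v| = s v * p.corr u v := by
    intro v; simp only [s]; split_ifs with h
    · rw [abs_of_nonneg h, one_mul]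
    · rw [abs_of_neg (not_le.1 h)]; ring
  have h2 : ∑ v, |p.corr u v| =
      p.expect (fun x => spin (x u) * ∑ v, s v * spin (x v)) := by
    simp only [mul_sum]
    rw [p.expect_sum]
    refine sum_congr rfl fun v _ => ?_
    rw [h1, corr, ← p.expect_const_mul]
    congr 1; ext x; ring
  have hosc : OscLE (fun x : Config n => ∑ v, s v * spin (x v)) 2 := by
    intro w x
    simp only [diff]
    rw [← sum_sub_distrib, sum_eq_single w]
    · simp only [Function.update_self]
      rw [← mul_sub, abs_mul, hs]; norm_num [spin]
    · intro v _ hv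
      simp [Function.update_of_ne hv]
    · intro h; exact absurd (mem_univ w) h
  have h3 := hp.abs_expect_spin_mul_le hη hf hosc u
  rw [← h2, abs_of_nonneg (by positivity)] at h3
  calc _ ≤ _ := h3
    _ = 1 / η := by field_simp

/-- The difference of the form in direction `v` is twice a linear form in the other spins. Its
second moment is a sum of correlations with coefficients in [-1, 1], hence at most n/η by the row
bound, and the Poincaré inequality sums this over `v`. -/
theorem HighTemperature.variance_quad_le {η : ℝ} (hp : p.HighTemperature η) (hη : 0 < η)
    (hf : p.NoExternalField) (A : Fin n → Fin n → ℝ) (hA : ∀ u v, A u v = A v u)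
    (hA1 : ∀ u v, |A u v| ≤ 1) :
    p.expect (fun x => (quad A x - p.expect (quad A)) ^ 2) ≤ (n / η) ^ 2 := by
  rcases Nat.eq_zero_or_pos n with rfl | hn
  · have : ∀ x : Config 0, (quad A x - p.expect (quad A)) ^ 2 = 0 := by
      intro x; simp [quad, expect]
    simp only [this]; rw [p.expect_const]; positivity
  have hn' : (0 : ℝ) < n := by exact_mod_cast hn
  have h := hp.poincare hη hn (f := fun x => quad A x - p.expect (quad A))
    (by rw [p.expect_sub (quad A) fun _ => p.expect (quad A), p.expect_const, sub_self])
  refine h.trans ?_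
  have hv : ∀ v, p.expect (fun x => diff v (fun x => quad A x - p.expect (quad A)) x ^ 2) ≤
      4 * (n / η) := by
    intro v
    have e : (fun x => diff v (fun x => quad A x - p.expect (quad A)) x ^ 2) =
        fun x => 4 * ∑ u ∈ univ.erase v, ∑ w ∈ univ.erase v,
          A v u * A v w * (spin (x u) * spin (x w)) := by
      ext x
      simp only [diff, quad_update A hA]
      have : ∀ S c d : ℝ, (spin true * S + c - d - (spin false * S + c - d)) ^ 2 =
          4 * (S * S) := by intro S c d; simp [spin]; ring
      rw [this, sum_mul_sum]
      congr 1
      exact sum_congr rfl fun u _ => sum_congr rfl fun w _ => by ring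
    rw [e, p.expect_const_mul, p.expect_sum]
    gcongr
    calc _ ≤ ∑ u ∈ univ.erase v, ∑ w, |p.corr u w| := by
          refine sum_le_sum fun u _ => ?_
          rw [p.expect_sum]
          refine le_trans (sum_le_sum fun w _ => ?_)
            (sum_le_sum_of_subset_of_nonneg (erase_subset v univ) fun _ _ _ => abs_nonneg _)
          rw [p.expect_const_mul]
          refine (le_abs_self _).trans ?_
          rw [abs_mul, abs_mul]
          calc _ ≤ 1 * 1 * |p.corr u w| := by
                exact mul_le_mul (mul_le_mul (hA1 v u) (hA1 v w) (abs_nonneg _) zero_le_one)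
                  le_rfl (abs_nonneg _) (by norm_num)
            _ = _ := by ring
      _ ≤ ∑ u ∈ univ.erase v, 1 / η := sum_le_sum fun u _ => hp.sum_abs_corr_le hη hf u
      _ ≤ ∑ u : Fin n, 1 / η :=
          sum_le_sum_of_subset_of_nonneg (erase_subset v univ) fun _ _ _ => by positivity
      _ = n / η := by
          simp only [sum_const, card_univ, Fintype.card_fin, nsmul_eq_mul]; ring
  calc _ ≤ 1 / (4 * η) * ∑ v : Fin n, 4 * (n / η) := by
        gcongr with v; exact hv v
    _ = (n / η) ^ 2 := by
        simp only [sum_const, card_univ, Fintype.card_fin, nsmul_eq_mul]; field_simp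

end IsingModel

end IsingTest

end

noncomputable section

namespace IsingTest

open Finset

/-! ### Symmetric divergence from the uniform distribution -/

namespace IsingModel

variable {n : ℕ} (p q : IsingModel n)

instance : IsProbabilityMeasure p.law := by unfold law; infer_instance

theorem law_singleton (x : Config n) : p.law {x} = ENNReal.ofReal (p.prob x) := by
  rw [law, PMF.toMeasure_apply_singleton _ _ (measurableSet_singleton x)]
  simp [pmf]

theorem integral_law (f : Config n → ℝ) : ∫ x, f x ∂p.law = p.expect f := by
  rw [integral_fintype Integrable.of_finite, expect]
  refine sum_congr rfl fun x _ => ?_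
  rw [measureReal_def, p.law_singleton, ENNReal.toReal_ofReal (p.prob_pos x).le, smul_eq_mul]

theorem law_eq_withDensity :
    p.law = q.law.withDensity fun x => ENNReal.ofReal (p.prob x / q.prob x) := by
  refine Measure.ext_of_singleton fun x => ?_
  rw [withDensity_apply _ (measurableSet_singleton x), lintegral_singleton, law_singleton,
    law_singleton, ← ENNReal.ofReal_mul (div_pos (p.prob_pos x) (q.prob_pos x)).le,
    div_mul_cancel₀ _ (q.prob_pos x).ne']

theorem law_absolutelyContinuous : p.law ≪ q.law := by
  rw [p.law_eq_withDensity q]; exact withDensity_absolutelyContinuous _ _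

/-- The nonnegativity is recorded because adding two divergences requires merging two values of
`ENNReal.ofReal`. -/
theorem klDiv_law : InformationTheory.klDiv p.law q.law =
    ENNReal.ofReal (p.expect fun x => Real.log (p.prob x) - Real.log (q.prob x)) ∧
    0 ≤ p.expect fun x => Real.log (p.prob x) - Real.log (q.prob x) := by
  have hac := p.law_absolutelyContinuous q
  have h := InformationTheory.toReal_klDiv_of_measure_eq hac (by simp)
  have h2 : ∫ x, llr p.law q.law x ∂p.law =
      p.expect fun x => Real.log (p.prob x) - Real.log (q.prob x) := by
    rw [← integral_law]
    refine integral_congr_ae (hac.ae_le ?_)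
    have h3 := Measure.rnDeriv_withDensity q.law
      (f := fun x => ENNReal.ofReal (p.prob x / q.prob x)) (measurable_of_finite _)
    rw [← p.law_eq_withDensity q] at h3
    filter_upwards [h3] with x hx
    rw [llr, hx, ENNReal.toReal_ofReal (div_pos (p.prob_pos x) (q.prob_pos x)).le,
      Real.log_div (p.prob_pos x).ne' (q.prob_pos x).ne']
  rw [h2] at h
  refine ⟨?_, h ▸ ENNReal.toReal_nonneg⟩
  rw [← h, ENNReal.ofReal_toReal]
  exact InformationTheory.klDiv_ne_top hac Integrable.of_finite

/-- The Ising model without interactions, the uniform distribution. -/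
def uniform (n : ℕ) : IsingModel n := ⟨fun _ => 0, fun _ _ => 0, fun _ _ => rfl⟩

theorem uniform_prob (x : Config n) : (uniform n).prob x = (1 / 2) ^ n := by
  have h : ∀ x : Config n, (uniform n).energy x = 0 := by intro x; simp [energy, uniform]
  have hc : Fintype.card (Config n) = 2 ^ n := by simp [Config]
  simp only [prob, logPartition, h, Real.exp_zero, sum_const, card_univ, hc, nsmul_eq_mul, mul_one,
    zero_sub, Real.exp_neg]
  rw [Real.exp_log (by positivity)]
  simp

theorem uniform_law_mem : (uniform n).law ∈ productLaws n := by
  refine ⟨fun _ => (PMF.uniformOfFintype Bool).toMeasure, fun _ => inferInstance, ?_⟩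
  refine Measure.ext_of_singleton fun x => ?_
  rw [law_singleton, uniform_prob, Measure.pi_singleton]
  simp only [PMF.toMeasure_apply_singleton _ _ (measurableSet_singleton _),
    PMF.uniformOfFintype_apply, Fintype.card_bool, prod_const, card_univ, Fintype.card_fin]
  rw [ENNReal.ofReal_pow (by norm_num), one_div, ENNReal.ofReal_inv_of_pos two_pos]
  simp

theorem uniform_corr {u v : Fin n} (h : u ≠ v) : (uniform n).corr u v = 0 := by
  unfold corr expect
  rw [sum_config_update u]
  rw [sum_eq_zero fun x _ => ?_, zero_div]
  simp only [uniform_prob, Function.update_self, Function.update_of_ne h.symm]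
  simp only [spin, if_true, Bool.false_eq_true, if_false]
  ring

theorem expect_quad (A : Fin n → Fin n → ℝ) :
    p.expect (quad A) = ∑ u, ∑ v ∈ Ioi u, A u v * p.corr u v := by
  have : quad A = fun x : Config n => ∑ u, ∑ v ∈ Ioi u, A u v * (spin (x u) * spin (x v)) := rfl
  rw [this, expect_sum]
  refine sum_congr rfl fun u _ => ?_
  rw [expect_sum]
  exact sum_congr rfl fun v _ => by rw [expect_const_mul, corr]

variable {p}

/-- The uniform distribution is a product distribution. In the symmetric divergence from it the
log-partition function and the constant density cancel, which leaves the mean energy under p minus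
that under the uniform distribution; the latter is 0. -/
theorem NoExternalField.dSKLProduct_le (hp : p.NoExternalField) :
    dSKLProduct p.law ≤ ENNReal.ofReal (∑ u, ∑ v ∈ Ioi u, p.edge u v * p.corr u v) := by
  refine (iInf₂_le _ (uniform_law_mem (n := n))).trans_eq ?_
  obtain ⟨h1, h1'⟩ := p.klDiv_law (uniform n)
  obtain ⟨h2, h2'⟩ := (uniform n).klDiv_law p
  rw [dSKL, h1, h2, ← ENNReal.ofReal_add h1' h2']
  congr 1
  have hlog : ∀ x, Real.log (p.prob x) = quad p.edge x - p.logPartition := by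
    intro x
    rw [prob, Real.log_exp, energy, quad]
    simp [hp _]
  simp only [hlog, uniform_prob]
  have e1 := p.expect_sub (fun x => quad p.edge x - p.logPartition)
    (fun _ => Real.log ((1 / 2) ^ n))
  have e2 := (uniform n).expect_sub (fun _ => Real.log ((1 / 2) ^ n))
    (fun x => quad p.edge x - p.logPartition)
  have e3 := p.expect_sub (quad p.edge) (fun _ => p.logPartition)
  have e4 := (uniform n).expect_sub (quad p.edge) (fun _ => p.logPartition)
  simp only [expect_const, expect_quad] at e1 e2 e3 e4
  have e5 : ∑ u, ∑ v ∈ Ioi u, p.edge u v * (uniform n).corr u v = 0 :=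
    sum_eq_zero fun u _ => sum_eq_zero fun v hv => by
      rw [uniform_corr (mem_Ioi.1 hv).ne, mul_zero]
  linarith

theorem NoExternalField.corr_eq_zero (hp : p.NoExternalField) (h : p.law ∈ productLaws n)
    {u v : Fin n} (huv : u ≠ v) : p.corr u v = 0 := by
  obtain ⟨r, hr, hq⟩ := h
  have hind : ProbabilityTheory.IndepFun (fun x : Config n => spin (x u))
      (fun x : Config n => spin (x v)) p.law := by
    rw [hq]
    have := ProbabilityTheory.iIndepFun_pi (μ := r) (X := fun _ b => spin b)
      (fun i => (measurable_of_finite _).aemeasurable)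
    exact this.indepFun huv
  have := hind.integral_fun_mul_eq_mul_integral
    (measurable_of_finite _).aestronglyMeasurable (measurable_of_finite _).aestronglyMeasurable
  rw [integral_law, integral_law, hp.expect_spin, zero_mul] at this
  exact this

end IsingModel

end IsingTest

end

noncomputable section

namespace IsingTest

open Finset

/-! ### The sign of a biased random walk -/

/-- `E[F(Y₁ + ⋯ + Y_k)]` for independent signs `Y_i` of mean `m`. -/
def walk (m : ℝ) : ℕ → (ℤ → ℝ) → ℝ
  | 0, F => F 0
  | k + 1, F => (1 + m) / 2 * walk m k (fun s => F (s + 1)) +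
      (1 - m) / 2 * walk m k (fun s => F (s - 1))

theorem walk_add (m : ℝ) (k : ℕ) (F G : ℤ → ℝ) :
    walk m k (fun s => F s + G s) = walk m k F + walk m k G := by
  induction k generalizing F G with
  | zero => rfl
  | succ k ih => simp only [walk, ih]; ring

theorem walk_const_mul (m : ℝ) (k : ℕ) (c : ℝ) (F : ℤ → ℝ) :
    walk m k (fun s => c * F s) = c * walk m k F := by
  induction k generalizing F with
  | zero => rfl
  | succ k ih => simp only [walk, ih]; ring

theorem walk_const (m : ℝ) (k : ℕ) (c : ℝ) : walk m k (fun _ => c) = c := by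
  induction k with
  | zero => rfl
  | succ k ih => simp only [walk, ih]; ring

theorem walk_neg (m : ℝ) (k : ℕ) (F : ℤ → ℝ) :
    walk (-m) k F = walk m k (fun s => F (-s)) := by
  induction k generalizing F with
  | zero => rfl
  | succ k ih =>
    simp only [walk, ih]
    have h1 : (fun s : ℤ => F (-s + 1)) = fun s => F (-(s - 1)) := by ext s; congr 1; ring
    have h2 : (fun s : ℤ => F (-s - 1)) = fun s => F (-(s + 1)) := by ext s; congr 1; ring
    rw [h1, h2]; ring

theorem walk_nonneg {m : ℝ} (hm : |m| ≤ 1) (k : ℕ) {F : ℤ → ℝ} (hF : ∀ s, 0 ≤ F s) :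
    0 ≤ walk m k F := by
  have := abs_le.1 hm
  induction k generalizing F with
  | zero => exact hF 0
  | succ k ih =>
    exact add_nonneg (mul_nonneg (by linarith) (ih fun s => hF _))
      (mul_nonneg (by linarith) (ih fun s => hF _))

/-- Exchanging up and down steps multiplies the probability of a path that ends at s by ((1 - m)/(1
+ m))^s. -/
theorem walk_tilt {m : ℝ} (hm : |m| < 1) (k : ℕ) (F : ℤ → ℝ) :
    walk m k (fun s => F (-s) * ((1 - m) / (1 + m)) ^ s) = walk m k F := by
  obtain ⟨h1, h2⟩ := abs_lt.1 hm
  have hp : (0 : ℝ) < 1 + m := by linarith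
  have hq : (0 : ℝ) < 1 - m := by linarith
  have hr : (1 - m) / (1 + m) ≠ 0 := (div_pos hq hp).ne'
  induction k generalizing F with
  | zero => simp [walk]
  | succ k ih =>
    simp only [walk]
    have e1 : (fun s : ℤ => F (-(s + 1)) * ((1 - m) / (1 + m)) ^ (s + 1)) = fun s =>
        ((1 - m) / (1 + m)) * ((fun s => F (s - 1)) (-s) * ((1 - m) / (1 + m)) ^ s) := by
      ext s
      have : -(s + 1) = -s - 1 := by ring
      rw [zpow_add_one₀ hr, this]; ring
    have e2 : (fun s : ℤ => F (-(s - 1)) * ((1 - m) / (1 + m)) ^ (s - 1)) = fun s =>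
        ((1 - m) / (1 + m))⁻¹ * ((fun s => F (s + 1)) (-s) * ((1 - m) / (1 + m)) ^ s) := by
      ext s
      have : -(s - 1) = -s + 1 := by ring
      rw [zpow_sub_one₀ hr, this]; ring
    rw [e1, e2, walk_const_mul, walk_const_mul, ih fun s => F (s - 1), ih fun s => F (s + 1)]
    field_simp
    ring

/-- By the tilting identity, twice the expectation is that of F(s)(1 - r^s) with r ≤ 1, which is
nonnegative for every s. Thus an inequality between odd functions is needed only for positive s. -/
theorem walk_odd_nonneg {m : ℝ} (h0 : 0 ≤ m) (h1 : m < 1) (k : ℕ) {F : ℤ → ℝ}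
    (hodd : ∀ s, F (-s) = -F s) (hF : ∀ s, 0 < s → 0 ≤ F s) : 0 ≤ walk m k F := by
  have hm : |m| < 1 := by rwa [abs_of_nonneg h0]
  set r := (1 - m) / (1 + m) with hr
  have hr0 : 0 < r := div_pos (by linarith) (by linarith)
  have hr1 : r ≤ 1 := by rw [hr, div_le_one (by linarith)]; linarith
  have h2 : walk m k F + walk m k F = walk m k (fun s => F s + F (-s) * r ^ s) := by
    rw [walk_add, walk_tilt hm]
  have h3 : 0 ≤ walk m k (fun s => F s + F (-s) * r ^ s) := by
    refine walk_nonneg hm.le k fun s => ?_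
    rw [hodd]
    have e : F s + -F s * r ^ s = F s * (1 - r ^ s) := by ring
    rw [e]
    rcases lt_trichotomy s 0 with h | h | h
    · have hs : F s ≤ 0 := by have := hF (-s) (by omega); rw [hodd] at this; linarith
      have : 1 ≤ r ^ s := one_le_zpow_of_nonpos₀ hr0 hr1 h.le
      exact mul_nonneg_of_nonpos_of_nonpos hs (by linarith)
    · simp [h]
    · have : r ^ s ≤ 1 := zpow_le_one₀ hr0 hr1 h.le
      exact mul_nonneg (hF s h) (by linarith)
  linarith

theorem walk_moments (m : ℝ) (k : ℕ) :
    walk m k (fun s => (s : ℝ)) = k * m ∧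
    walk m k (fun s => (s : ℝ) ^ 2) = k + k * (k - 1) * m ^ 2 ∧
    walk m k (fun s => (s : ℝ) ^ 3) =
      (3 * k - 2) * k * m + k * (k - 1) * (k - 2) * m ^ 3 := by
  induction k with
  | zero => simp [walk]
  | succ k ih =>
    obtain ⟨i1, i2, i3⟩ := ih
    simp only [walk]
    push_cast
    have a1 : ∀ c : ℝ, walk m k (fun s => (s : ℝ) + c) = k * m + c := by
      intro c; rw [walk_add, i1, walk_const]
    have a2 : ∀ c : ℝ, walk m k (fun s => ((s : ℝ) + c) ^ 2) =
        k + k * (k - 1) * m ^ 2 + (2 * c * (k * m) + c ^ 2) := by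
      intro c
      have : (fun s : ℤ => ((s : ℝ) + c) ^ 2) =
          fun s : ℤ => (s : ℝ) ^ 2 + (2 * c * s + c ^ 2) := by ext; ring
      rw [this, walk_add, walk_add, walk_const_mul, walk_const, i1, i2]
    have a3 : ∀ c : ℝ, walk m k (fun s => ((s : ℝ) + c) ^ 3) =
        (3 * k - 2) * k * m + k * (k - 1) * (k - 2) * m ^ 3 +
          (3 * c * (k + k * (k - 1) * m ^ 2) + (3 * c ^ 2 * (k * m) + c ^ 3)) := by
      intro c
      have : (fun s : ℤ => ((s : ℝ) + c) ^ 3) =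
          fun s : ℤ => (s : ℝ) ^ 3 + (3 * c * (s : ℝ) ^ 2 + (3 * c ^ 2 * s + c ^ 3)) := by
        ext; ring
      rw [this, walk_add, walk_add, walk_add, walk_const_mul, walk_const_mul, walk_const,
        i1, i2, i3]
    simp only [sub_eq_add_neg, a1, a2, a3]
    refine ⟨by ring, by ring, by ring⟩

/-- For t = cs > 0, 1 - 3t/2 + t³/2 = (t - 1)²(t + 2)/2 ≥ 0, so the odd cubic (3t - t³)/2 may
replace the sign. Its linear part has mean 3ckm/2; the two smallness conditions on c keep the cubic
part below ckm. -/
theorem walk_sign_ge {m c : ℝ} {k : ℕ} (hk : 0 < k) (h0 : 0 ≤ m) (h1 : m < 1) (hc : 0 ≤ c)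
    (hc1 : 2 * c ^ 2 * k ≤ 1) (hc2 : 2 * c ^ 2 * (k * m) ^ 2 ≤ 1) :
    c * (k * m) / 2 ≤ walk m k (fun s => (s.sign : ℝ)) := by
  obtain ⟨w1, -, w3⟩ := walk_moments m k
  have hodd := walk_odd_nonneg h0 h1 k
    (F := fun s => (s.sign : ℝ) + ((-(3 * c / 2)) * s + (c ^ 3 / 2) * (s : ℝ) ^ 3))
    (fun s => by push_cast [Int.sign_neg]; ring)
    (fun s hs => by
      rw [Int.sign_eq_one_of_pos hs]
      have hs' : (0 : ℝ) ≤ s := by exact_mod_cast hs.le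
      have ht : 0 ≤ c * s := mul_nonneg hc hs'
      have : (1 : ℝ) + (-(3 * c / 2) * s + c ^ 3 / 2 * s ^ 3) =
          (c * s - 1) ^ 2 * (c * s + 2) / 2 := by ring
      push_cast; rw [this]; positivity)
  rw [walk_add, walk_add, walk_const_mul, walk_const_mul, w1, w3] at hodd
  have hk1 : (1 : ℝ) ≤ k := by exact_mod_cast hk
  have hkm : 0 ≤ k * m := mul_nonneg (by linarith) h0
  have b1 : (3 * k - 2) * k * m ≤ 3 * k * (k * m) := by nlinarith
  have b2 : k * (k - 1) * (k - 2) * m ^ 3 ≤ (k * m) ^ 2 * (k * m) := by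
    have h3 : (0 : ℝ) ≤ m ^ 3 := by positivity
    have : (k : ℝ) * (k - 1) * (k - 2) ≤ k ^ 3 := by nlinarith
    calc _ ≤ (k : ℝ) ^ 3 * m ^ 3 := by gcongr
      _ = _ := by ring
  have hckm : 0 ≤ c * (k * m) := mul_nonneg hc hkm
  have b3 : c ^ 3 / 2 * (3 * k * (k * m) + (k * m) ^ 2 * (k * m)) ≤ c * (k * m) := by
    have : c ^ 3 / 2 * (3 * k * (k * m) + (k * m) ^ 2 * (k * m)) =
      c * (k * m) * ((3 * (2 * c ^ 2 * k) + 2 * c ^ 2 * (k * m) ^ 2) / 4) := by ring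
    rw [this]
    exact mul_le_of_le_one_right hckm (by linarith)
  have b4 : c ^ 3 / 2 * ((3 * k - 2) * k * m + k * (k - 1) * (k - 2) * m ^ 3) ≤
      c ^ 3 / 2 * (3 * k * (k * m) + (k * m) ^ 2 * (k * m)) := by gcongr
  linarith

theorem walk_sign_mul_ge {m c : ℝ} {k : ℕ} (hk : 0 < k) (h1 : |m| < 1) (hc : 0 ≤ c)
    (hc1 : 2 * c ^ 2 * k ≤ 1) (hc2 : 2 * c ^ 2 * (k * m) ^ 2 ≤ 1) :
    c * k / 2 * m ^ 2 ≤ m * walk m k (fun s => (s.sign : ℝ)) := by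
  rcases le_or_gt 0 m with h | h
  · have := walk_sign_ge hk h (abs_lt.1 h1).2 hc hc1 hc2
    nlinarith
  · have := walk_sign_ge (m := -m) hk (by linarith) (by linarith [(abs_lt.1 h1).1]) hc hc1
      (by rw [mul_neg, neg_sq]; exact hc2)
    rw [walk_neg] at this
    have e : (fun s : ℤ => (((-s).sign : ℤ) : ℝ)) = fun s => (-1 : ℝ) * (s.sign : ℝ) := by
      ext s; push_cast [Int.sign_neg]; ring
    rw [e, walk_const_mul] at this
    nlinarith

/-! ### Independence of blocks -/

open ProbabilityTheory

/-- Induction on the number of blocks: a new block is disjoint from the union of the earlier ones,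
and the functions factor through the finitely many coordinates of their blocks. -/
theorem iIndepFun_of_dependsOn {Ω E J ι : Type*} {γ : J → Type*} [MeasurableSpace Ω]
    {μ : Measure Ω} [MeasurableSpace E] [Finite E] [MeasurableSingletonClass E] [Nonempty E]
    [∀ j, MeasurableSpace (γ j)] {X : ι → Ω → E} (hX : iIndepFun X μ)
    (hm : ∀ i, Measurable (X i)) (B : J → Finset ι)
    (hB : Pairwise fun i j => Disjoint (B i) (B j)) (F : ∀ j, (ι → E) → γ j)
    (hF : ∀ j, DependsOn (F j) (B j)) :
    iIndepFun (fun j ω => F j fun i => X i ω) μ := by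
  classical
  have hμ := hX.isProbabilityMeasure
  -- Extends a tuple on `T` arbitrarily, so that `F j` can be evaluated on it; the choice is
  -- immaterial when `B j ⊆ T`.
  let ext (T : Finset ι) (t : T → E) : ι → E := fun i =>
    if h : i ∈ T then t ⟨i, h⟩ else Classical.arbitrary E
  have hext : ∀ (T : Finset ι) (j : J), B j ⊆ T → ∀ ω,
      F j (fun i => X i ω) = F j (ext T fun i => X i ω) := by
    intro T j hj ω
    refine hF j fun i hi => ?_
    simp only [ext]
    rw [dif_pos (hj hi)]
  rw [iIndepFun_iff_measure_inter_preimage_eq_mul]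
  intro S sets hsets
  induction S using Finset.induction_on with
  | empty => simp
  | insert a S ha ih =>
    rw [Finset.prod_insert ha, Finset.set_biInter_insert,
      ← ih fun i hi => hsets i (mem_insert_of_mem hi)]
    have hd : Disjoint (B a) (S.biUnion B) := by
      rw [disjoint_biUnion_right]
      exact fun i hi => hB (by rintro rfl; exact ha hi)
    have hind := hX.indepFun_finset (B a) (S.biUnion B) hd hm
    have h1 : (fun ω => F a fun i => X i ω) ⁻¹' sets a =
        (fun ω (i : B a) => X i ω) ⁻¹' {t | F a (ext (B a) t) ∈ sets a} := by
      ext ω; simp only [Set.mem_preimage, Set.mem_ofPred_eq]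
      rw [hext (B a) a subset_rfl]
    have h2 : (⋂ j ∈ S, (fun ω => F j fun i => X i ω) ⁻¹' sets j) =
        (fun ω (i : S.biUnion B) => X i ω) ⁻¹'
          {t | ∀ j ∈ S, F j (ext (S.biUnion B) t) ∈ sets j} := by
      ext ω; simp only [Set.mem_iInter, Set.mem_preimage, Set.mem_ofPred_eq]
      refine forall₂_congr fun j hj => ?_
      rw [hext (S.biUnion B) j (subset_biUnion_of_mem B hj)]
    rw [h1, h2]
    exact hind.measure_inter_preimage_eq_mul _ _ (Set.toFinite _).measurableSet
      (Set.toFinite _).measurableSet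

end IsingTest

end

noncomputable section

namespace IsingTest

open Finset ProbabilityTheory

/-! ### Samples from an Ising model -/

section Sample

set_option linter.unusedSectionVars false

variable {n : ℕ} {Ω : Type*} [MeasurableSpace Ω]

/-- The first `N` terms of `X` are independent samples from `p`; all of its terms are
independent. -/
structure IsSample (p : IsingModel n) (μ : Measure Ω) (X : ℕ → Ω → Config n) (N : ℕ) : Prop where
  indep : iIndepFun X μ
  map_eq : ∀ i < N, μ.map (X i) = p.law

variable [DiscreteMeasurableSpace Ω] [Finite Ω] {μ : Measure Ω}
  [IsProbabilityMeasure μ] {p : IsingModel n} {X : ℕ → Ω → Config n} {N : ℕ}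

theorem IsSample.shift (hX : IsSample p μ X N) {s k : ℕ} (h : s + k ≤ N) :
    IsSample p μ (fun i => X (s + i)) k :=
  ⟨hX.indep.precomp (g := fun i => s + i) (add_right_injective s),
    fun i hi => hX.map_eq _ (by omega)⟩

theorem IsSample.integral (hX : IsSample p μ X N) {i : ℕ} (hi : i < N) (f : Config n → ℝ) :
    ∫ ω, f (X i ω) ∂μ = p.expect f := by
  rw [← p.integral_law, ← hX.map_eq i hi,
    integral_map Measurable.of_discrete.aemeasurable (measurable_of_finite _).aestronglyMeasurable]

theorem IsSample.hoeffding_upper (hX : IsSample p μ X N) (hN : 0 < N) {f : Config n → ℝ}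
    (hf : ∀ x, |f x| ≤ 1) {δ : ℝ} (hδ : 0 ≤ δ) :
    μ.real {ω | δ ≤ (∑ i ∈ range N, f (X i ω)) / N - p.expect f} ≤
      Real.exp (-(N * δ ^ 2 / 2)) := by
  have hN' : (0 : ℝ) < N := by exact_mod_cast hN
  have hind : iIndepFun (fun i ω => f (X i ω) - p.expect f) μ :=
    hX.indep.comp (fun _ c => f c - p.expect f) fun _ => measurable_of_finite _
  have hsub : ∀ i < N, HasSubgaussianMGF (fun ω => f (X i ω) - p.expect f) 1 μ := by
    intro i hi
    have := hasSubgaussianMGF_of_mem_Icc (μ := μ) (X := fun ω => f (X i ω)) (a := -1) (b := 1)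
      Measurable.of_discrete.aemeasurable (ae_of_all _ fun ω => abs_le.1 (hf _))
    rw [hX.integral hi] at this
    convert this using 1
    ext; norm_num
  have h := HasSubgaussianMGF.measure_sum_range_ge_le_of_iIndepFun hind hsub
    (ε := N * δ) (by positivity)
  have e : {ω | δ ≤ (∑ i ∈ range N, f (X i ω)) / N - p.expect f} =
      {ω | N * δ ≤ ∑ i ∈ range N, (f (X i ω) - p.expect f)} := by
    ext ω
    simp only [Set.mem_ofPred_eq, sum_sub_distrib, sum_const, card_range, nsmul_eq_mul]
    rw [le_sub_iff_add_le, le_div_iff₀ hN', le_sub_iff_add_le]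
    constructor <;> intro h <;> linarith
  rw [e]
  refine h.trans_eq ?_
  congr 1
  simp only [NNReal.coe_one]
  field_simp

theorem IsSample.hoeffding (hX : IsSample p μ X N) (hN : 0 < N) {f : Config n → ℝ}
    (hf : ∀ x, |f x| ≤ 1) {δ : ℝ} (hδ : 0 ≤ δ) :
    μ.real {ω | δ ≤ |(∑ i ∈ range N, f (X i ω)) / N - p.expect f|} ≤
      2 * Real.exp (-(N * δ ^ 2 / 2)) := by
  have h1 := hX.hoeffding_upper hN hf hδ
  have h2 := hX.hoeffding_upper hN (f := fun x => -f x) (fun x => by rw [abs_neg]; exact hf x) hδ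
  have e : p.expect (fun x => -f x) = -p.expect f := by
    have := p.expect_const_mul (-1) f; simpa using this
  rw [e] at h2
  simp only [sum_neg_distrib] at h2
  calc _ ≤ μ.real ({ω | δ ≤ (∑ i ∈ range N, f (X i ω)) / N - p.expect f} ∪
        {ω | δ ≤ (-∑ i ∈ range N, f (X i ω)) / N - -p.expect f}) := by
        refine measureReal_mono ?_
        intro ω hω
        simp only [Set.mem_ofPred_eq, le_abs] at hω
        rcases hω with hω | hω
        · exact Or.inl hω
        · refine Or.inr ?_
          simp only [Set.mem_ofPred_eq]
          rw [neg_div]; linarith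
    _ ≤ _ := (measureReal_union_le _ _).trans (by linarith)

theorem IsSample.chebyshev (hX : IsSample p μ X N) (hN : 0 < N) (f : Config n → ℝ) {V c : ℝ}
    (hV : p.expect (fun x => (f x - p.expect f) ^ 2) ≤ V) (hc : 0 < c) :
    μ.real {ω | c ≤ |(∑ i ∈ range N, f (X i ω)) / N - p.expect f|} ≤ V / (N * c ^ 2) := by
  have hN' : (0 : ℝ) < N := by exact_mod_cast hN
  have hmem : ∀ g : Ω → ℝ, MemLp g 2 μ := fun g => MemLp.of_discrete
  have hint : ∫ ω, ∑ i ∈ range N, f (X i ω) ∂μ = N * p.expect f := by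
    rw [integral_finsetSum _ fun i _ => Integrable.of_finite,
      sum_congr rfl fun i hi => hX.integral (mem_range.1 hi) f]
    simp
  have hvar : Var[fun ω => ∑ i ∈ range N, f (X i ω); μ] =
      N * p.expect (fun x => (f x - p.expect f) ^ 2) := by
    have h := IndepFun.variance_sum (μ := μ) (X := fun i ω => f (X i ω)) (s := range N)
      (fun i _ => hmem _) (fun i _ j _ hij =>
        (hX.indep.indepFun hij).comp (measurable_of_finite f) (measurable_of_finite f))
    have e : (∑ i ∈ range N, fun ω => f (X i ω)) = fun ω => ∑ i ∈ range N, f (X i ω) := by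
      ext ω; simp
    rw [e] at h
    rw [h, sum_congr rfl (g := fun _ => p.expect (fun x => (f x - p.expect f) ^ 2))]
    · simp
    · intro i hi
      rw [variance_eq_integral Measurable.of_discrete.aemeasurable,
        hX.integral (mem_range.1 hi) f]
      exact hX.integral (mem_range.1 hi) fun x => (f x - p.expect f) ^ 2
  have h := meas_ge_le_variance_div_sq (hmem fun ω => ∑ i ∈ range N, f (X i ω))
    (c := N * c) (by positivity)
  rw [hint, hvar] at h
  have e : {ω | c ≤ |(∑ i ∈ range N, f (X i ω)) / N - p.expect f|} =
      {ω | N * c ≤ |(∑ i ∈ range N, f (X i ω)) - N * p.expect f|} := by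
    ext ω
    have : (∑ i ∈ range N, f (X i ω)) / N - p.expect f =
        ((∑ i ∈ range N, f (X i ω)) - N * p.expect f) / N := by field_simp
    simp only [Set.mem_ofPred_eq]
    rw [this, abs_div, abs_of_pos hN', le_div_iff₀ hN', mul_comm c]
  rw [e, measureReal_def]
  have hV0 : 0 ≤ p.expect (fun x => (f x - p.expect f) ^ 2) :=
    p.expect_nonneg fun x => sq_nonneg _
  refine (ENNReal.toReal_mono ENNReal.ofReal_ne_top h).trans ?_
  rw [ENNReal.toReal_ofReal (by positivity)]
  calc _ = p.expect (fun x => (f x - p.expect f) ^ 2) / (N * c ^ 2) := by field_simp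
    _ ≤ _ := by gcongr

/-- Induction on `k`, splitting off the last sample, which is independent of the partial sum. -/
theorem IsSample.integral_walk (hX : IsSample p μ X N) (Y : Config n → ℤ)
    (hY : ∀ x, Y x = 1 ∨ Y x = -1) {k : ℕ} (hk : k ≤ N) (F : ℤ → ℝ) :
    ∫ ω, F (∑ i ∈ range k, Y (X i ω)) ∂μ = walk (p.expect fun x => (Y x : ℝ)) k F := by
  induction k generalizing F with
  | zero => simp [walk]
  | succ k ih =>
    set m := p.expect fun x => (Y x : ℝ) with hm
    have hind : IndepFun (fun ω => ∑ i ∈ range k, Y (X i ω)) (fun ω => Y (X k ω)) μ := by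
      have h := hX.indep.comp (fun _ c => Y c) fun _ => measurable_of_finite _
      have h2 := h.indepFun_sum_range_succ (fun i => Measurable.of_discrete) k
      have e : (∑ j ∈ range k, (fun c => Y c) ∘ X j) = fun ω => ∑ i ∈ range k, Y (X i ω) := by
        ext ω; simp
      rwa [e] at h2
    have hprod : ∀ (G : ℤ → ℝ) (H : ℤ → ℝ),
        ∫ ω, G (∑ i ∈ range k, Y (X i ω)) * H (Y (X k ω)) ∂μ =
          walk m k G * p.expect (fun x => H (Y x)) := by
      intro G H
      have h := (hind.comp (φ := G) (ψ := H) Measurable.of_discrete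
        Measurable.of_discrete).integral_fun_mul_eq_mul_integral
        Measurable.of_discrete.aestronglyMeasurable Measurable.of_discrete.aestronglyMeasurable
      simp only [Function.comp_apply] at h
      rw [h, ih (by omega), hX.integral (by omega) fun x => H (Y x)]
    -- As the last increment is ±1, F(S + Y) is affine in Y, a sum of products of independent
    -- factors.
    have e : ∀ ω, F (∑ i ∈ range (k + 1), Y (X i ω)) =
        F (∑ i ∈ range k, Y (X i ω) + 1) * ((1 + (Y (X k ω) : ℝ)) / 2) +
        F (∑ i ∈ range k, Y (X i ω) - 1) * ((1 - (Y (X k ω) : ℝ)) / 2) := by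
      intro ω
      rw [sum_range_succ]
      rcases hY (X k ω) with h | h <;> rw [h] <;> push_cast [sub_eq_add_neg] <;> ring
    have e1 : p.expect (fun x => (1 + (Y x : ℝ)) / 2) = (1 + m) / 2 := by
      have : (fun x => (1 + (Y x : ℝ)) / 2) = fun x => (1 / 2 : ℝ) * (1 + (Y x : ℝ)) := by
        ext; ring
      rw [this, p.expect_const_mul, p.expect_add (fun _ => (1 : ℝ)), p.expect_const]; ring
    have e2 : p.expect (fun x => (1 - (Y x : ℝ)) / 2) = (1 - m) / 2 := by
      have : (fun x => (1 - (Y x : ℝ)) / 2) = fun x => (1 / 2 : ℝ) * (1 - (Y x : ℝ)) := by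
        ext; ring
      rw [this, p.expect_const_mul, p.expect_sub (fun _ => (1 : ℝ)), p.expect_const]; ring
    simp only [e]
    rw [integral_add Integrable.of_finite Integrable.of_finite,
      hprod (fun s => F (s + 1)) (fun y => (1 + (y : ℝ)) / 2),
      hprod (fun s => F (s - 1)) (fun y => (1 - (y : ℝ)) / 2), e1, e2, walk]
    ring

/-! ### Repetition and majority votes -/

theorem measureReal_compl_eq (A : Set Ω) : μ.real Aᶜ = 1 - μ.real A := by
  rw [measureReal_compl MeasurableSet.of_discrete]; simp

/-- Reverse Markov inequality: f is at most a, plus T on the event that f reaches a. -/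
theorem measureReal_ge_of_integral_ge {f : Ω → ℝ} {a T : ℝ} (ha : 0 ≤ a)
    (hf : ∀ ω, f ω ≤ T) (h : 2 * a ≤ ∫ ω, f ω ∂μ) : a ≤ T * μ.real {ω | a ≤ f ω} := by
  have h1 : ∀ ω, f ω ≤ a + T * Set.indicator {ω | a ≤ f ω} (fun _ => (1 : ℝ)) ω := by
    intro ω
    by_cases hω : a ≤ f ω
    · rw [Set.indicator_of_mem (by exact hω)]; linarith [hf ω]
    · rw [Set.indicator_of_notMem (by exact hω)]; linarith
  have h2 : ∫ ω, f ω ∂μ ≤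
      ∫ ω, (a + T * Set.indicator {ω | a ≤ f ω} (fun _ => (1 : ℝ)) ω) ∂μ :=
    integral_mono Integrable.of_finite Integrable.of_finite h1
  rw [integral_add Integrable.of_finite Integrable.of_finite, integral_const_mul,
    integral_indicator_const _ MeasurableSet.of_discrete] at h2
  simp at h2
  linarith

/-- The `r`-th of the consecutive blocks of length `k`. -/
def block (k r : ℕ) : Finset ℕ := Ico (r * k) (r * k + k)

theorem disjoint_block (k : ℕ) : Pairwise fun i j => Disjoint (block k i) (block k j) := by
  intro i j hij
  wlog h : i < j generalizing i j
  · exact (this hij.symm (by omega)).symm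
  rw [block, block, Finset.disjoint_left]
  intro a ha hb
  rw [mem_Ico] at ha hb
  have : i * k + k ≤ j * k := by rw [← Nat.succ_mul]; exact Nat.mul_le_mul_right k h
  omega

theorem dependsOn_block {E γ : Type*} {k : ℕ} {F : (ℕ → E) → γ} (hF : DependsOn F (range k))
    (r : ℕ) : DependsOn (fun x : ℕ → E => F fun i => x (r * k + i)) (block k r) := by
  intro x y h
  refine hF fun i hi => h _ ?_
  simp only [coe_range, Set.mem_Iio] at hi
  simp only [block, coe_Ico, Set.mem_Ico]; omega

theorem iIndepFun_blocks {γ : Type*} [MeasurableSpace γ] (hX : iIndepFun X μ) {k : ℕ}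
    {F : (ℕ → Config n) → γ} (hF : DependsOn F (range k)) :
    iIndepFun (fun (r : ℕ) ω => F fun i => X (r * k + i) ω) μ :=
  iIndepFun_of_dependsOn hX (fun _ => Measurable.of_discrete) (block k) (disjoint_block k)
    (fun r x => F fun i => x (r * k + i)) fun r => dependsOn_block hF r

theorem measureReal_forall_blocks_le (hX : iIndepFun X μ) {k L : ℕ} {q : ℝ}
    {Q : (ℕ → Config n) → Prop} (hQ : DependsOn Q (range k))
    (hq : ∀ r < L, μ.real {ω | Q fun i => X (r * k + i) ω} ≤ q) :
    μ.real {ω | ∀ r < L, Q fun i => X (r * k + i) ω} ≤ q ^ L := by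
  have h := (iIndepFun_blocks hX hQ).measure_inter_preimage_eq_mul (range L)
    (sets := fun _ => {True}) fun _ _ => MeasurableSet.of_discrete
  have e : {ω | ∀ r < L, Q fun i => X (r * k + i) ω} =
      ⋂ r ∈ range L, (fun ω => Q fun i => X (r * k + i) ω) ⁻¹' {True} := by
    ext ω; simp
  rw [e, measureReal_def, h, ENNReal.toReal_prod]
  calc _ ≤ ∏ _r ∈ range L, q := by
        refine prod_le_prod (fun _ _ => ENNReal.toReal_nonneg) fun r hr => ?_
        refine le_trans (le_of_eq ?_) (hq r (mem_range.1 hr))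
        rw [measureReal_def]; congr 2; ext ω; simp
    _ = _ := by simp

open Classical in
-- Half of the blocks being bad requires an excess of R/4 over the expected number. Indicators are
-- subgaussian with parameter 1/4, so Hoeffding gives (R/4)² / (2R/4) = R/8. Ties count as bad, so
-- the bound serves both for wrong rejections and for wrong acceptances.
theorem measureReal_majority_le (hX : iIndepFun X μ) {k R : ℕ}
    {Q : (ℕ → Config n) → Prop} (hQ : DependsOn Q (range k))
    (hq : ∀ r < R, μ.real {ω | Q fun i => X (r * k + i) ω} ≤ 1 / 4) :
    μ.real {ω | R ≤ 2 * ((range R).filter fun r => Q fun i => X (r * k + i) ω).card} ≤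
      Real.exp (-(R / 8)) := by
  set Z : ℕ → Ω → ℝ := fun r ω => if Q fun i => X (r * k + i) ω then 1 else 0 with hZ
  have hQ' : DependsOn (fun x => if Q x then (1 : ℝ) else 0) (range k) := by
    intro x y h
    simp only [hQ h]
  have hind := iIndepFun_blocks hX hQ'
  have hmean : ∀ r < R, ∫ ω, Z r ω ∂μ ≤ 1 / 4 := by
    intro r hr
    refine le_trans (le_of_eq ?_) (hq r hr)
    have : Z r = Set.indicator {ω | Q fun i => X (r * k + i) ω} fun _ => (1 : ℝ) := by
      ext ω; simp [hZ, Set.indicator_apply]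
    rw [this, integral_indicator_const _ MeasurableSet.of_discrete]; simp
  have hind2 : iIndepFun (fun r ω => Z r ω - ∫ ω, Z r ω ∂μ) μ :=
    hind.comp (fun r c => c - ∫ ω, Z r ω ∂μ) fun _ => by fun_prop
  have hsub : ∀ r < R, HasSubgaussianMGF (fun ω => Z r ω - ∫ ω, Z r ω ∂μ) (1 / 4) μ := by
    intro r _
    have := hasSubgaussianMGF_of_mem_Icc (μ := μ) (X := Z r) (a := 0) (b := 1)
      Measurable.of_discrete.aemeasurable
      (ae_of_all _ fun ω => by simp only [hZ]; split_ifs <;> simp)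
    convert this using 1
    ext; norm_num
  have h := HasSubgaussianMGF.measure_sum_range_ge_le_of_iIndepFun hind2 hsub
    (ε := R / 4) (by positivity)
  rcases Nat.eq_zero_or_pos R with rfl | hR
  · simp
  have hR' : (0 : ℝ) < R := by exact_mod_cast hR
  calc _ ≤ μ.real {ω | (R : ℝ) / 4 ≤ ∑ r ∈ range R, (Z r ω - ∫ ω, Z r ω ∂μ)} := by
        refine measureReal_mono fun ω hω => ?_
        simp only [Set.mem_ofPred_eq] at hω ⊢
        have h1 : (((range R).filter fun r => Q fun i => X (r * k + i) ω).card : ℝ) =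
            ∑ r ∈ range R, Z r ω := by
          rw [card_filter]; push_cast; rfl
        have h2 : (R : ℝ) ≤ 2 * ∑ r ∈ range R, Z r ω := by rw [← h1]; exact_mod_cast hω
        have h3 : ∑ r ∈ range R, ∫ ω, Z r ω ∂μ ≤ R * (1 / 4) := by
          calc _ ≤ ∑ r ∈ range R, (1 / 4 : ℝ) := sum_le_sum fun r hr => hmean r (mem_range.1 hr)
            _ = _ := by simp
        rw [sum_sub_distrib]; linarith
    _ ≤ _ := h
    _ = _ := by congr 1; push_cast; field_simp; norm_num

end Sample

end IsingTest

end

noncomputable section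

namespace IsingTest

open Finset ProbabilityTheory

/-! ### The three stages of the algorithm -/

section Stages

set_option linter.unusedSectionVars false

variable {n : ℕ} {Ω : Type*} [MeasurableSpace Ω]
  [DiscreteMeasurableSpace Ω] [Finite Ω] {μ : Measure Ω}
  [IsProbabilityMeasure μ] {p : IsingModel n} {X : ℕ → Ω → Config n} {N : ℕ}

/-- The union bound for localization ends in 16 e^(-8), which has to be at most 1/100. -/
theorem exp_neg_eight_le : 1600 * Real.exp (-8) ≤ 1 := by
  have h1 : (2.7 : ℝ) ^ 8 ≤ Real.exp 1 ^ 8 := by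
    gcongr; linarith [Real.exp_one_gt_d9]
  have h2 : Real.exp 1 ^ 8 = Real.exp 8 := by rw [← Real.exp_nat_mul]; norm_num
  rw [Real.exp_neg, ← div_eq_mul_inv, div_le_one (Real.exp_pos _), ← h2]
  exact le_trans (by norm_num) h1

theorem abs_empNode_le (k : ℕ) (x : ℕ → Config n) (u : Fin n) : |empNode k x u| ≤ 1 := by
  rw [empNode, abs_div, Nat.abs_cast]
  refine div_le_one_of_le₀ ?_ (Nat.cast_nonneg k)
  calc _ ≤ ∑ i ∈ range k, |spin (x i u)| := abs_sum_le_sum_abs _ _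
    _ = k := by simp [abs_spin]

/-- Since spins have mean 0, the covariance is λ_uv. The product of two empirical node means is at
most one of them in absolute value, so accuracy 1/(4w) for edges and nodes alike suffices. By
Hoeffding each failure has probability at most 2 e^(-8m), and there are at most n² ≤ 4^m pairs. -/
theorem IsSample.localization (hX : IsSample p μ X N) (hf : p.NoExternalField) (hN : 0 < N)
    {w : ℝ} (hw : 0 < w) {m : ℕ} (hm : 0 < m) (hnm : n < 2 ^ m) (hNw : 256 * w ^ 2 * m ≤ N) :
    μ.real {ω | ∃ u v : Fin n, u < v ∧ 1 / (2 * w) ≤ |empEdge N (fun i => X i ω) u v -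
      empNode N (fun i => X i ω) u * empNode N (fun i => X i ω) v - p.corr u v|} ≤ 1 / 100 := by
  set q := Real.exp (-8) ^ m with hq
  have hexp : Real.exp (-(N * (1 / (4 * w)) ^ 2 / 2)) ≤ q := by
    rw [hq, ← Real.exp_nat_mul, Real.exp_le_exp]
    have : (N : ℝ) * (1 / (4 * w)) ^ 2 / 2 = N / (32 * w ^ 2) := by field_simp; norm_num
    rw [this, mul_neg, neg_le_neg_iff, le_div_iff₀ (by positivity)]
    linarith
  have hA : ∀ u v : Fin n, μ.real {ω | 1 / (4 * w) ≤
      |empEdge N (fun i => X i ω) u v - p.corr u v|} ≤ 2 * q := fun u v =>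
    (hX.hoeffding hN (f := fun x => spin (x u) * spin (x v))
      (fun x => by rw [abs_mul, abs_spin, abs_spin, one_mul]) (by positivity)).trans
      (mul_le_mul_of_nonneg_left hexp two_pos.le)
  have hB : ∀ u : Fin n, μ.real {ω | 1 / (4 * w) ≤ |empNode N (fun i => X i ω) u|} ≤ 2 * q := by
    intro u
    have := hX.hoeffding hN (f := fun x => spin (x u)) (fun x => by rw [abs_spin])
      (δ := 1 / (4 * w)) (by positivity)
    rw [hf.expect_spin] at this
    simp only [sub_zero] at this
    exact this.trans (mul_le_mul_of_nonneg_left hexp two_pos.le)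
  have hsub : {ω | ∃ u v : Fin n, u < v ∧ 1 / (2 * w) ≤ |empEdge N (fun i => X i ω) u v -
      empNode N (fun i => X i ω) u * empNode N (fun i => X i ω) v - p.corr u v|} ⊆
      ⋃ a : Fin n × Fin n, ({ω | 1 / (4 * w) ≤
        |empEdge N (fun i => X i ω) a.1 a.2 - p.corr a.1 a.2|} ∪
        {ω | 1 / (4 * w) ≤ |empNode N (fun i => X i ω) a.1|}) := by
    rintro ω ⟨u, v, -, h⟩
    refine Set.mem_iUnion.2 ⟨(u, v), ?_⟩
    by_contra hcon
    simp only [Set.mem_union, Set.mem_ofPred_eq, not_or, not_le] at hcon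
    have h1 : |empNode N (fun i => X i ω) u * empNode N (fun i => X i ω) v| ≤
        |empNode N (fun i => X i ω) u| := by
      rw [abs_mul]; exact mul_le_of_le_one_right (abs_nonneg _) (abs_empNode_le _ _ _)
    have h2 := abs_sub (empEdge N (fun i => X i ω) u v - p.corr u v)
      (empNode N (fun i => X i ω) u * empNode N (fun i => X i ω) v)
    rw [sub_right_comm] at h2
    have e : 1 / (2 * w) = 1 / (4 * w) + 1 / (4 * w) := by field_simp; norm_num
    linarith [hcon.1, hcon.2]
  have hn4 : (n : ℝ) ^ 2 ≤ 4 ^ m := by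
    have : (n : ℝ) ≤ 2 ^ m := by exact_mod_cast hnm.le
    calc (n : ℝ) ^ 2 ≤ (2 ^ m) ^ 2 := by gcongr
      _ = 4 ^ m := by rw [← pow_mul, mul_comm, pow_mul]; norm_num
  calc _ ≤ μ.real _ := measureReal_mono hsub
    _ ≤ ∑ a : Fin n × Fin n, μ.real _ := measureReal_iUnion_fintype_le _
    _ ≤ ∑ _a : Fin n × Fin n, (4 * q) := by
        refine sum_le_sum fun a _ => (measureReal_union_le _ _).trans ?_
        linarith [hA a.1 a.2, hB a.1]
    _ = n ^ 2 * (4 * q) := by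
        rw [sum_const, card_univ, Fintype.card_prod, Fintype.card_fin, nsmul_eq_mul]
        push_cast; ring
    _ ≤ 4 ^ m * (4 * q) := by gcongr
    _ = 4 * (4 * Real.exp (-8)) ^ m := by rw [hq, mul_pow]; ring
    _ ≤ 4 * (4 * Real.exp (-8)) ^ 1 := by
        gcongr 4 * ?_
        exact pow_le_pow_of_le_one (by positivity) (by linarith [exp_neg_eight_le]) hm
    _ ≤ _ := by linarith [exp_neg_eight_le]

/-- Only coefficients above the diagonal matter, so the matrix may be symmetrized. This is needed
because `weakLearn` is treated as an arbitrary sign matrix. -/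
theorem IsingModel.HighTemperature.variance_quad_le' {η : ℝ} (hp : p.HighTemperature η)
    (hη : 0 < η) (hf : p.NoExternalField) (A : Fin n → Fin n → ℝ) (hA1 : ∀ u v, |A u v| ≤ 1) :
    p.expect (fun x => (quad A x - p.expect (quad A)) ^ 2) ≤ (n / η) ^ 2 := by
  have e : quad A = quad fun u v => if u < v then A u v else A v u := by
    ext x
    refine sum_congr rfl fun u _ => sum_congr rfl fun v hv => ?_
    simp only [if_pos (mem_Ioi.1 hv)]
  rw [e]
  refine hp.variance_quad_le hη hf _ (fun u v => ?_) fun u v => ?_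
  · rcases lt_trichotomy u v with h | h | h
    · rw [if_pos h, if_neg h.not_gt]
    · rw [h]
    · rw [if_neg h.not_gt, if_pos h]
  · split_ifs
    exacts [hA1 _ _, hA1 _ _]

theorem thresholdRejects_iff {D : ℕ} {τ β ε : ℝ} (hε : 0 < ε) (Γ : Fin n → Fin n → ℝ) (k : ℕ)
    (x : ℕ → Config n) : ThresholdRejects D τ β ε Γ k x ↔
      1 < D * ((n : ℝ) ^ (2 - τ) * (β / ε)) * ((∑ i ∈ range k, quad Γ (x i)) / k) := by
  have e : globalStatistic Γ k x = (∑ i ∈ range k, quad Γ (x i)) / k := rfl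
  rw [ThresholdRejects, ← e, ← mul_lt_mul_iff_of_pos_left (b := 1) hε, mul_one]
  have : ε * (D * ((n : ℝ) ^ (2 - τ) * (β / ε)) * globalStatistic Γ k x) =
      D * β * (n : ℝ) ^ (2 - τ) * globalStatistic Γ k x := by field_simp
  rw [this]

theorem dependsOn_thresholdRejects (D : ℕ) (τ β ε : ℝ) (Γ : Fin n → Fin n → ℝ) (k : ℕ) :
    DependsOn (fun x : ℕ → Config n => ThresholdRejects D τ β ε Γ k x) (range k) := by
  intro x y h
  have : globalStatistic Γ k x = globalStatistic Γ k y := by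
    unfold globalStatistic
    congr 1
    exact sum_congr rfl fun i hi => by rw [h i hi]
  simp only [ThresholdRejects, this]

/-- One block of the testing stage misjudges the sign vector `Γ` with probability at most `1/4`. -/
theorem IsSample.test_block (hX : IsSample p μ X N) {η : ℝ} (hp : p.HighTemperature η)
    (hη : 0 < η) (hf : p.NoExternalField) {K : ℕ} (hK : 1 / η ≤ K) (hN : 0 < N) {w : ℝ}
    (hw : 0 < w) (hNw : 2304 * (K : ℝ) ^ 2 * (n ^ 2 * w ^ 2) ≤ N) (Γ : Fin n → Fin n → ℝ)
    (hΓ : ∀ u v, |Γ u v| ≤ 1) :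
    μ.real {ω | 1 / (24 * w) ≤ |(∑ i ∈ range N, quad Γ (X i ω)) / N - p.expect (quad Γ)|} ≤
      1 / 4 := by
  have hN' : (0 : ℝ) < N := by exact_mod_cast hN
  refine (hX.chebyshev hN _ (hp.variance_quad_le' hη hf Γ hΓ) (by positivity)).trans ?_
  rw [div_le_iff₀ (by positivity)]
  have h1 : ((n : ℝ) / η) ^ 2 ≤ n ^ 2 * K ^ 2 := by
    rw [div_eq_mul_one_div, mul_pow]; gcongr
  -- The constant 2304 is 4 · 24², for error probability 1/4 at deviation 1/(24w).
  have h2 : 1 / 4 * ((N : ℝ) * (1 / (24 * w)) ^ 2) = N / (2304 * w ^ 2) := by field_simp; norm_num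
  rw [h2, le_div_iff₀ (by positivity)]
  calc _ ≤ (n : ℝ) ^ 2 * K ^ 2 * (2304 * w ^ 2) := by gcongr
    _ = 2304 * (K : ℝ) ^ 2 * (n ^ 2 * w ^ 2) := by ring
    _ ≤ N := hNw

theorem abs_weakLearn (k : ℕ) (x : ℕ → Config n) (u v : Fin n) : |weakLearn k x u v| = 1 := by
  unfold weakLearn; split_ifs <;> simp

/-- Every configuration has positive probability, so X_u X_v is not almost surely constant.
Strictness is what the tilting of the random walk requires. -/
theorem IsingModel.abs_corr_lt_one {u v : Fin n} (h : u ≠ v) : |p.corr u v| < 1 := by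
  have key : ∀ c : ℝ, |c| = 1 → 0 < p.expect fun x => 1 - c * (spin (x u) * spin (x v)) := by
    intro c hc
    refine sum_pos' (fun x _ => mul_nonneg (p.prob_pos x).le ?_) ?_
    · have : |c * (spin (x u) * spin (x v))| = 1 := by
        rw [abs_mul, abs_mul, hc, abs_spin, abs_spin]; norm_num
      linarith [le_abs_self (c * (spin (x u) * spin (x v)))]
    -- A configuration in which c x_u x_v = -1.
    · refine ⟨Function.update (fun _ => true) u (decide (c ≠ 1)), mem_univ _,
        mul_pos (p.prob_pos _) ?_⟩
      simp only [Function.update_self, Function.update_of_ne h.symm]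
      rcases eq_or_eq_neg_of_abs_eq hc with rfl | rfl <;> norm_num [spin]
  have h1 := key 1 (by simp)
  have h2 := key (-1) (by simp)
  rw [p.expect_sub (fun _ => (1 : ℝ)), p.expect_const, p.expect_const_mul] at h1 h2
  change 0 < 1 - 1 * p.corr u v at h1
  change 0 < 1 - -1 * p.corr u v at h2
  exact abs_lt.2 ⟨by linarith, by linarith⟩

/-- The product X_u X_v is a sign of mean λ_uv, and a sum of an odd number of signs is not 0. So the
learned sign is the sign of a biased random walk, and the tie rule is irrelevant. -/
theorem IsSample.weakLearn_mean (hX : IsSample p μ X N) (hN : Odd N) {c : ℝ} (hc : 0 ≤ c)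
    (hc1 : 2 * c ^ 2 * N ≤ 1) {u v : Fin n} (huv : u ≠ v)
    (hc2 : 2 * c ^ 2 * (N * p.corr u v) ^ 2 ≤ 1) :
    c * N / 2 * p.corr u v ^ 2 ≤
      ∫ ω, weakLearn N (fun i => X i ω) u v * p.corr u v ∂μ := by
  set Y : Config n → ℤ := fun x => if x u = x v then 1 else -1 with hYdef
  have hY : ∀ x, Y x = 1 ∨ Y x = -1 := by
    intro x; simp only [Y]; split_ifs
    exacts [Or.inl rfl, Or.inr rfl]
  have hYs : ∀ x : Config n, (Y x : ℝ) = spin (x u) * spin (x v) := by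
    intro x; simp only [Y]
    cases x u <;> cases x v <;> simp [spin]
  have hm : p.expect (fun x => (Y x : ℝ)) = p.corr u v := by simp only [hYs]; rfl
  have hpar : ∀ (k : ℕ) (ω : Ω), (2 : ℤ) ∣ ∑ i ∈ range k, Y (X i ω) - k := by
    intro k ω
    have : ∑ i ∈ range k, Y (X i ω) - k = ∑ i ∈ range k, (Y (X i ω) - 1) := by
      rw [sum_sub_distrib]; simp
    rw [this]
    refine dvd_sum fun i _ => ?_
    rcases hY (X i ω) with h | h <;> rw [h] <;> decide
  have hsign : ∀ ω, weakLearn N (fun i => X i ω) u v =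
      (((∑ i ∈ range N, Y (X i ω)).sign : ℤ) : ℝ) := by
    intro ω
    have hne : ∑ i ∈ range N, Y (X i ω) ≠ 0 := by
      intro h0
      have := hpar N ω
      rw [h0] at this
      obtain ⟨j, rfl⟩ := hN
      omega
    have hpos : (0 : ℝ) < N := by exact_mod_cast hN.pos
    have e : empEdge N (fun i => X i ω) u v = ((∑ i ∈ range N, Y (X i ω) : ℤ) : ℝ) / N := by
      rw [empEdge]; push_cast; simp only [hYs]
    rw [weakLearn, e]
    rcases lt_or_gt_of_ne hne with h | h
    · rw [Int.sign_eq_neg_one_of_neg h, if_neg]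
      · simp
      · have : ((∑ i ∈ range N, Y (X i ω) : ℤ) : ℝ) < 0 := by exact_mod_cast h
        exact not_le.2 (div_neg_of_neg_of_pos this hpos)
    · rw [Int.sign_eq_one_of_pos h, if_pos]
      · simp
      · have : (0 : ℝ) < ((∑ i ∈ range N, Y (X i ω) : ℤ) : ℝ) := by exact_mod_cast h
        exact (div_pos this hpos).le
  simp only [hsign]
  rw [integral_mul_const, hX.integral_walk Y hY le_rfl (fun s => (s.sign : ℝ)), hm, mul_comm _ (p.corr u v)]
  exact walk_sign_mul_ge hN.pos (IsingModel.abs_corr_lt_one huv) hc hc1 hc2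

theorem sq_sum_Ioi_le (F : Fin n → Fin n → ℝ) :
    (∑ u, ∑ v ∈ Ioi u, F u v) ^ 2 ≤ n ^ 2 * ∑ u, ∑ v ∈ Ioi u, F u v ^ 2 := by
  calc _ ≤ (n : ℝ) * ∑ u, (∑ v ∈ Ioi u, F u v) ^ 2 := by
        have := sq_sum_le_card_mul_sum_sq (s := univ) (f := fun u => ∑ v ∈ Ioi u, F u v)
        simpa using this
    _ ≤ (n : ℝ) * ∑ u, n * ∑ v ∈ Ioi u, F u v ^ 2 := by
        gcongr with u
        refine (sq_sum_le_card_mul_sum_sq (s := Ioi u) (f := F u)).trans ?_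
        refine mul_le_mul_of_nonneg_right ?_ (sum_nonneg fun _ _ => sq_nonneg _)
        exact_mod_cast (card_le_univ (Ioi u)).trans_eq (Fintype.card_fin n)
    _ = _ := by rw [← mul_sum]; ring

/-- The total correlation `∑_{u < v} |E[X_u X_v]|`. -/
def totalCorr (p : IsingModel n) : ℝ := ∑ u, ∑ v ∈ Ioi u, |p.corr u v|

/-- A single weak learner finds a sign vector of large correlation with a probability that is
proportional to the total correlation. -/
theorem IsSample.weakLearn_good (hX : IsSample p μ X N) (hN : Odd N) {c : ℝ} (hc : 0 ≤ c)
    (hc1 : 2 * c ^ 2 * N ≤ 1)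
    (hc2 : ∀ u v, u < v → 2 * c ^ 2 * (N * p.corr u v) ^ 2 ≤ 1) {w : ℝ} (hw : 0 ≤ w)
    (hcw : w / 6 ≤ c * N / 2) :
    w * totalCorr p ^ 2 / (12 * n ^ 2) ≤ totalCorr p * μ.real {ω |
      w * totalCorr p ^ 2 / (12 * n ^ 2) ≤
        p.expect (quad (weakLearn N fun i => X i ω))} := by
  -- Reverse Markov with upper bound T, which no sign vector exceeds. The expectation is at least
  -- (w/6) ∑ λ_uv², and Cauchy-Schwarz over at most n² pairs turns this into (w/6) T²/n².
  refine measureReal_ge_of_integral_ge (by positivity) (fun ω => ?_) ?_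
  · rw [p.expect_quad]
    refine sum_le_sum fun u _ => sum_le_sum fun v _ => ?_
    refine (le_abs_self _).trans ?_
    rw [abs_mul, abs_weakLearn, one_mul]
  · simp only [p.expect_quad]
    rw [integral_finsetSum _ fun _ _ => Integrable.of_finite]
    have h1 : ∀ u : Fin n, ∀ v ∈ Ioi u, w / 6 * p.corr u v ^ 2 ≤
        ∫ ω, weakLearn N (fun i => X i ω) u v * p.corr u v ∂μ := by
      intro u v hv
      refine le_trans ?_ (hX.weakLearn_mean hN hc hc1 (mem_Ioi.1 hv).ne (hc2 u v (mem_Ioi.1 hv)))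
      gcongr
    have h2 : ∑ u, ∑ v ∈ Ioi u, w / 6 * p.corr u v ^ 2 ≤
        ∑ u, ∫ ω, ∑ v ∈ Ioi u, weakLearn N (fun i => X i ω) u v * p.corr u v ∂μ := by
      refine sum_le_sum fun u _ => ?_
      rw [integral_finsetSum _ fun _ _ => Integrable.of_finite]
      exact sum_le_sum (h1 u)
    refine le_trans ?_ h2
    have h3 := sq_sum_Ioi_le fun u v => |p.corr u v|
    simp only [sq_abs] at h3
    simp only [← mul_sum]
    rcases Nat.eq_zero_or_pos n with rfl | hn
    · simp
    have hn' : (0 : ℝ) < n := by exact_mod_cast hn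
    have h4 : totalCorr p ^ 2 / n ^ 2 ≤ ∑ u, ∑ v ∈ Ioi u, p.corr u v ^ 2 := by
      rw [div_le_iff₀ (by positivity), mul_comm]; exact h3
    calc _ = w / 6 * (totalCorr p ^ 2 / n ^ 2) := by field_simp; ring
      _ ≤ _ := by gcongr

/-- Condition on the value of `A`: it is independent of the votes, which read disjoint samples, so
the bound for each fixed good value averages to the bound for the selected one. Finiteness of `α`
makes this a finite sum. -/
theorem measureReal_select_le {α : Type*} [Fintype α] (hX : iIndepFun X μ) {S T : Finset ℕ}
    (hST : Disjoint S T) {A : (ℕ → Config n) → α} (hA : DependsOn A S)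
    {V : α → (ℕ → Config n) → Prop} (hV : ∀ a, DependsOn (V a) T) {Good : α → Prop} {q : ℝ}
    (hq : 0 ≤ q) (h : ∀ a, Good a → μ.real {ω | V a fun i => X i ω} ≤ q) :
    μ.real {ω | Good (A fun i => X i ω) ∧ V (A fun i => X i ω) fun i => X i ω} ≤ q := by
  classical
  have hind : ∀ a, μ.real ({ω | A (fun i => X i ω) = a} ∩ {ω | V a fun i => X i ω}) =
      μ.real {ω | A (fun i => X i ω) = a} * μ.real {ω | V a fun i => X i ω} := by
    intro a
    have h1 := iIndepFun_of_dependsOn hX (fun _ => Measurable.of_discrete)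
      (fun b : Bool => if b then S else T)
      (by
        intro i j hij
        cases i <;> cases j <;> simp_all [hST.symm])
      (fun b x => if b then A x = a else V a x)
      (by
        intro b
        cases b
        · simpa using hV a
        · intro x y hxy
          simp only [if_true] at hxy ⊢
          rw [hA hxy])
    have h2 := (h1.indepFun (i := true) (j := false) (by decide)).measure_inter_preimage_eq_mul
      {True} {True} MeasurableSet.of_discrete MeasurableSet.of_discrete
    simp only [if_true, Bool.false_eq_true, if_false] at h2
    have e : ∀ P : Ω → Prop, (fun ω => P ω) ⁻¹' {True} = {ω | P ω} := by
      intro P; ext ω; simp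
    rw [e, e] at h2
    simp only [measureReal_def, ← ENNReal.toReal_mul, h2]
  have hsub : {ω | Good (A fun i => X i ω) ∧ V (A fun i => X i ω) fun i => X i ω} ⊆
      ⋃ a ∈ univ.filter Good, ({ω | A (fun i => X i ω) = a} ∩ {ω | V a fun i => X i ω}) := by
    rintro ω ⟨h1, h2⟩
    simp only [Set.mem_iUnion]
    exact ⟨_, mem_filter.2 ⟨mem_univ _, h1⟩, rfl, h2⟩
  have htot : ∑ a, μ.real {ω | A (fun i => X i ω) = a} = 1 := by
    have h3 := measureReal_biUnion_finset (μ := μ) (s := univ)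
      (f := fun a => {ω | A (fun i => X i ω) = a})
      (fun a _ b _ hab => Set.disjoint_left.2 fun ω h1 h2 => hab (h1.symm.trans h2))
      (fun _ _ => MeasurableSet.of_discrete)
    rw [← h3]
    have : (⋃ a ∈ (univ : Finset α), {ω | A (fun i => X i ω) = a}) = Set.univ := by
      ext ω; simp
    rw [this]; simp
  calc _ ≤ μ.real _ := measureReal_mono hsub (measure_ne_top _ _)
    _ ≤ ∑ a ∈ univ.filter Good, μ.real _ := measureReal_biUnion_finset_le _ _
    _ ≤ ∑ a ∈ univ.filter Good, μ.real {ω | A (fun i => X i ω) = a} * q := by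
        refine sum_le_sum fun a ha => ?_
        rw [hind]
        exact mul_le_mul_of_nonneg_left (h a (mem_filter.1 ha).2) measureReal_nonneg
    _ ≤ ∑ a, μ.real {ω | A (fun i => X i ω) = a} * q :=
        sum_le_sum_of_subset_of_nonneg (subset_univ _) fun _ _ _ =>
          mul_nonneg measureReal_nonneg hq
    _ = q := by rw [← sum_mul, htot, one_mul]

end Stages

end IsingTest

end

noncomputable section

namespace IsingTest

open Finset ProbabilityTheory

/-! ### Powers of the number of vertices -/

/-- The power `n ^ (2 / 3)`, in terms of which the parameters of the algorithm with `τ = 4 / 3`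
are expressed. -/
def cbrtSq (n : ℕ) : ℝ := (n : ℝ) ^ (2 / 3 : ℝ)

theorem cbrtSq_nonneg (n : ℕ) : 0 ≤ cbrtSq n := Real.rpow_nonneg (Nat.cast_nonneg n) _

theorem cbrtSq_pow (n k : ℕ) : cbrtSq n ^ k = (n : ℝ) ^ (2 / 3 * k : ℝ) :=
  (Real.rpow_mul_natCast (Nat.cast_nonneg n) _ _).symm

theorem cbrtSq_pow_three (n : ℕ) : cbrtSq n ^ 3 = (n : ℝ) ^ 2 := by
  rw [cbrtSq_pow, ← Real.rpow_natCast]; norm_num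

theorem one_le_cbrtSq {n : ℕ} (hn : 0 < n) : 1 ≤ cbrtSq n :=
  Real.one_le_rpow (by exact_mod_cast hn) (by norm_num)

theorem cbrtSq_le {n : ℕ} (hn : 0 < n) : cbrtSq n ≤ n := by
  have : (n : ℝ) ^ (2 / 3 : ℝ) ≤ (n : ℝ) ^ (1 : ℝ) :=
    Real.rpow_le_rpow_of_exponent_le (by exact_mod_cast hn) (by norm_num)
  simpa [cbrtSq] using this

theorem le_cbrtSq_sq {n : ℕ} (hn : 0 < n) : (n : ℝ) ≤ cbrtSq n ^ 2 := by
  have : (n : ℝ) ^ (1 : ℝ) ≤ (n : ℝ) ^ (2 / 3 * (2 : ℕ) : ℝ) :=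
    Real.rpow_le_rpow_of_exponent_le (by exact_mod_cast hn) (by norm_num)
  rw [cbrtSq_pow]; simpa using this

theorem rpow_four_thirds (n : ℕ) : (n : ℝ) ^ (4 / 3 : ℝ) = cbrtSq n ^ 2 := by
  rw [cbrtSq_pow]; norm_num

theorem rpow_two_sub (n : ℕ) : (n : ℝ) ^ (2 - 4 / 3 : ℝ) = cbrtSq n := by
  rw [cbrtSq]; norm_num

namespace Constants

variable (a : Constants) (n : ℕ) (β ε : ℝ)

theorem locSamples_eq : a.locSamples n (4 / 3) β ε =
    ⌊a.loc * (cbrtSq n ^ 2 * (β / ε)) ^ 2 * ((Nat.log 2 n + 1 : ℕ) : ℝ)⌋₊ := by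
  have : (n : ℝ) ^ (2 * (4 / 3) : ℝ) = cbrtSq n ^ 4 := by rw [cbrtSq_pow]; norm_num
  rw [locSamples, this]; congr 2; ring

theorem repetitions_eq : a.repetitions n (4 / 3) = ⌈a.rep * cbrtSq n⌉₊ := by
  rw [repetitions, rpow_two_sub]

theorem learnSamples_eq : a.learnSamples n (4 / 3) β ε =
    2 * ⌊a.learn * (cbrtSq n ^ 2 * (β / ε)) ^ 2⌋₊ - 1 := by
  have : (n : ℝ) ^ (2 * (4 / 3) : ℝ) = cbrtSq n ^ 4 := by rw [cbrtSq_pow]; norm_num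
  rw [learnSamples, this]; congr 3; ring

theorem testSamples_eq : a.testSamples n (4 / 3) β ε =
    ⌊a.test * (n ^ 2 * (cbrtSq n * (β / ε)) ^ 2)⌋₊ := by
  have : (n : ℝ) ^ (6 - 2 * (4 / 3) : ℝ) = cbrtSq n ^ 5 := by rw [cbrtSq_pow]; norm_num
  rw [testSamples, this, ← cbrtSq_pow_three]; congr 1; ring

end Constants

/-- Doubling the constants of the sample sizes thus pays for rounding down, unless the size is 0. -/
theorem half_le_floor {x : ℝ} (hx : 1 ≤ x) : x / 2 ≤ ⌊x⌋₊ := by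
  have h1 := Nat.lt_floor_add_one x
  have h2 : (1 : ℝ) ≤ ⌊x⌋₊ := by exact_mod_cast (Nat.one_le_floor_iff x).2 hx
  linarith

/-! ### Correctness -/

/-- The sign vector of a weak learner. -/
def learnSign {n : ℕ} (k : ℕ) (x : ℕ → Config n) (u v : Fin n) : Bool :=
  haveI := Classical.propDecidable; decide (0 ≤ empEdge k x u v)

/-- Boolean sign matrices form a finite type, over which one can condition. -/
theorem weakLearn_eq_spin {n : ℕ} (k : ℕ) (x : ℕ → Config n) :
    weakLearn k x = fun u v => spin (learnSign k x u v) := by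
  ext u v
  by_cases h : 0 ≤ empEdge k x u v <;> simp [weakLearn, learnSign, spin, h]

theorem dependsOn_learnSign {n : ℕ} (k : ℕ) :
    DependsOn (fun x : ℕ → Config n => learnSign k x) (range k) := by
  intro x y h
  ext u v
  have : empEdge k x u v = empEdge k y u v := by
    unfold empEdge
    congr 1
    exact sum_congr rfl fun i hi => by rw [h i hi]
  simp only [learnSign, this]

theorem dependsOn_voteRejects {n : ℕ} (D : ℕ) (τ β ε : ℝ) (Γ : Fin n → Fin n → ℝ) (R k : ℕ) :
    DependsOn (fun x : ℕ → Config n => VoteRejects D τ β ε Γ R k x) (range (R * k)) := by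
  classical
  intro x y h
  simp only [VoteRejects]
  have : ∀ r ∈ range R, (ThresholdRejects D τ β ε Γ k (fun i => x (r * k + i)) ↔
      ThresholdRejects D τ β ε Γ k fun i => y (r * k + i)) := by
    intro r hr
    refine iff_of_eq (dependsOn_thresholdRejects D τ β ε Γ k fun i hi => h _ ?_)
    rw [mem_range] at hr
    simp only [coe_range, Set.mem_Iio] at hi ⊢
    calc r * k + i < r * k + k := by omega
      _ = (r + 1) * k := by ring
      _ ≤ R * k := Nat.mul_le_mul_right k hr
  rw [filter_congr this]

theorem dependsOn_shift {E γ : Type*} {k : ℕ} {F : (ℕ → E) → γ} (hF : DependsOn F (range k))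
    (s : ℕ) : DependsOn (fun x : ℕ → E => F fun i => x (s + i)) (Ico s (s + k)) := by
  intro x y h
  refine hF fun i hi => h _ ?_
  simp only [coe_range, Set.mem_Iio] at hi
  simp only [coe_Ico, Set.mem_Ico]; omega

theorem localizationRejects_iff {n : ℕ} {β ε : ℝ} (hε : 0 < ε) (k : ℕ) (x : ℕ → Config n) :
    LocalizationRejects (4 / 3) β ε k x ↔ ∃ u v : Fin n, u < v ∧
      1 ≤ 2 * (cbrtSq n ^ 2 * (β / ε)) *
        |empEdge k x u v - empNode k x u * empNode k x v| := by
  unfold LocalizationRejects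
  refine exists_congr fun u => exists_congr fun v => and_congr_right fun _ => ?_
  rw [rpow_four_thirds, ← mul_le_mul_iff_of_pos_left (b := 1) hε, mul_one]
  have : ∀ y : ℝ, ε * (2 * (cbrtSq n ^ 2 * (β / ε)) * y) = 2 * β * cbrtSq n ^ 2 * y := by
    intro y; field_simp
  rw [this]

/-- The constants of the algorithm, for an upper bound `K` of `1 / η`. -/
def constants (K : ℕ) (hK : 0 < K) : Constants where
  -- 512 and 4608 are twice the 256 and 2304 required by localization and by a test block. 60 = 5 ·
  -- 12 learners per unit of s give failure e^(-5). 80 gives R/8 = 10 (⌊log₂ n⌋ + 1). 24 puts the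
  -- threshold at half the mean 1/(12sb) of a good sign vector.
  loc := 512 * K ^ 2
  rep := 60
  learn := K ^ 2
  vote := 80
  test := 4608 * K ^ 2
  thr := 24
  loc_pos := by positivity
  rep_pos := by positivity
  learn_pos := by positivity
  vote_pos := by positivity
  test_pos := by positivity
  thr_pos := by positivity

section Correctness

set_option linter.unusedSectionVars false

variable {n : ℕ} {Ω : Type*} [MeasurableSpace Ω]
  [DiscreteMeasurableSpace Ω] [Finite Ω] {μ : Measure Ω}
  [IsProbabilityMeasure μ] {p : IsingModel n} {X : ℕ → Ω → Config n} {N : ℕ}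

open Classical in
-- A block votes against such a vector only if its empirical mean deviates by 1/(24sb). Empty blocks
-- have mean 0 and never vote against, so the size condition is needed for positive k only.
theorem IsSample.vote_of_expect_eq_zero {R k : ℕ} (hX : IsSample p μ X (R * k)) {η : ℝ}
    (hp : p.HighTemperature η) (hη : 0 < η) (hf : p.NoExternalField) {K : ℕ} (hK : 1 / η ≤ K)
    {β ε : ℝ} (hε : 0 < ε) (Γ : Fin n → Fin n → ℝ) (hΓ : ∀ u v, |Γ u v| ≤ 1)
    (hk : 0 < k → 0 < cbrtSq n * (β / ε) ∧
      2304 * (K : ℝ) ^ 2 * (n ^ 2 * (cbrtSq n * (β / ε)) ^ 2) ≤ k)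
    (hΓ0 : p.expect (quad Γ) = 0) :
    μ.real {ω | VoteRejects 24 (4 / 3) β ε Γ R k fun i => X i ω} ≤ Real.exp (-(R / 8)) := by
  refine (measureReal_mono ?_).trans (measureReal_majority_le hX.indep
    (dependsOn_thresholdRejects 24 (4 / 3) β ε Γ k) (R := R) ?_)
  · intro ω hω
    have h : R < 2 * _ := hω
    exact h.le
  · intro r hr
    have hle : r * k + k ≤ R * k := by rw [← Nat.succ_mul]; exact Nat.mul_le_mul_right k hr
    rcases Nat.eq_zero_or_pos k with rfl | hk0
    · simp only [thresholdRejects_iff hε]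
      norm_num
    obtain ⟨hw, hkw⟩ := hk hk0
    refine (measureReal_mono ?_).trans
      ((hX.shift hle).test_block hp hη hf hK hk0 hw hkw Γ hΓ)
    intro ω hω
    simp only [Set.mem_ofPred_eq, thresholdRejects_iff hε, rpow_two_sub] at hω ⊢
    rw [hΓ0, sub_zero]
    refine le_trans ?_ (le_abs_self _)
    rw [div_le_iff₀ (by positivity), mul_comm]
    exact_mod_cast hω.le

open Classical in
-- The mean is at least twice the threshold, so a block that fails to reject deviates by 1/(24sb).
theorem IsSample.vote_of_expect_ge {R k : ℕ} (hX : IsSample p μ X (R * k)) {η : ℝ}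
    (hp : p.HighTemperature η) (hη : 0 < η) (hf : p.NoExternalField) {K : ℕ} (hK : 1 / η ≤ K)
    {β ε : ℝ} (hε : 0 < ε) (Γ : Fin n → Fin n → ℝ) (hΓ : ∀ u v, |Γ u v| ≤ 1)
    (hk : 0 < k) (hw : 0 < cbrtSq n * (β / ε))
    (hkw : 2304 * (K : ℝ) ^ 2 * (n ^ 2 * (cbrtSq n * (β / ε)) ^ 2) ≤ k)
    (hΓ0 : 1 / (12 * (cbrtSq n * (β / ε))) ≤ p.expect (quad Γ)) :
    μ.real {ω | ¬ VoteRejects 24 (4 / 3) β ε Γ R k fun i => X i ω} ≤ Real.exp (-(R / 8)) := by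
  have hdep := dependsOn_thresholdRejects (n := n) 24 (4 / 3) β ε Γ k
  refine (measureReal_mono ?_).trans (measureReal_majority_le hX.indep (R := R) (k := k)
    (Q := fun x => ¬ ThresholdRejects 24 (4 / 3) β ε Γ k x) ?_ ?_)
  · intro ω hω
    simp only [Set.mem_ofPred_eq, VoteRejects, not_lt] at hω ⊢
    have := card_filter_add_card_filter_not (s := range R)
      (fun r => ThresholdRejects 24 (4 / 3) β ε Γ k fun i => X (r * k + i) ω)
    rw [card_range] at this
    have key : R ≤ 2 * ((range R).filter
        fun r => ¬ ThresholdRejects 24 (4 / 3) β ε Γ k fun i => X (r * k + i) ω).card := by omega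
    convert key
  · intro x y h
    have := hdep h
    simp only at this ⊢
    rw [this]
  · intro r hr
    have hle : r * k + k ≤ R * k := by rw [← Nat.succ_mul]; exact Nat.mul_le_mul_right k hr
    refine (measureReal_mono ?_).trans
      ((hX.shift hle).test_block hp hη hf hK hk hw hkw Γ hΓ)
    intro ω hω
    simp only [Set.mem_ofPred_eq, thresholdRejects_iff hε, rpow_two_sub, not_lt] at hω ⊢
    rw [abs_sub_comm]
    refine le_trans ?_ (le_abs_self _)
    have h1 : (∑ i ∈ range k, quad Γ (X (r * k + i) ω)) / k ≤
        1 / (24 * (cbrtSq n * (β / ε))) := by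
      rw [le_div_iff₀ (by positivity), mul_comm]
      exact_mod_cast hω
    have h2 : 1 / (12 * (cbrtSq n * (β / ε))) =
      1 / (24 * (cbrtSq n * (β / ε))) + 1 / (24 * (cbrtSq n * (β / ε))) := by
        field_simp; norm_num
    linarith

/-- With m = ⌊log₂ n⌋ + 1 there are at most 61 · 2^m learners, while e^(-R/8) = e^(-10m). -/
theorem mul_exp_rounds_le {K : ℕ} (hK : 0 < K) :
    ((constants K hK).repetitions n (4 / 3) : ℝ) *
      Real.exp (-(((constants K hK).rounds n : ℕ) / 8)) ≤ 2 / 25 := by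
  rw [Constants.repetitions_eq]
  rcases Nat.eq_zero_or_pos n with rfl | hn
  · have : cbrtSq 0 = 0 := by rw [cbrtSq]; norm_num
    rw [this]; norm_num
  set m := Nat.log 2 n + 1 with hm
  have hr : (((constants K hK).rounds n : ℕ) : ℝ) / 8 = m * 10 := by
    rw [Constants.rounds]; simp only [constants]; push_cast [← hm]; ring
  have hn2 : (n : ℝ) ≤ 2 ^ m := by exact_mod_cast (Nat.lt_pow_succ_log_self (by norm_num) n).le
  have h2m : (1 : ℝ) ≤ 2 ^ m := one_le_pow₀ (by norm_num)
  have hL : (⌈((constants K hK).rep : ℝ) * cbrtSq n⌉₊ : ℝ) ≤ 61 * 2 ^ m := by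
    refine (Nat.ceil_lt_add_one (by have := cbrtSq_nonneg n; positivity)).le.trans ?_
    have := cbrtSq_le hn
    simp only [constants]; push_cast
    linarith
  rw [hr]
  have he : Real.exp (-(m * 10)) = Real.exp (-10) ^ m := by
    rw [← Real.exp_nat_mul]; ring_nf
  have he10 : Real.exp (-10) ≤ Real.exp (-8) := Real.exp_le_exp.2 (by norm_num)
  have h8 := exp_neg_eight_le
  calc _ ≤ (61 * 2 ^ m) * Real.exp (-10) ^ m := by rw [he]; gcongr
    _ = 61 * (2 * Real.exp (-10)) ^ m := by rw [mul_pow]; ring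
    _ ≤ 61 * (2 * Real.exp (-10)) ^ 1 := by
        gcongr 61 * ?_
        exact pow_le_pow_of_le_one (by positivity) (by linarith) (by omega)
    _ ≤ _ := by linarith

/-- Without correlations the statistic of every sign vector has mean 0, whatever was learned. A
union bound over localization and the learners gives 1/100 + 2/25. -/
theorem IsSample.reject_of_corr_eq_zero {K : ℕ} (hK0 : 0 < K) {β ε : ℝ} (hβ : 0 ≤ β) (hε : 0 < ε)
    (hX : IsSample p μ X ((constants K hK0).samples n (4 / 3) β ε)) {η : ℝ}
    (hp : p.HighTemperature η) (hη : 0 < η) (hf : p.NoExternalField) (hK : 1 / η ≤ K)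
    (hcorr : ∀ u v, u ≠ v → p.corr u v = 0) :
    μ.real {ω | SequenceRejects (constants K hK0) (4 / 3) β ε fun i => X i ω} ≤ 1 / 10 := by
  set a := constants K hK0 with ha
  set k₀ := a.locSamples n (4 / 3) β ε with hk₀
  set L := a.repetitions n (4 / 3) with hL
  set k₁ := a.learnSamples n (4 / 3) β ε with hk₁
  set R := a.rounds n with hR
  set k₂ := a.testSamples n (4 / 3) β ε with hk₂
  have hN : a.samples n (4 / 3) β ε = k₀ + L * k₁ + R * k₂ := rfl
  have hb : 0 ≤ β / ε := div_nonneg hβ hε.le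
  have hs := cbrtSq_nonneg n
  have hK1 : (1 : ℝ) ≤ K := by exact_mod_cast hK0
  -- localization
  have h1 : μ.real {ω | LocalizationRejects (4 / 3) β ε k₀ fun i => X i ω} ≤ 1 / 100 := by
    -- Without samples the empirical covariances are 0 and localization does not reject.
    rcases Nat.eq_zero_or_pos k₀ with h0 | h0
    · rw [h0]
      simp only [localizationRejects_iff hε]
      norm_num [empEdge, empNode]
    have hX0 : IsSample p μ X k₀ := by
      have := hX.shift (s := 0) (k := k₀) (by omega)
      simpa only [zero_add] using this
    have hx : 0 < k₀ := h0
    rw [hk₀, a.locSamples_eq, Nat.floor_pos] at hx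
    have hw : 0 < cbrtSq n ^ 2 * (β / ε) := by
      rcases (by positivity : 0 ≤ cbrtSq n ^ 2 * (β / ε)).eq_or_lt with h | h
      · rw [← h] at hx; norm_num at hx
      · exact h
    refine (measureReal_mono ?_).trans (hX0.localization hf h0 hw (Nat.succ_pos (Nat.log 2 n))
      (Nat.lt_pow_succ_log_self (by norm_num) n) ?_)
    · intro ω hω
      simp only [Set.mem_ofPred_eq, localizationRejects_iff hε] at hω ⊢
      obtain ⟨u, v, huv, h⟩ := hω
      refine ⟨u, v, huv, ?_⟩
      rw [hcorr u v huv.ne, sub_zero, div_le_iff₀ (by positivity), mul_comm]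
      exact h
    · have := half_le_floor hx
      rw [← a.locSamples_eq, ← hk₀] at this
      refine le_trans (le_of_eq_of_le ?_ (mul_le_mul_of_nonneg_left (one_le_pow₀ hK1 (n := 2))
        (by positivity :
          0 ≤ 256 * (cbrtSq n ^ 2 * (β / ε)) ^ 2 * ((Nat.log 2 n + 1 : ℕ) : ℝ)))) ?_
      · simp
      · refine le_trans (le_of_eq ?_) this
        simp only [ha, constants]; push_cast; ring
  -- votes
  have hk : 0 < k₂ → 0 < cbrtSq n * (β / ε) ∧
      2304 * (K : ℝ) ^ 2 * (n ^ 2 * (cbrtSq n * (β / ε)) ^ 2) ≤ k₂ := by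
    intro h0
    have hx : 0 < k₂ := h0
    rw [hk₂, a.testSamples_eq, Nat.floor_pos] at hx
    refine ⟨?_, ?_⟩
    · rcases (by positivity : 0 ≤ cbrtSq n * (β / ε)).eq_or_lt with h | h
      · rw [← h] at hx; norm_num at hx
      · exact h
    · have := half_le_floor hx
      rw [← a.testSamples_eq, ← hk₂] at this
      refine le_trans (le_of_eq ?_) this
      simp only [ha, constants]; push_cast; ring
  have hXt : IsSample p μ (fun i => X (k₀ + L * k₁ + i)) (R * k₂) := hX.shift (by omega)
  have h2 : ∀ l ∈ range L, μ.real {ω | VoteRejects 24 (4 / 3) β ε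
      (weakLearn k₁ fun i => X (k₀ + l * k₁ + i) ω) R k₂ fun i => X (k₀ + L * k₁ + i) ω} ≤
      Real.exp (-(R / 8)) := by
    intro l hl
    have hle : l * k₁ + k₁ ≤ L * k₁ := by
      rw [← Nat.succ_mul]; exact Nat.mul_le_mul_right k₁ (mem_range.1 hl)
    have := measureReal_select_le (μ := μ) hX.indep
      (S := Ico (k₀ + l * k₁) (k₀ + l * k₁ + k₁))
      (T := Ico (k₀ + L * k₁) (k₀ + L * k₁ + R * k₂))
      (by
        rw [Finset.disjoint_left]
        intro i hi hi'
        rw [mem_Ico] at hi hi'; omega)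
      (A := fun x => learnSign k₁ fun i => x (k₀ + l * k₁ + i))
      (dependsOn_shift (dependsOn_learnSign k₁) _)
      (V := fun σ x => VoteRejects 24 (4 / 3) β ε (fun u v => spin (σ u v)) R k₂
        fun i => x (k₀ + L * k₁ + i))
      (fun σ => dependsOn_shift (dependsOn_voteRejects 24 (4 / 3) β ε _ R k₂) _)
      -- No selection takes place here: each learner is bounded for all values of its sign vector.
      (Good := fun _ => True) (q := Real.exp (-(R / 8))) (Real.exp_pos _).le
      (fun σ _ => hXt.vote_of_expect_eq_zero hp hη hf hK hε _ (fun u v => (abs_spin _).le) hk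
        (by
          rw [p.expect_quad]
          exact sum_eq_zero fun u _ => sum_eq_zero fun v hv => by
            rw [hcorr u v (mem_Ioi.1 hv).ne, mul_zero]))
    simp only [true_and] at this
    simpa only [weakLearn_eq_spin] using this
  have hsub : {ω | SequenceRejects a (4 / 3) β ε fun i => X i ω} ⊆
      {ω | LocalizationRejects (4 / 3) β ε k₀ fun i => X i ω} ∪
      ⋃ l ∈ range L, {ω | VoteRejects 24 (4 / 3) β ε
        (weakLearn k₁ fun i => X (k₀ + l * k₁ + i) ω) R k₂ fun i => X (k₀ + L * k₁ + i) ω} := by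
    rintro ω (h | ⟨l, hl, h⟩)
    · exact Or.inl h
    · refine Or.inr ?_
      simp only [Set.mem_iUnion]
      exact ⟨l, mem_range.2 hl, h⟩
  calc _ ≤ μ.real _ := measureReal_mono hsub (measure_ne_top _ _)
    _ ≤ 1 / 100 + ∑ l ∈ range L, Real.exp (-(R / 8)) := by
        refine (measureReal_union_le _ _).trans (add_le_add h1 ?_)
        exact (measureReal_biUnion_finset_le _ _).trans (sum_le_sum h2)
    _ = 1 / 100 + L * Real.exp (-(R / 8)) := by simp
    _ ≤ 1 / 100 + 2 / 25 := by gcongr; exact mul_exp_rounds_le hK0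
    _ ≤ _ := by norm_num

end Correctness

end IsingTest

end

noncomputable section

namespace IsingTest

open Finset ProbabilityTheory

/-! ### Correctness far from independence -/

section Correctness

set_option linter.unusedSectionVars false

variable {n : ℕ} {Ω : Type*} [MeasurableSpace Ω]
  [DiscreteMeasurableSpace Ω] [Finite Ω] {μ : Measure Ω}
  [IsProbabilityMeasure μ] {p : IsingModel n} {X : ℕ → Ω → Config n} {N : ℕ}

theorem IsingModel.HighTemperature.totalCorr_le {η : ℝ} (hp : p.HighTemperature η) (hη : 0 < η)
    (hf : p.NoExternalField) {K : ℕ} (hK : 1 / η ≤ K) : totalCorr p ≤ n * K := by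
  calc _ ≤ ∑ u, ∑ v, |p.corr u v| := sum_le_sum fun u _ =>
        sum_le_sum_of_subset_of_nonneg (subset_univ _) fun _ _ _ => abs_nonneg _
    _ ≤ ∑ _u : Fin n, (K : ℝ) := sum_le_sum fun u _ => (hp.sum_abs_corr_le hη hf u).trans hK
    _ = n * K := by simp

/-- The learning stage: some weakly learned sign vector is good. -/
theorem IsSample.exists_good {L k : ℕ} (hX : IsSample p μ X (L * k)) {K : ℕ} (hK : 0 < K)
    (hn : 0 < n) {b : ℝ} (hb : 0 < b) (hT : 1 ≤ b * totalCorr p)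
    (hL : 60 * cbrtSq n ≤ L)
    (hk : Odd k) (hk1 : (K : ℝ) ^ 2 * (cbrtSq n ^ 2 * b) ^ 2 / 2 ≤ k)
    (hk2 : (k : ℝ) ≤ 2 * (K ^ 2 * (cbrtSq n ^ 2 * b) ^ 2))
    (hcorr : ∀ u v, u < v → |p.corr u v| ≤ 1 / (cbrtSq n ^ 2 * b)) :
    μ.real {ω | ∀ l < L, ¬ 1 / (12 * (cbrtSq n * b)) ≤
      p.expect (quad fun u v => spin (learnSign k (fun i => X (l * k + i) ω) u v))} ≤ 1 / 100 := by
  set s := cbrtSq n with hs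
  set w := s ^ 2 * b with hw
  have hs1 : 1 ≤ s := one_le_cbrtSq hn
  have hs0 : 0 < s := by linarith
  have hw0 : 0 < w := by positivity
  have hK' : (0 : ℝ) < K := by exact_mod_cast hK
  have hk' : (0 : ℝ) < k := by exact_mod_cast hk.pos
  have hT0 : 0 < totalCorr p := by
    by_contra! h
    have : b * totalCorr p ≤ 0 := mul_nonpos_of_nonneg_of_nonpos hb.le h
    linarith
  have hs3 : s * s ^ 2 = (n : ℝ) ^ 2 := by rw [hs, ← cbrtSq_pow_three]; ring
  -- Scale of the cubic minorant of the sign. As c² k = 1/(4K²), the first smallness condition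
  -- holds; k ≤ 2K²w² and |λ_uv| ≤ 1/w give the second; and ck/2 = √k/(4K) ≥ w/6 follows from k ≥
  -- K²w²/2.
  set c := 1 / (2 * K * √k) with hc
  have hc0 : 0 ≤ c := by positivity
  have hc2 : c ^ 2 * k = 1 / (4 * K ^ 2) := by
    rw [hc, div_pow, mul_pow, Real.sq_sqrt hk'.le]; field_simp; norm_num
  have hK1 : (1 : ℝ) ≤ K ^ 2 := one_le_pow₀ (by exact_mod_cast hK)
  have hgood : ∀ l < L, μ.real {ω | ¬ 1 / (12 * (s * b)) ≤
      p.expect (quad fun u v => spin (learnSign k (fun i => X (l * k + i) ω) u v))} ≤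
      1 - 1 / (12 * s) := by
    intro l hl
    have hle : l * k + k ≤ L * k := by rw [← Nat.succ_mul]; exact Nat.mul_le_mul_right k hl
    have h1 := (hX.shift hle).weakLearn_good hk hc0
      (by
        rw [mul_assoc, hc2, ← mul_div_assoc, div_le_one (by positivity)]; linarith)
      (by
        intro u v huv
        have h2 : p.corr u v ^ 2 ≤ (1 / w) ^ 2 := by
          rw [← sq_abs]; exact pow_le_pow_left₀ (abs_nonneg _) (hcorr u v huv) 2
        calc 2 * c ^ 2 * (k * p.corr u v) ^ 2 = 2 * (c ^ 2 * k) * (k * p.corr u v ^ 2) := by ring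
          _ ≤ 2 * (1 / (4 * K ^ 2)) * ((2 * (K ^ 2 * w ^ 2)) * (1 / w) ^ 2) := by
              rw [hc2]; gcongr
          _ = 1 := by field_simp; norm_num)
      hw0.le
      (by
        have h3 : c * k / 2 = √k / (4 * K) := by
          have : (k : ℝ) = √k * √k := (Real.mul_self_sqrt hk'.le).symm
          have hsq : 0 < √(k : ℝ) := Real.sqrt_pos.2 hk'
          rw [hc]; conv_lhs => rw [this, Real.sqrt_mul_self hsq.le]
          field_simp; norm_num
        rw [h3, div_le_div_iff₀ (by norm_num) (by positivity)]
        have h4 : w * (4 * K) / 6 ≤ √k := by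
          apply Real.le_sqrt_of_sq_le
          have : (w * (4 * K) / 6) ^ 2 = 4 / 9 * (K ^ 2 * w ^ 2) := by ring
          rw [this]
          have : 0 ≤ (K : ℝ) ^ 2 * w ^ 2 := by positivity
          linarith
        linarith)
    rw [mul_comm (totalCorr p), ← div_le_iff₀ hT0] at h1
    -- With n² = s³ and w = s² b the success probability is at least bT/(12s) and the mean reached
    -- is (bT)²/(12sb), and bT ≥ 1.
    have e1 : w * totalCorr p ^ 2 / (12 * n ^ 2) / totalCorr p = b * totalCorr p / (12 * s) := by
      rw [← hs3, hw]; field_simp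
    have e2 : 1 / (12 * s) ≤ b * totalCorr p / (12 * s) := by gcongr
    have e3 : 1 / (12 * (s * b)) ≤ w * totalCorr p ^ 2 / (12 * n ^ 2) := by
      have : w * totalCorr p ^ 2 / (12 * n ^ 2) = (b * totalCorr p) ^ 2 / (12 * (s * b)) := by
        rw [← hs3, hw]; field_simp
      rw [this]
      gcongr
      exact one_le_pow₀ hT
    rw [e1] at h1
    have h5 := e2.trans h1
    have h6 : μ.real {ω | w * totalCorr p ^ 2 / (12 * n ^ 2) ≤
        p.expect (quad (weakLearn k fun i => X (l * k + i) ω))} ≤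
        μ.real {ω | 1 / (12 * (s * b)) ≤
          p.expect (quad fun u v => spin (learnSign k (fun i => X (l * k + i) ω) u v))} := by
      refine measureReal_mono fun ω hω => ?_
      simp only [Set.mem_ofPred_eq, weakLearn_eq_spin] at hω ⊢
      exact e3.trans hω
    have h7 := measureReal_compl_eq (μ := μ) {ω | 1 / (12 * (s * b)) ≤
          p.expect (quad fun u v => spin (learnSign k (fun i => X (l * k + i) ω) u v))}
    have e8 : {ω | ¬ 1 / (12 * (s * b)) ≤
      p.expect (quad fun u v => spin (learnSign k (fun i => X (l * k + i) ω) u v))} =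
      {ω | 1 / (12 * (s * b)) ≤
          p.expect (quad fun u v => spin (learnSign k (fun i => X (l * k + i) ω) u v))}ᶜ := rfl
    rw [e8, h7]
    linarith
  have hdep : DependsOn (fun x : ℕ → Config n => ¬ 1 / (12 * (s * b)) ≤
      p.expect (quad fun u v => spin (learnSign k x u v))) (range k) := by
    intro x y h
    have := dependsOn_learnSign k h
    simp only at this ⊢
    rw [this]
  refine (measureReal_forall_blocks_le hX.indep hdep hgood).trans ?_
  have hpos : 0 ≤ 1 - 1 / (12 * s) := by
    have : 1 / (12 * s) ≤ 1 := by rw [div_le_one (by positivity)]; linarith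
    linarith
  calc (1 - 1 / (12 * s)) ^ L ≤ Real.exp (-(1 / (12 * s))) ^ L := by
        gcongr
        have := Real.add_one_le_exp (-(1 / (12 * s)))
        linarith
    _ = Real.exp (-(L / (12 * s))) := by rw [← Real.exp_nat_mul]; congr 1; ring
    -- The number of learners is at least 60s = 5 · 12s.
    _ ≤ Real.exp (-5) := by
        rw [Real.exp_le_exp, neg_le_neg_iff, le_div_iff₀ (by positivity)]
        linarith
    _ ≤ 1 / 100 := by
        have h1 : (2.7 : ℝ) ^ 5 ≤ Real.exp 1 ^ 5 := by
          gcongr; linarith [Real.exp_one_gt_d9]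
        have h2 : Real.exp 1 ^ 5 = Real.exp 5 := by rw [← Real.exp_nat_mul]; norm_num
        rw [Real.exp_neg, ← one_div]
        refine one_div_le_one_div_of_le (by norm_num) ?_
        rw [← h2]; exact le_trans (by norm_num) h1

/-- Either localization detects a pair with |λ_uv| ≥ 1/w, or all correlations are small enough for
weak learning. Then, outside an event of probability 1/100, there is a good sign vector, and only
the vote on the first good one has to succeed. -/
theorem IsSample.accept_of_totalCorr_ge {K : ℕ} (hK0 : 0 < K) {β ε : ℝ} (hβ : 0 ≤ β) (hε : 0 < ε)
    (hX : IsSample p μ X ((constants K hK0).samples n (4 / 3) β ε)) {η : ℝ}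
    (hp : p.HighTemperature η) (hη : 0 < η) (hf : p.NoExternalField) (hK : 1 / η ≤ K)
    (hT : ε ≤ β * totalCorr p) :
    μ.real {ω | ¬ SequenceRejects (constants K hK0) (4 / 3) β ε fun i => X i ω} ≤ 1 / 10 := by
  classical
  set a := constants K hK0 with ha
  set k₀ := a.locSamples n (4 / 3) β ε with hk₀
  set L := a.repetitions n (4 / 3) with hL
  set k₁ := a.learnSamples n (4 / 3) β ε with hk₁
  set R := a.rounds n with hR
  set k₂ := a.testSamples n (4 / 3) β ε with hk₂
  have hN : a.samples n (4 / 3) β ε = k₀ + L * k₁ + R * k₂ := rfl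
  have hK1 : (1 : ℝ) ≤ K := by exact_mod_cast hK0
  have hβ0 : 0 < β := by
    rcases hβ.eq_or_lt with h | h
    · rw [← h] at hT; linarith
    · exact h
  have hb : 0 < β / ε := div_pos hβ0 hε
  set b := β / ε with hbdef
  have hT1 : 1 ≤ b * totalCorr p := by
    rw [hbdef, div_mul_eq_mul_div, le_div_iff₀ hε]; linarith
  have hTle := hp.totalCorr_le hη hf hK
  have hn : 0 < n := by
    rcases Nat.eq_zero_or_pos n with rfl | h
    · have h0 : totalCorr p ≤ 0 := by simpa using hTle
      have : b * totalCorr p ≤ 0 := mul_nonpos_of_nonneg_of_nonpos hb.le h0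
      linarith
    · exact h
  have hs1 : 1 ≤ cbrtSq n := one_le_cbrtSq hn
  set s := cbrtSq n with hs
  have hs0 : 0 < s := by linarith
  set w := s ^ 2 * b with hw
  have hw0 : 0 < w := by positivity
  -- This keeps all sample sizes positive: T ≤ nK by the row bound, and n ≤ s².
  have hKw : 1 ≤ K * w := by
    calc 1 ≤ b * totalCorr p := hT1
      _ ≤ b * (n * K) := by gcongr
      _ ≤ b * (s ^ 2 * K) := by gcongr; exact le_cbrtSq_sq hn
      _ = K * w := by rw [hw]; ring
  have hKw2 : 1 ≤ (K : ℝ) ^ 2 * w ^ 2 := by rw [← mul_pow]; exact one_le_pow₀ hKw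
  set m := Nat.log 2 n + 1 with hm
  have hm1 : (1 : ℝ) ≤ m := by exact_mod_cast Nat.succ_pos _
  -- sizes of the samples
  have hK2m : (K : ℝ) ^ 2 * w ^ 2 ≤ K ^ 2 * w ^ 2 * m := le_mul_of_one_le_right (by positivity) hm1
  have hk₀ge : 256 * w ^ 2 * m ≤ k₀ := by
    have h1 : (1 : ℝ) ≤ 512 * (K ^ 2 * w ^ 2 * m) := by linarith
    have h2 := half_le_floor h1
    have h3 : k₀ = ⌊512 * ((K : ℝ) ^ 2 * w ^ 2 * m)⌋₊ := by
      rw [hk₀, a.locSamples_eq]; congr 1; simp only [ha, constants]; push_cast [← hm]; ring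
    rw [h3]
    refine le_trans ?_ h2
    have : w ^ 2 * m ≤ K ^ 2 * (w ^ 2 * m) :=
      le_mul_of_one_le_left (by positivity) (one_le_pow₀ hK1)
    linarith
  have hk₀pos : 0 < k₀ := by
    have : (0 : ℝ) < k₀ := lt_of_lt_of_le (by positivity) hk₀ge
    exact_mod_cast this
  have hk₁eq : k₁ = 2 * ⌊(K : ℝ) ^ 2 * w ^ 2⌋₊ - 1 := by
    rw [hk₁, a.learnSamples_eq]; simp only [ha, constants]; push_cast; rfl
  have hfl : 1 ≤ ⌊(K : ℝ) ^ 2 * w ^ 2⌋₊ := (Nat.one_le_floor_iff _).2 hKw2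
  have hk₁odd : Odd k₁ := ⟨⌊(K : ℝ) ^ 2 * w ^ 2⌋₊ - 1, by omega⟩
  have hk₁ge : (K : ℝ) ^ 2 * w ^ 2 / 2 ≤ k₁ := by
    refine (half_le_floor hKw2).trans ?_
    exact_mod_cast (by omega : ⌊(K : ℝ) ^ 2 * w ^ 2⌋₊ ≤ k₁)
  have hk₁le : (k₁ : ℝ) ≤ 2 * (K ^ 2 * w ^ 2) := by
    have h1 := Nat.floor_le (by positivity : 0 ≤ (K : ℝ) ^ 2 * w ^ 2)
    have h2 : (k₁ : ℝ) ≤ 2 * (⌊(K : ℝ) ^ 2 * w ^ 2⌋₊ : ℝ) := by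
      exact_mod_cast (by omega : k₁ ≤ 2 * ⌊(K : ℝ) ^ 2 * w ^ 2⌋₊)
    linarith
  have hnw : w ^ 2 ≤ n ^ 2 * (s * b) ^ 2 := by
    have : (n : ℝ) ^ 2 * (s * b) ^ 2 = s * w ^ 2 := by
      rw [hw, ← cbrtSq_pow_three, ← hs]; ring
    rw [this]; exact le_mul_of_one_le_left (by positivity) hs1
  have hk₂ge : 2304 * (K : ℝ) ^ 2 * (n ^ 2 * (s * b) ^ 2) ≤ k₂ := by
    have h0 : (K : ℝ) ^ 2 * w ^ 2 ≤ K ^ 2 * (n ^ 2 * (s * b) ^ 2) := by gcongr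
    have h1 : (1 : ℝ) ≤ 4608 * (K ^ 2 * (n ^ 2 * (s * b) ^ 2)) := by linarith
    have h2 := half_le_floor h1
    have h3 : k₂ = ⌊4608 * ((K : ℝ) ^ 2 * (n ^ 2 * (s * b) ^ 2))⌋₊ := by
      rw [hk₂, a.testSamples_eq]; congr 1; simp only [ha, constants]; push_cast; ring
    rw [h3]
    refine le_trans (le_of_eq ?_) h2
    ring
  have hk₂pos : 0 < k₂ := by
    have hn' : (0 : ℝ) < n := by exact_mod_cast hn
    have : (0 : ℝ) < k₂ := lt_of_lt_of_le (by positivity) hk₂ge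
    exact_mod_cast this
  have hLge : 60 * s ≤ L := by
    rw [hL, a.repetitions_eq]
    refine le_trans (le_of_eq ?_) (Nat.le_ceil _)
    simp only [ha, constants]; push_cast; rfl
  -- localization
  have hX0 : IsSample p μ X k₀ := by
    have := hX.shift (s := 0) (k := k₀) (by omega)
    simpa only [zero_add] using this
  have hloc := hX0.localization hf hk₀pos hw0 (Nat.succ_pos (Nat.log 2 n))
    (Nat.lt_pow_succ_log_self (by norm_num) n) hk₀ge
  -- A correlation of at least 1/w is off by at least 1/(2w) whenever its estimate stays below the
  -- threshold 1/(2w).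
  by_cases hcase : ∃ u v : Fin n, u < v ∧ 1 / w ≤ |p.corr u v|
  · obtain ⟨u, v, huv, hc⟩ := hcase
    refine (measureReal_mono ?_).trans (hloc.trans (by norm_num))
    intro ω hω
    have h1 : ¬ LocalizationRejects (4 / 3) β ε k₀ fun i => X i ω := fun h => hω (Or.inl h)
    rw [localizationRejects_iff hε] at h1
    push Not at h1
    have h2 := h1 u v huv
    refine ⟨u, v, huv, ?_⟩
    set lh := empEdge k₀ (fun i => X i ω) u v -
      empNode k₀ (fun i => X i ω) u * empNode k₀ (fun i => X i ω) v
    have h3 : |lh| ≤ 1 / (2 * w) := by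
      rw [le_div_iff₀ (by positivity), mul_comm]; exact h2.le
    have h4 : |p.corr u v| ≤ |lh| + |lh - p.corr u v| := by
      have := abs_sub_abs_le_abs_sub (p.corr u v) lh
      rw [abs_sub_comm (p.corr u v) lh] at this; linarith
    have h5 : 1 / w = 1 / (2 * w) + 1 / (2 * w) := by field_simp; norm_num
    linarith
  · push Not at hcase
    have hXl : IsSample p μ (fun i => X (k₀ + i)) (L * k₁) := hX.shift (by omega)
    have hXt : IsSample p μ (fun i => X (k₀ + L * k₁ + i)) (R * k₂) := hX.shift (by omega)
    have hgood := hXl.exists_good hK0 hn hb hT1 hLge hk₁odd hk₁ge hk₁le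
      fun u v huv => (hcase u v huv).le
    set Good : (Fin n → Fin n → Bool) → Prop := fun σ =>
      1 / (12 * (s * b)) ≤ p.expect (quad fun u v => spin (σ u v)) with hGood
    set sig : ℕ → (ℕ → Config n) → Fin n → Fin n → Bool := fun l x =>
      learnSign k₁ fun i => x (k₀ + (l * k₁ + i)) with hsig
    -- The first good learned vector, a function of the learning samples only. The default is
    -- harmless: the absence of a good vector is counted as a separate failure.
    set A : (ℕ → Config n) → Fin n → Fin n → Bool := fun x =>
      if h : ∃ l, l < L ∧ Good (sig l x) then sig (Nat.find h) x else fun _ _ => true with hA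
    have hsel := measureReal_select_le (μ := μ) hX.indep
      (S := Ico k₀ (k₀ + L * k₁))
      (T := Ico (k₀ + L * k₁) (k₀ + L * k₁ + R * k₂))
      (by
        rw [Finset.disjoint_left]
        intro i hi hi'
        rw [mem_Ico] at hi hi'; omega)
      (A := A)
      (by
        intro x y h
        have h1 : ∀ l < L, sig l x = sig l y := by
          intro l hl
          have hle : l * k₁ + k₁ ≤ L * k₁ := by
            rw [← Nat.succ_mul]; exact Nat.mul_le_mul_right k₁ hl
          refine dependsOn_learnSign k₁ fun i hi => h _ ?_
          simp only [coe_range, Set.mem_Iio] at hi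
          simp only [coe_Ico, Set.mem_Ico]; omega
        have h2 : (fun l => l < L ∧ Good (sig l x)) = fun l => l < L ∧ Good (sig l y) := by
          ext l
          exact and_congr_right fun hl => by rw [h1 l hl]
        have h3 : ∀ hx : ∃ l, l < L ∧ Good (sig l x), ∀ hy : ∃ l, l < L ∧ Good (sig l y),
            Nat.find hx = Nat.find hy := by
          intro hx hy
          refine Nat.find_congr' ?_
          intro l; exact iff_of_eq (congrFun h2 l)
        simp only [hA]
        by_cases hx : ∃ l, l < L ∧ Good (sig l x)
        · have hy : ∃ l, l < L ∧ Good (sig l y) := by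
            obtain ⟨l, hl⟩ := hx; exact ⟨l, hl.1, h1 l hl.1 ▸ hl.2⟩
          rw [dif_pos hx, dif_pos hy, h3 hx hy, h1 _ (Nat.find_spec hy).1]
        · have hy : ¬ ∃ l, l < L ∧ Good (sig l y) := by
            rintro ⟨l, hl⟩; exact hx ⟨l, hl.1, (h1 l hl.1).symm ▸ hl.2⟩
          rw [dif_neg hx, dif_neg hy])
      (V := fun σ x => ¬ VoteRejects 24 (4 / 3) β ε (fun u v => spin (σ u v)) R k₂
        fun i => x (k₀ + L * k₁ + i))
      (fun σ x y h => by
        have := dependsOn_shift (dependsOn_voteRejects 24 (4 / 3) β ε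
          (fun u v => spin (σ u v)) R k₂) (k₀ + L * k₁) h
        simp only at this ⊢
        rw [this])
      (Good := Good) (q := Real.exp (-(R / 8))) (Real.exp_pos _).le
      (fun σ hσ => hXt.vote_of_expect_ge hp hη hf hK hε _ (fun u v => (abs_spin _).le) hk₂pos
        (by positivity) hk₂ge hσ)
    have hsub : {ω | ¬ SequenceRejects a (4 / 3) β ε fun i => X i ω} ⊆
        {ω | ∀ l < L, ¬ 1 / (12 * (s * b)) ≤ p.expect (quad fun u v =>
          spin (learnSign k₁ (fun i => X (k₀ + (l * k₁ + i)) ω) u v))} ∪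
        {ω | Good (A fun i => X i ω) ∧ ¬ VoteRejects 24 (4 / 3) β ε
          (fun u v => spin (A (fun i => X i ω) u v)) R k₂ fun i => X (k₀ + L * k₁ + i) ω} := by
      intro ω hω
      by_cases h : ∃ l, l < L ∧ Good (sig l fun i => X i ω)
      · refine Or.inr ?_
        have hAeq : A (fun i => X i ω) = sig (Nat.find h) fun i => X i ω := by
          simp only [hA]; rw [dif_pos h]
        have hsp := Nat.find_spec h
        refine ⟨by rw [hAeq]; exact hsp.2, fun hv => hω (Or.inr ⟨Nat.find h, hsp.1, ?_⟩)⟩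
        rw [hAeq] at hv
        change VoteRejects 24 (4 / 3) β ε
          (weakLearn k₁ fun i => X (k₀ + Nat.find h * k₁ + i) ω) R k₂
          fun i => X (k₀ + L * k₁ + i) ω
        rw [weakLearn_eq_spin]
        simp only [add_assoc] at hv ⊢
        exact hv
      · refine Or.inl ?_
        push Not at h
        exact fun l hl => h l hl
    have hL1 : (1 : ℝ) ≤ L := by linarith
    -- A single vote matters here, so the union bound over the learners is more than enough.
    have hRle : Real.exp (-(R / 8)) ≤ 2 / 25 := by
      refine le_trans ?_ (mul_exp_rounds_le (n := n) hK0)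
      exact le_mul_of_one_le_left (Real.exp_pos _).le hL1
    calc _ ≤ μ.real _ := measureReal_mono hsub (measure_ne_top _ _)
      _ ≤ 1 / 100 + 2 / 25 :=
          (measureReal_union_le _ _).trans (add_le_add hgood (hsel.trans hRle))
      _ ≤ _ := by norm_num

end Correctness

/-! ### The algorithm on its finite sample -/

/-- The terms of a finite sample, padded by a constant configuration. -/
def padded {n N : ℕ} (i : ℕ) (ω : Fin N → Config n) : Config n :=
  if h : i < N then ω ⟨i, h⟩ else fun _ => true

/-- A padding term depends on the empty set of coordinates, so the whole infinite sequence is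
independent, although only its first `N` terms have law p. -/
theorem isSample_padded {n : ℕ} (p : IsingModel n) (N : ℕ) :
    IsSample p (Measure.pi fun _ : Fin N => p.law) padded N := by
  have hind : iIndepFun (fun (i : Fin N) (ω : Fin N → Config n) => ω i)
      (Measure.pi fun _ : Fin N => p.law) :=
    iIndepFun_pi (X := fun _ c => c) fun _ => aemeasurable_id
  refine ⟨?_, fun i hi => ?_⟩
  · have h := iIndepFun_of_dependsOn hind (fun _ => measurable_pi_apply _)
      (fun j : ℕ => if h : j < N then {⟨j, h⟩} else ∅)
      (by
        intro i j hij
        by_cases hi : i < N <;> by_cases hj : j < N <;> simp [hi, hj, hij])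
      (fun j (ω : Fin N → Config n) => padded j ω)
      (by
        intro j x y h
        unfold padded
        by_cases hj : j < N
        · simp only [dif_pos hj]
          exact h _ (by simp [hj])
        · simp only [dif_neg hj])
    exact h
  · have : padded (n := n) (N := N) i = Function.eval ⟨i, hi⟩ := by
      ext ω; simp [padded, hi]
    rw [this]
    exact (measurePreserving_eval (fun _ : Fin N => p.law) ⟨i, hi⟩).map_eq

theorem IsingModel.NoExternalField.le_mul_totalCorr {n : ℕ} {p : IsingModel n}
    (hf : p.NoExternalField) {β ε : ℝ} (he : p.EdgeBound β) (hε : 0 < ε)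
    (h : ENNReal.ofReal ε ≤ dSKLProduct p.law) : ε ≤ β * totalCorr p := by
  have h1 := h.trans hf.dSKLProduct_le
  have h2 : ∑ u, ∑ v ∈ Ioi u, p.edge u v * p.corr u v ≤ β * totalCorr p := by
    rw [totalCorr, mul_sum]
    refine sum_le_sum fun u _ => ?_
    rw [mul_sum]
    refine sum_le_sum fun v hv => (le_abs_self _).trans ?_
    rw [abs_mul]
    exact mul_le_mul_of_nonneg_right (he u v (mem_Ioi.1 hv).ne) (abs_nonneg _)
  by_contra! hcon
  exact absurd h1 (not_le.2 ((ENNReal.ofReal_lt_ofReal_iff hε).2 (h2.trans_lt hcon)))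

theorem ofReal_le_of_compl_le {Ω : Type*} [MeasurableSpace Ω] [DiscreteMeasurableSpace Ω]
    [Finite Ω] {μ : Measure Ω} [IsProbabilityMeasure μ] {A : Set Ω} (h : μ.real Aᶜ ≤ 1 / 10) :
    9 / 10 ≤ μ A := by
  rw [measureReal_compl_eq] at h
  have h2 : (9 / 10 : ℝ) ≤ μ.real A := by linarith
  have h3 : ENNReal.ofReal (9 / 10) ≤ μ A := by
    rw [← ENNReal.ofReal_toReal (measure_ne_top μ A)]
    exact ENNReal.ofReal_le_ofReal h2
  rwa [ENNReal.ofReal_div_of_pos (by norm_num), ENNReal.ofReal_ofNat, ENNReal.ofReal_ofNat] at h3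

theorem learnThenTest_correct {η : ℝ} (hη : 0 < η) {K : ℕ} (hK0 : 0 < K) (hK : 1 / η ≤ K) {n : ℕ}
    {p : IsingModel n} {β ε : ℝ} (hf : p.NoExternalField) (hp : p.HighTemperature η) (hβ : 0 ≤ β)
    (he : p.EdgeBound β) (hε : 0 < ε) :
    (p.law ∈ productLaws n →
      9 / 10 ≤ sampleProb p ((constants K hK0).samples n (4 / 3) β ε)
        {x | ¬ LearnThenTestRejects (constants K hK0) (4 / 3) β ε x}) ∧
    (ENNReal.ofReal ε ≤ dSKLProduct p.law →
      9 / 10 ≤ sampleProb p ((constants K hK0).samples n (4 / 3) β ε)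
        {x | LearnThenTestRejects (constants K hK0) (4 / 3) β ε x}) := by
  have hX := isSample_padded p ((constants K hK0).samples n (4 / 3) β ε)
  constructor
  · intro h
    refine ofReal_le_of_compl_le ?_
    have := hX.reject_of_corr_eq_zero hK0 hβ hε hp hη hf hK fun u v huv => hf.corr_eq_zero h huv
    refine le_trans (le_of_eq ?_) this
    congr 1
    ext x
    simp only [Set.mem_compl_iff, Set.mem_ofPred_eq, not_not]
    rfl
  · intro h
    exact ofReal_le_of_compl_le (hX.accept_of_totalCorr_ge hK0 hβ hε hp hη hf hK
      (hf.le_mul_totalCorr he hε h))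

/-! ### Sample complexity -/

theorem log_two_add_one_le {n : ℕ} (hn : 0 < n) :
    ((Nat.log 2 n + 1 : ℕ) : ℝ) ≤ 2 * (1 + Real.log n) := by
  have h1 : ((2 ^ Nat.log 2 n : ℕ) : ℝ) ≤ n := by exact_mod_cast Nat.pow_log_le_self 2 hn.ne'
  have h2 : (Nat.log 2 n : ℝ) * Real.log 2 ≤ Real.log n := by
    rw [← Real.log_pow]
    refine Real.log_le_log (by positivity) ?_
    exact_mod_cast h1
  have h3 := Real.log_two_gt_d9
  have h4 : (0 : ℝ) ≤ Nat.log 2 n := Nat.cast_nonneg _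
  push_cast
  nlinarith

/-- In powers of s, localization takes s⁴ up to the logarithm, learning s · s⁴, and each testing
round n² s² = s⁵, all times (β/ε)²; and n^(10/3) = s⁵. -/
theorem samples_le (a : Constants) (n : ℕ) {β ε : ℝ} :
    (a.samples n (4 / 3) β ε : ℝ) ≤ (2 * (a.loc + (2 * a.rep + 2) * a.learn + a.vote * a.test)) *
      (1 + Real.log n) * ((n : ℝ) ^ (10 / 3 : ℝ) * β ^ 2 / ε ^ 2) := by
  have h103 : (n : ℝ) ^ (10 / 3 : ℝ) = cbrtSq n ^ 5 := by rw [cbrtSq_pow]; norm_num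
  have hs := cbrtSq_nonneg n
  rcases Nat.eq_zero_or_pos n with rfl | hn
  · have h0 : cbrtSq 0 = 0 := by rw [cbrtSq]; norm_num
    rw [Constants.samples, a.locSamples_eq, a.learnSamples_eq, a.testSamples_eq, h103, h0]
    simp
  have hs1 := one_le_cbrtSq hn
  set s := cbrtSq n with hsdef
  set y := s ^ 5 * (β / ε) ^ 2 with hy
  have hy0 : 0 ≤ y := by positivity
  have he : (n : ℝ) ^ (10 / 3 : ℝ) * β ^ 2 / ε ^ 2 = y := by rw [h103, hy]; ring
  have h45 : (s ^ 2 * (β / ε)) ^ 2 * s = y := by rw [hy]; ring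
  have h4 : (s ^ 2 * (β / ε)) ^ 2 ≤ y := by
    rw [← h45]; exact le_mul_of_one_le_right (by positivity) hs1
  have hlog := log_two_add_one_le hn
  set m : ℝ := ((Nat.log 2 n + 1 : ℕ) : ℝ) with hm
  have hm1 : 1 ≤ m := by rw [hm]; exact_mod_cast Nat.succ_pos _
  have k0 : (a.locSamples n (4 / 3) β ε : ℝ) ≤ a.loc * y * m := by
    rw [a.locSamples_eq]
    refine (Nat.floor_le (by positivity)).trans ?_
    gcongr
  have hL : (a.repetitions n (4 / 3) : ℝ) ≤ (a.rep + 1) * s := by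
    rw [a.repetitions_eq]
    refine (Nat.ceil_lt_add_one (by positivity)).le.trans ?_
    linarith
  have k1 : (a.learnSamples n (4 / 3) β ε : ℝ) ≤ 2 * (a.learn * (s ^ 2 * (β / ε)) ^ 2) := by
    rw [a.learnSamples_eq]
    have h1 := Nat.floor_le (by positivity : 0 ≤ (a.learn : ℝ) * (s ^ 2 * (β / ε)) ^ 2)
    have h2 : ((2 * ⌊(a.learn : ℝ) * (s ^ 2 * (β / ε)) ^ 2⌋₊ - 1 : ℕ) : ℝ) ≤
        2 * (⌊(a.learn : ℝ) * (s ^ 2 * (β / ε)) ^ 2⌋₊ : ℝ) := by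
      exact_mod_cast Nat.sub_le _ _
    linarith
  have hR : (a.rounds n : ℝ) = a.vote * m := by rw [Constants.rounds]; push_cast [hm]; ring
  have k2 : (a.testSamples n (4 / 3) β ε : ℝ) ≤ a.test * y := by
    rw [a.testSamples_eq]
    refine (Nat.floor_le (by positivity)).trans (le_of_eq ?_)
    rw [← cbrtSq_pow_three, hy]; ring
  have hLk : (a.repetitions n (4 / 3) : ℝ) * a.learnSamples n (4 / 3) β ε ≤
      (2 * a.rep + 2) * a.learn * y * m := by
    calc _ ≤ ((a.rep + 1) * s) * (2 * (a.learn * (s ^ 2 * (β / ε)) ^ 2)) := by gcongr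
      _ = (2 * a.rep + 2) * a.learn * y := by rw [← h45]; ring
      _ ≤ _ := le_mul_of_one_le_right (by positivity) hm1
  have hRk : (a.rounds n : ℝ) * a.testSamples n (4 / 3) β ε ≤ a.vote * a.test * y * m := by
    rw [hR]
    calc _ ≤ a.vote * m * (a.test * y) := by gcongr
      _ = _ := by ring
  rw [he, Constants.samples]
  push_cast
  calc _ ≤ (a.loc + (2 * a.rep + 2) * a.learn + a.vote * a.test) * y * m := by linarith
    _ ≤ (a.loc + (2 * a.rep + 2) * a.learn + a.vote * a.test) * y * (2 * (1 + Real.log n)) := by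
        gcongr
    _ = _ := by ring

/-- One exponent increases and the other decreases in τ; both equal 10/3 at τ = 4/3, so one of them
is always at least 10/3. -/
theorem rpow_ten_thirds_le (n : ℕ) (τ : ℝ) :
    (n : ℝ) ^ (10 / 3 : ℝ) ≤ (n : ℝ) ^ (2 + τ) + (n : ℝ) ^ (6 - 2 * τ) := by
  rcases Nat.eq_zero_or_pos n with rfl | hn
  · rw [Nat.cast_zero, Real.zero_rpow (by norm_num)]
    exact add_nonneg (Real.rpow_nonneg le_rfl _) (Real.rpow_nonneg le_rfl _)
  have h1 : (1 : ℝ) ≤ n := by exact_mod_cast hn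
  have hA : 0 ≤ (n : ℝ) ^ (2 + τ) := by positivity
  have hB : 0 ≤ (n : ℝ) ^ (6 - 2 * τ) := by positivity
  rcases le_total (4 / 3) τ with h | h
  · have : (n : ℝ) ^ (10 / 3 : ℝ) ≤ (n : ℝ) ^ (2 + τ) :=
      Real.rpow_le_rpow_of_exponent_le h1 (by linarith)
    linarith
  · have : (n : ℝ) ^ (10 / 3 : ℝ) ≤ (n : ℝ) ^ (6 - 2 * τ) :=
      Real.rpow_le_rpow_of_exponent_le h1 (by linarith)
    linarith

end IsingTest

end

noncomputable section

namespace IsingTest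

open Finset

/-! ### Arithmetic terms with bounded sums and their compilation -/

/-- Prepends a value to an environment. -/
def push (i : ℕ) (ρ : ℕ → ℕ) : ℕ → ℕ
  | 0 => i
  | j + 1 => ρ j

/-- Arithmetic terms over a memory; `sum` binds the variable `0`. -/
inductive Term
  | var (i : ℕ)
  | const (c : ℕ)
  | op (o : ArithOp) (a b : Term)
  | load (a : Term)
  | sum (t : Term)

namespace Term

/-- The value of a term; all sums range over the numbers below `M`. -/
def eval (mem : ℕ → ℕ) (M : ℕ) : Term → (ℕ → ℕ) → ℕ
  | var i, ρ => ρ i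
  | const c, _ => c
  | op o a b, ρ => o.eval (eval mem M a ρ) (eval mem M b ρ)
  | load a, ρ => mem (eval mem M a ρ)
  | sum t, ρ => ∑ i ∈ range M, eval mem M t (push i ρ)

/-- A program that computes a term into the register `d`, using registers from `d` on; the variables
are in the registers given by `r`, and the bound of all sums is in the register `0`. -/
def compile : Term → (ℕ → ℕ) → ℕ → Program
  -- The machine has no move instruction; a register is copied by adding zero.
  | var i, r, d => .seq (.const (d + 1) 0) (.arith .add d (r i) (d + 1))
  | const c, _, d => .const d c
  | op o a b, r, d => .seq (compile a r d) (.seq (compile b r (d + 1)) (.arith o d d (d + 1)))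
  | load a, r, d => .seq (compile a r d) (.load d d)
  | sum t, r, d =>
    -- Register d accumulates the sum, d + 1 is the summation index, d + 2 counts the remaining
    -- rounds, and d + 3 holds the constant 1; the body works from d + 4 on.
    .seq (.const d 0) <| .seq (.const (d + 1) 0) <| .seq (.const (d + 3) 1) <|
    .seq (.arith .add (d + 2) 0 d) <|
    .loop (d + 2) <|
      .seq (compile t (push (d + 1) r) (d + 4)) <|
      .seq (.arith .add d d (d + 4)) <|
      .seq (.arith .add (d + 1) (d + 1) (d + 3)) (.arith .sub (d + 2) (d + 2) (d + 3))

end Term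

theorem size_le_of_le {a k : ℕ} (h : a ≤ k) : a.size ≤ k :=
  Nat.size_le.2 (h.trans_lt Nat.lt_two_pow_self)

theorem ArithOp.size_eval_le (o : ArithOp) (a b : ℕ) : (o.eval a b).size ≤ a.size + b.size + 1 := by
  have ha := Nat.lt_size_self a
  have hb := Nat.lt_size_self b
  rw [Nat.size_le]
  have h1 : 2 ^ a.size ≤ 2 ^ (a.size + b.size) := Nat.pow_le_pow_right two_pos (by omega)
  have h2 : 2 ^ b.size ≤ 2 ^ (a.size + b.size) := Nat.pow_le_pow_right two_pos (by omega)
  rw [pow_succ]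
  cases o <;> simp only [ArithOp.eval]
  · omega
  · omega
  · have : a * b < 2 ^ a.size * 2 ^ b.size := Nat.mul_lt_mul'' ha hb
    rw [← pow_add] at this; omega
  · have := Nat.div_le_self a b; omega

/-- The number of summands, not merely its bit length, is bounded by `B`; since k < 2^B, summation
adds at most `B` bits. -/
theorem size_sum_range_le {M B Q : ℕ} (hM : M ≤ B) {f : ℕ → ℕ} {k : ℕ} (hk : k ≤ M)
    (hf : ∀ i < M, (f i).size ≤ Q) : (∑ i ∈ range k, f i).size ≤ B + Q := by
  rw [Nat.size_le]
  calc ∑ i ∈ range k, f i ≤ ∑ _i ∈ range k, 2 ^ Q := sum_le_sum fun i hi =>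
        (Nat.size_le.1 (hf i ((mem_range.1 hi).trans_le hk))).le
    _ = k * 2 ^ Q := by simp
    _ < 2 ^ B * 2 ^ Q := by
        refine Nat.mul_lt_mul_of_pos_right ?_ (by positivity)
        exact (hk.trans hM).trans_lt Nat.lt_two_pow_self
    _ = _ := (pow_add _ _ _).symm

theorem size_push_le {i B : ℕ} {ρ : ℕ → ℕ} (hi : i ≤ B) (hρ : ∀ j, (ρ j).size ≤ B) (j : ℕ) :
    (push i ρ j).size ≤ B := by
  cases j
  · exact size_le_of_le hi
  · exact hρ _

namespace Term

open Polynomial in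
/-- The values of a term have polynomially many bits. -/
theorem exists_size_le (t : Term) : ∃ q : Polynomial ℕ, ∀ (mem ρ : ℕ → ℕ) (M B : ℕ),
    (∀ a, (mem a).size ≤ B) → M ≤ B → (∀ i, (ρ i).size ≤ B) →
    (t.eval mem M ρ).size ≤ q.eval B := by
  induction t with
  | var i => exact ⟨X, fun mem ρ M B _ _ hρ => by simpa [Term.eval] using hρ i⟩
  | const c => exact ⟨C c.size, fun mem ρ M B _ _ _ => by simp [Term.eval]⟩
  | op o a b iha ihb =>
    obtain ⟨qa, ha⟩ := iha
    obtain ⟨qb, hb⟩ := ihb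
    refine ⟨qa + qb + 1, fun mem ρ M B h1 h2 h3 => ?_⟩
    have := o.size_eval_le (a.eval mem M ρ) (b.eval mem M ρ)
    have := ha mem ρ M B h1 h2 h3
    have := hb mem ρ M B h1 h2 h3
    simp only [Term.eval, eval_add, eval_one]
    omega
  | load a iha => exact ⟨X, fun mem ρ M B h1 _ _ => by simpa [Term.eval] using h1 _⟩
  | sum t ih =>
    obtain ⟨q, hq⟩ := ih
    refine ⟨X + q, fun mem ρ M B h1 h2 h3 => ?_⟩
    simp only [Term.eval, eval_add, eval_X]
    exact size_sum_range_le h2 le_rfl fun i hi =>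
      hq mem (push i ρ) M B h1 h2 (size_push_le (hi.le.trans h2) h3)

/-- The program `P` computes the value `y` into the register `d`, without changing the memory and
the registers below `d`. -/
def Yields (P : Program) (d : ℕ) (s : RamState) (y T : ℕ) : Prop :=
  ∃ t s', Exec P s t s' ∧ t ≤ T ∧ s'.mem = s.mem ∧ s'.reg d = y ∧ ∀ i < d, s'.reg i = s.reg i

/-- Induction on the number j of rounds left, with the partial sum over the first M - j indices as
loop invariant. A round costs at most `T` for the body and 2S + 4B + 6 for the guard and the three
updates. -/
theorem yields_loop {P : Program} {r : ℕ → ℕ} {mem ρ : ℕ → ℕ} {t : Term} {d M T S B : ℕ}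
    (hd : 0 < d) (hr : ∀ i, r i < d) (hM : M ≤ B)
    (hbody : ∀ s : RamState, s.mem = mem → s.reg 0 = M → (∀ i, s.reg (r i) = ρ i) →
      ∀ i < M, s.reg (d + 1) = i → Yields P (d + 4) s (t.eval mem M (push i ρ)) T)
    (hsize : ∀ i < M, (t.eval mem M (push i ρ)).size ≤ S) (j : ℕ) (hj : j ≤ M) (s : RamState)
    (hmem : s.mem = mem) (h0 : s.reg 0 = M) (hρ : ∀ i, s.reg (r i) = ρ i)
    (hacc : s.reg d = ∑ i ∈ range (M - j), t.eval mem M (push i ρ))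
    (hidx : s.reg (d + 1) = M - j) (hrem : s.reg (d + 2) = j) (hone : s.reg (d + 3) = 1) :
    Yields (.loop (d + 2) <| .seq P <| .seq (.arith .add d d (d + 4)) <|
      .seq (.arith .add (d + 1) (d + 1) (d + 3)) (.arith .sub (d + 2) (d + 2) (d + 3))) d s
      (∑ i ∈ range M, t.eval mem M (push i ρ)) (j * (T + 2 * S + 4 * B + 6) + 1) := by
  induction j generalizing s with
  | zero =>
    refine ⟨1, s, Exec.loop_stop hrem, by omega, rfl, by simpa using hacc, fun _ _ => rfl⟩
  | succ j ih =>
    obtain ⟨t1, s1, e1, b1, m1, v1, p1⟩ := hbody s hmem h0 hρ (M - (j + 1)) (by omega) hidx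
    have hv := hsize (M - (j + 1)) (by omega)
    set v := t.eval mem M (push (M - (j + 1)) ρ)
    have r0 := p1 d (by omega)
    have r1 := p1 (d + 1) (by omega)
    have r2 := p1 (d + 2) (by omega)
    have r3 := p1 (d + 3) (by omega)
    set s2 : RamState := ⟨Function.update s1.reg d (s1.reg d + s1.reg (d + 4)), s1.mem⟩ with hs2
    set s3 : RamState := ⟨Function.update s2.reg (d + 1) (s2.reg (d + 1) + s2.reg (d + 3)),
      s2.mem⟩ with hs3
    set s4 : RamState := ⟨Function.update s3.reg (d + 2) (s3.reg (d + 2) - s3.reg (d + 3)),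
      s3.mem⟩ with hs4
    have e2 := Exec.arith .add d d (d + 4) s1
    have e3 := Exec.arith .add (d + 1) (d + 1) (d + 3) s2
    have e4 := Exec.arith .sub (d + 2) (d + 2) (d + 3) s3
    simp only [ArithOp.eval, ← hs2] at e2
    simp only [ArithOp.eval, ← hs3] at e3
    simp only [ArithOp.eval, ← hs4] at e4
    have low : ∀ i < d, s4.reg i = s.reg i := by
      intro i hi
      simp only [hs4, hs3, hs2]
      rw [Function.update_of_ne (by omega), Function.update_of_ne (by omega),
        Function.update_of_ne (by omega)]
      exact p1 i (by omega)
    have q2 : s2.reg (d + 1) = M - (j + 1) ∧ s2.reg (d + 2) = j + 1 ∧ s2.reg (d + 3) = 1 ∧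
        s2.reg d = s.reg d + v := by
      simp [hs2, r0, r1, r2, r3, hidx, hrem, hone, v1]
    have q3 : s3.reg (d + 1) = M - j ∧ s3.reg (d + 2) = j + 1 ∧ s3.reg (d + 3) = 1 ∧
        s3.reg d = s.reg d + v := by
      simp [hs3, q2]; omega
    have q4 : s4.reg (d + 1) = M - j ∧ s4.reg (d + 2) = j ∧ s4.reg (d + 3) = 1 ∧
        s4.reg d = s.reg d + v := by
      simp [hs4, q3]
    obtain ⟨t5, s5, e5, b5, m5, v5, p5⟩ := ih (by omega) s4 (by rw [← hmem, ← m1])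
      ((low 0 hd).trans h0) (fun i => (low _ (hr i)).trans (hρ i))
      (by
        rw [q4.2.2.2, hacc, ← sum_range_succ]
        congr 2; omega) q4.1 q4.2.1 q4.2.2.1
    refine ⟨_, s5, .loop_step (by omega) (.seq e1 (.seq e2 (.seq e3 e4))) e5, ?_,
      m5.trans m1, v5, fun i hi => (p5 i hi).trans (low i hi)⟩
    have z1 : (s.reg (d + 2)).size ≤ B := size_le_of_le (by omega)
    have z2 : (s1.reg d).size ≤ B + S := by
      rw [r0, hacc]; exact size_sum_range_le hM (by omega) hsize
    have z3 : (s1.reg (d + 4)).size ≤ S := by rw [v1]; exact hv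
    have z4 : (s2.reg (d + 1)).size ≤ B := size_le_of_le (by omega)
    have z5 : (s2.reg (d + 3)).size = 1 := by rw [q2.2.2.1]; rfl
    have z6 : (s3.reg (d + 2)).size ≤ B := size_le_of_le (by omega)
    have z7 : (s3.reg (d + 3)).size = 1 := by rw [q3.2.2.1]; rfl
    have : (j + 1) * (T + 2 * S + 4 * B + 6) = j * (T + 2 * S + 4 * B + 6) +
      (T + 2 * S + 4 * B + 6) := by ring
    omega

open Polynomial in
/-- Compiled terms run in polynomial time. -/
theorem exists_yields (t : Term) : ∃ q : Polynomial ℕ, ∀ (mem ρ r : ℕ → ℕ) (M B d : ℕ)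
    (s : RamState), 0 < d → (∀ i, r i < d) → s.mem = mem → s.reg 0 = M →
    (∀ i, s.reg (r i) = ρ i) → (∀ a, (mem a).size ≤ B) → M ≤ B → (∀ i, (ρ i).size ≤ B) →
    Yields (t.compile r d) d s (t.eval mem M ρ) (q.eval B) := by
  induction t with
  | var i =>
    refine ⟨X + 2, fun mem ρ r M B d s hd hr hmem h0 hρ h1 h2 h3 => ?_⟩
    refine ⟨_, _, .seq (.const _ _ _) (.arith _ _ _ _ _), ?_, rfl, ?_, ?_⟩
    · have := hr i
      have h5 := h3 i
      rw [← hρ] at h5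
      simp [Function.update_of_ne (by omega : r i ≠ d + 1)]
      omega
    · simp [ArithOp.eval, Function.update_of_ne ((hr i).trans (Nat.lt_succ_self d)).ne, hρ,
        Term.eval]
    · intro j hj
      simp [Function.update_of_ne hj.ne, Function.update_of_ne (hj.trans (Nat.lt_succ_self d)).ne]
  | const c =>
    refine ⟨C (1 + c.size), fun mem ρ r M B d s hd hr hmem h0 hρ h1 h2 h3 => ?_⟩
    refine ⟨_, _, .const _ _ _, by simp, rfl, by simp [Term.eval], fun j hj => ?_⟩
    simp [Function.update_of_ne hj.ne]
  | op o a b iha ihb =>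
    obtain ⟨qa, ha⟩ := iha
    obtain ⟨qb, hb⟩ := ihb
    obtain ⟨za, hza⟩ := a.exists_size_le
    obtain ⟨zb, hzb⟩ := b.exists_size_le
    refine ⟨qa + qb + (za + zb + 1), fun mem ρ r M B d s hd hr hmem h0 hρ h1 h2 h3 => ?_⟩
    obtain ⟨t1, s1, e1, b1, m1, v1, p1⟩ := ha mem ρ r M B d s hd hr hmem h0 hρ h1 h2 h3
    obtain ⟨t2, s2, e2, b2, m2, v2, p2⟩ := hb mem ρ r M B (d + 1) s1 (by omega)
      (fun i => (hr i).trans (Nat.lt_succ_self d)) (m1.trans hmem) ((p1 0 hd).trans h0)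
      (fun i => (p1 _ (hr i)).trans (hρ i)) h1 h2 h3
    have v1' : s2.reg d = a.eval mem M ρ := (p2 d (by omega)).trans v1
    refine ⟨_, _, .seq e1 (.seq e2 (.arith _ _ _ _ _)), ?_, m2.trans m1, ?_, ?_⟩
    · rw [v1', v2]
      have := hza mem ρ M B h1 h2 h3
      have := hzb mem ρ M B h1 h2 h3
      simp only [eval_add, eval_one]
      omega
    · simp [v1', v2, Term.eval]
    · intro j hj
      simp only [Function.update_of_ne hj.ne]
      rw [p2 j (by omega), p1 j hj]
  | load a iha =>
    obtain ⟨qa, ha⟩ := iha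
    obtain ⟨za, hza⟩ := a.exists_size_le
    refine ⟨qa + (za + X + 1), fun mem ρ r M B d s hd hr hmem h0 hρ h1 h2 h3 => ?_⟩
    obtain ⟨t1, s1, e1, b1, m1, v1, p1⟩ := ha mem ρ r M B d s hd hr hmem h0 hρ h1 h2 h3
    refine ⟨_, _, .seq e1 (.load _ _ _), ?_, m1, ?_, ?_⟩
    · rw [v1, m1, hmem]
      have := hza mem ρ M B h1 h2 h3
      have := h1 (a.eval mem M ρ)
      simp only [eval_add, eval_one, eval_X]
      omega
    · simp [v1, m1, hmem, Term.eval]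
    · intro j hj
      simp only [Function.update_of_ne hj.ne]
      exact p1 j hj
  | sum t ih =>
    obtain ⟨q, hq⟩ := ih
    obtain ⟨z, hz⟩ := t.exists_size_le
    refine ⟨X * (q + 2 * z + 4 * X + 6) + X + 6,
      fun mem ρ r M B d s hd hr hmem h0 hρ h1 h2 h3 => ?_⟩
    set s1 : RamState := ⟨Function.update s.reg d 0, s.mem⟩ with hs1
    set s2 : RamState := ⟨Function.update s1.reg (d + 1) 0, s1.mem⟩ with hs2
    set s3 : RamState := ⟨Function.update s2.reg (d + 3) 1, s2.mem⟩ with hs3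
    set s4 : RamState := ⟨Function.update s3.reg (d + 2) (s3.reg 0 + s3.reg d), s3.mem⟩ with hs4
    have e1 := Exec.const d 0 s
    have e2 := Exec.const (d + 1) 0 s1
    have e3 := Exec.const (d + 3) 1 s2
    have e4 := Exec.arith .add (d + 2) 0 d s3
    have low : ∀ i < d, s3.reg i = s.reg i := by
      intro i hi
      simp only [hs3, hs2, hs1]
      rw [Function.update_of_ne (by omega), Function.update_of_ne (by omega),
        Function.update_of_ne (by omega)]
    have low4 : ∀ i < d, s4.reg i = s.reg i := by
      intro i hi
      rw [← low i hi]
      simp only [hs4]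
      rw [Function.update_of_ne (by omega)]
    have a0 : s3.reg 0 = M := (low 0 hd).trans h0
    have ad : s3.reg d = 0 := by simp [hs3, hs2, hs1]
    have hl := yields_loop (P := compile t (push (d + 1) r) (d + 4)) (mem := mem) (ρ := ρ) (t := t)
      (T := q.eval B) (S := z.eval B) hd hr h2
      (fun s' hm' h0' hρ' i hi hidx => by
        refine hq mem (push i ρ) (push (d + 1) r) M B (d + 4) s' (by omega) ?_ hm' h0' ?_ h1 h2
          (size_push_le (hi.le.trans h2) h3)
        · intro k; cases k
          · simp [push]
          · exact (hr _).trans (by omega)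
        · intro k; cases k
          · exact hidx
          · exact hρ' _)
      (fun i hi => hz mem (push i ρ) M B h1 h2 (size_push_le (hi.le.trans h2) h3))
      M le_rfl s4 hmem ((low4 0 hd).trans h0) (fun i => (low4 _ (hr i)).trans (hρ i))
      (by simp [hs4, ad]) (by simp [hs4, hs3, hs2]) (by simp [hs4, a0, ad])
      (by simp [hs4, hs3])
    obtain ⟨t5, s5, e5, b5, m5, v5, p5⟩ := hl
    refine ⟨_, s5, .seq e1 (.seq e2 (.seq e3 (.seq e4 e5))), ?_, m5, v5,
      fun i hi => (p5 i hi).trans (low4 i hi)⟩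
    have z1 : (s3.reg 0).size ≤ B := size_le_of_le (by omega)
    have z2 : (s3.reg d).size = 0 := by rw [ad]; rfl
    have z3 : Nat.size 0 = 0 := rfl
    have z4 : Nat.size 1 = 1 := rfl
    have z5 : M * (q.eval B + 2 * z.eval B + 4 * B + 6) ≤
        B * (q.eval B + 2 * z.eval B + 4 * B + 6) := Nat.mul_le_mul_right _ h2
    simp only [eval_add, eval_mul, eval_X, eval_ofNat]
    omega

open Polynomial in
/-- The program that computes first the bound of all sums and then the output. -/
theorem exists_program (tM tOut : Term) : ∃ (P : Program) (q : Polynomial ℕ),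
    ∀ (input : List ℕ) (M B : ℕ), M = tM.eval (fun i => input.getD i 0) 0 (fun _ => 0) → M ≤ B →
    (∀ i, (input.getD i 0).size ≤ B) →
    ∃ t s, Exec P (initState input) t s ∧ t ≤ q.eval B ∧
      s.reg 0 = tOut.eval (fun i => input.getD i 0) M (fun _ => M) := by
  obtain ⟨q1, h1⟩ := tM.exists_yields
  obtain ⟨q2, h2⟩ := tOut.exists_yields
  obtain ⟨z1, hz1⟩ := tM.exists_size_le
  obtain ⟨z2, hz2⟩ := tOut.exists_size_le
  -- Initially register 0 is 0, so sums in `tM` would be empty. Its value M is then copied to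
  -- register 0, where `tOut` finds the bound of its sums; finally the output is copied there.
  refine ⟨.seq (tM.compile (fun _ => 0) 1) <| .seq (.const 2 0) <| .seq (.arith .add 0 1 2) <|
    .seq (tOut.compile (fun _ => 0) 1) <| .seq (.const 2 0) (.arith .add 0 1 2),
    q1 + q2 + z1 + z2 + 4, fun input M B hM hMB hB => ?_⟩
  set mem : ℕ → ℕ := fun i => input.getD i 0
  obtain ⟨t1, s1, e1, b1, m1, v1, p1⟩ := h1 mem (fun _ => 0) (fun _ => 0) 0 B 1 (initState input)
    one_pos (fun _ => one_pos) rfl rfl (fun _ => rfl) hB (Nat.zero_le _) (fun _ => Nat.zero_le _)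
  have zz1 := hz1 mem (fun _ => 0) 0 B hB (Nat.zero_le _) (fun _ => Nat.zero_le _)
  rw [← hM] at v1 zz1
  set s2 : RamState := ⟨Function.update s1.reg 2 0, s1.mem⟩ with hs2
  set s3 : RamState := ⟨Function.update s2.reg 0 (s2.reg 1 + s2.reg 2), s2.mem⟩ with hs3
  have a3 : s3.reg 0 = M := by simp [hs3, hs2, v1]
  obtain ⟨t4, s4, e4, b4, m4, v4, p4⟩ := h2 mem (fun _ => M) (fun _ => 0) M B 1 s3
    one_pos (fun _ => one_pos) m1 a3 (fun _ => a3) hB hMB (fun _ => size_le_of_le hMB)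
  have zz2 := hz2 mem (fun _ => M) M B hB hMB (fun _ => size_le_of_le hMB)
  refine ⟨_, _, .seq e1 (.seq (.const 2 0 s1) (.seq (.arith .add 0 1 2 s2)
    (.seq e4 (.seq (.const 2 0 s4) (.arith .add 0 1 2 _))))), ?_, ?_⟩
  · have c1 : s2.reg 1 = M := by simp [hs2, v1]
    have c2 : s2.reg 2 = 0 := by simp [hs2]
    rw [c1, c2]
    have y0 : Nat.size 0 = 0 := rfl
    simp only [Function.update_self, ne_eq, OfNat.one_ne_ofNat, not_false_eq_true,
      Function.update_of_ne, v4, eval_add, eval_ofNat, y0]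
    omega
  · simp [ArithOp.eval, v4]

end Term

end IsingTest

end

noncomputable section

namespace IsingTest

open Finset

/-! ### Functions and predicates given by terms -/

/-- Functions of the memory, the bound of all sums and the environment that are given by terms. -/
def Definable (f : (ℕ → ℕ) → ℕ → (ℕ → ℕ) → ℕ) : Prop :=
  ∃ t : Term, ∀ mem M ρ, t.eval mem M ρ = f mem M ρ

open Classical in
/-- Predicates whose indicator function is given by a term. -/
def DefinablePred (P : (ℕ → ℕ) → ℕ → (ℕ → ℕ) → Prop) : Prop :=
  Definable fun mem M ρ => if P mem M ρ then 1 else 0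

namespace Definable

variable {f g : (ℕ → ℕ) → ℕ → (ℕ → ℕ) → ℕ}

theorem var (i : ℕ) : Definable fun _ _ ρ => ρ i := ⟨.var i, fun _ _ _ => rfl⟩

theorem const (c : ℕ) : Definable fun _ _ _ => c := ⟨.const c, fun _ _ _ => rfl⟩

theorem op (o : ArithOp) (hf : Definable f) (hg : Definable g) :
    Definable fun mem M ρ => o.eval (f mem M ρ) (g mem M ρ) := by
  obtain ⟨t, ht⟩ := hf
  obtain ⟨u, hu⟩ := hg
  exact ⟨.op o t u, fun mem M ρ => by rw [Term.eval, ht, hu]⟩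

theorem add (hf : Definable f) (hg : Definable g) :
    Definable fun mem M ρ => f mem M ρ + g mem M ρ := op .add hf hg

theorem sub (hf : Definable f) (hg : Definable g) :
    Definable fun mem M ρ => f mem M ρ - g mem M ρ := op .sub hf hg

theorem mul (hf : Definable f) (hg : Definable g) :
    Definable fun mem M ρ => f mem M ρ * g mem M ρ := op .mul hf hg

theorem div (hf : Definable f) (hg : Definable g) :
    Definable fun mem M ρ => f mem M ρ / g mem M ρ := op .div hf hg

theorem pow (hf : Definable f) (k : ℕ) : Definable fun mem M ρ => f mem M ρ ^ k := by
  induction k with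
  | zero => simpa using const 1
  | succ k ih => simpa only [pow_succ] using ih.mul hf

theorem load (hf : Definable f) : Definable fun mem M ρ => mem (f mem M ρ) := by
  obtain ⟨t, ht⟩ := hf
  exact ⟨.load t, fun mem M ρ => by rw [Term.eval, ht]⟩

/-- The summation index is variable 0, hence the free variables of the summand are shifted by one.
-/
theorem sum {f : (ℕ → ℕ) → ℕ → (ℕ → ℕ) → ℕ → ℕ}
    (hf : Definable fun mem M ρ => f mem M (fun j => ρ (j + 1)) (ρ 0)) :
    Definable fun mem M ρ => ∑ i ∈ range M, f mem M ρ i := by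
  obtain ⟨t, ht⟩ := hf
  refine ⟨.sum t, fun mem M ρ => ?_⟩
  simp only [Term.eval, ht]
  rfl

theorem card {P : (ℕ → ℕ) → ℕ → (ℕ → ℕ) → ℕ → Prop} [∀ mem M ρ, DecidablePred (P mem M ρ)]
    (hP : DefinablePred fun mem M ρ => P mem M (fun j => ρ (j + 1)) (ρ 0)) :
    Definable fun mem M ρ => #{i ∈ range M | P mem M ρ i} := by
  obtain ⟨t, ht⟩ := hP
  refine ⟨.sum t, fun mem M ρ => ?_⟩
  beta_reduce
  rw [card_filter]
  simp only [Term.eval, ht]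
  refine sum_congr rfl fun i _ => ?_
  congr

end Definable

namespace DefinablePred

variable {f g : (ℕ → ℕ) → ℕ → (ℕ → ℕ) → ℕ} {P Q : (ℕ → ℕ) → ℕ → (ℕ → ℕ) → Prop}

theorem of_eq_ite (hf : Definable f) (h : ∀ mem M ρ, (P mem M ρ → f mem M ρ = 1) ∧
    (¬ P mem M ρ → f mem M ρ = 0)) : DefinablePred P := by
  obtain ⟨t, ht⟩ := hf
  refine ⟨t, fun mem M ρ => ?_⟩
  rw [ht]
  beta_reduce
  split_ifs with hP
  exacts [(h mem M ρ).1 hP, (h mem M ρ).2 hP]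

/-- With truncated subtraction, 1 - (f - g) is the indicator of f ≤ g. -/
theorem le (hf : Definable f) (hg : Definable g) :
    DefinablePred fun mem M ρ => f mem M ρ ≤ g mem M ρ :=
  of_eq_ite ((Definable.const 1).sub (hf.sub hg)) fun mem M ρ => by omega

theorem lt (hf : Definable f) (hg : Definable g) :
    DefinablePred fun mem M ρ => f mem M ρ < g mem M ρ := le (hf.add (.const 1)) hg

theorem not (hP : DefinablePred P) : DefinablePred fun mem M ρ => ¬ P mem M ρ :=
  of_eq_ite ((Definable.const 1).sub hP) fun mem M ρ => by
    by_cases h : P mem M ρ <;> simp [h]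

theorem and (hP : DefinablePred P) (hQ : DefinablePred Q) :
    DefinablePred fun mem M ρ => P mem M ρ ∧ Q mem M ρ :=
  of_eq_ite (hP.mul hQ) fun mem M ρ => by
    by_cases h : P mem M ρ <;> by_cases h' : Q mem M ρ <;> simp [h, h']

theorem or (hP : DefinablePred P) (hQ : DefinablePred Q) :
    DefinablePred fun mem M ρ => P mem M ρ ∨ Q mem M ρ := by
  simpa only [← not_or, not_not, ← or_iff_not_and_not] using (hP.not.and hQ.not).not

theorem iff (hP : DefinablePred P) (hQ : DefinablePred Q) :
    DefinablePred fun mem M ρ => (P mem M ρ ↔ Q mem M ρ) := by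
  simpa only [iff_iff_and_or_not_and_not] using (hP.and hQ).or (hP.not.and hQ.not)

theorem eq (hf : Definable f) (hg : Definable g) :
    DefinablePred fun mem M ρ => f mem M ρ = g mem M ρ := by
  simpa only [← le_antisymm_iff] using (le hf hg).and (le hg hf)

theorem exists_lt {P : (ℕ → ℕ) → ℕ → (ℕ → ℕ) → ℕ → Prop}
    (hP : DefinablePred fun mem M ρ => P mem M (fun j => ρ (j + 1)) (ρ 0)) :
    DefinablePred fun mem M ρ => ∃ i < M, P mem M ρ i := by
  classical
  have := lt (.const 0) (Definable.card hP)
  simpa only [card_pos, filter_nonempty_iff, mem_range] using this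

end DefinablePred

end IsingTest

end

noncomputable section

namespace IsingTest

open Finset

/-! ### The sample sizes in integer arithmetic -/

/-- Terms cannot search for a number, but they can count: k is the number of i < M that satisfy i <
k. -/
theorem card_filter_range_eq {M k : ℕ} (h : k ≤ M) {p : ℕ → Prop} [DecidablePred p]
    (hp : ∀ i, p i ↔ i < k) : #{i ∈ range M | p i} = k := by
  have : {i ∈ range M | p i} = range k := by
    ext i; simp only [mem_filter, mem_range, hp]; omega
  rw [this, card_range]

/-- The integral part of the cube root of `A / B`, if it is at most `M`. -/
def floorCbrt (M A B : ℕ) : ℕ := #{i ∈ range M | (i + 1) ^ 3 * B ≤ A}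

theorem floorCbrt_eq {y : ℝ} (hy : 0 ≤ y) {M A B : ℕ} (hB : 0 < B) (h : y ^ 3 * B = A)
    (hM : ⌊y⌋₊ ≤ M) : floorCbrt M A B = ⌊y⌋₊ := by
  refine card_filter_range_eq hM fun i => ?_
  have hB' : (0 : ℝ) < B := by exact_mod_cast hB
  rw [← Nat.succ_le_iff, Nat.le_floor_iff hy, ← Nat.cast_le (α := ℝ), ← h]
  push_cast
  rw [mul_le_mul_iff_left₀ hB', pow_le_pow_iff_left₀ (by positivity) hy (by norm_num)]

/-- `⌊log₂ n⌋ + 1`, as one plus the number of the powers of two in `[2, n]`; powers of two are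
recognized by the absence of odd divisors. -/
def ramLog (n M : ℕ) : ℕ :=
  open Classical in
  1 + #{j ∈ range M | (2 ≤ j ∧ j ≤ n) ∧ ¬ ∃ k < M, 1 ≤ k ∧ (2 * k + 1) * (j / (2 * k + 1)) = j}

/-- A number j ≥ 2 is a power of two iff no odd number 2k + 1 ≥ 3 divides it. This avoids powers
with variable exponent, which terms do not have. -/
theorem ramLog_eq {n M : ℕ} (h : n < M) : ramLog n M = Nat.log 2 n + 1 := by
  classical
  have key : ({j ∈ range M | (2 ≤ j ∧ j ≤ n) ∧
      ¬ ∃ k < M, 1 ≤ k ∧ (2 * k + 1) * (j / (2 * k + 1)) = j} : Finset ℕ) =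
      (range (Nat.log 2 n)).image fun i => 2 ^ (i + 1) := by
    ext j
    simp only [mem_filter, mem_range, mem_image]
    constructor
    · rintro ⟨hjM, ⟨h2, hjn⟩, hno⟩
      rcases Nat.eq_two_pow_or_exists_odd_prime_and_dvd j with ⟨k, hk⟩ | ⟨p, hp, hpj, hodd⟩
      · cases k with
        | zero => simp at hk; omega
        | succ k =>
          refine ⟨k, ?_, hk.symm⟩
          rw [← Nat.succ_le_iff]
          exact Nat.le_log_of_pow_le (by norm_num) (hk ▸ hjn)
      · obtain ⟨q, rfl⟩ := hodd
        have := Nat.le_of_dvd (by omega) hpj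
        have := hp.two_le
        exact absurd ⟨q, by omega, by omega, Nat.mul_div_cancel' hpj⟩ hno
    · rintro ⟨i, hi, rfl⟩
      have hle : 2 ^ (i + 1) ≤ n := by
        have hn : n ≠ 0 := by rintro rfl; simp at hi
        exact Nat.pow_le_of_le_log hn hi
      refine ⟨by omega, ⟨?_, hle⟩, ?_⟩
      · rw [pow_succ]; have := Nat.one_le_two_pow (n := i); omega
      · rintro ⟨k, -, hk1, hk⟩
        have hd : 2 * k + 1 ∣ 2 ^ (i + 1) := ⟨_, hk.symm⟩
        have hc : Nat.Coprime (2 * k + 1) (2 ^ (i + 1)) :=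
          Nat.Coprime.pow_right _ (by simp)
        have := Nat.Coprime.eq_one_of_dvd hc hd
        omega
  have hinj : Function.Injective fun i : ℕ => 2 ^ (i + 1) := fun i j hij => by
    have := Nat.pow_right_injective le_rfl hij
    omega
  unfold ramLog
  rw [key, card_image_of_injective _ hinj, card_range, add_comm]

namespace Constants

variable (a : Constants) (n P Q M : ℕ)

/-- The sample sizes are floors of reals whose cubes are rational: cubing turns s⁴ into n⁸, n² s²
into n¹⁰ and (β/ε)² into P⁶/Q⁶, where β/ε = P/Q. -/
def ramLoc : ℕ := floorCbrt M ((a.loc * ramLog n M) ^ 3 * n ^ 8 * P ^ 6) (Q ^ 6)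

def ramRep : ℕ := #{i ∈ range M | i ^ 3 < a.rep ^ 3 * n ^ 2}

def ramLearn : ℕ := 2 * floorCbrt M (a.learn ^ 3 * n ^ 8 * P ^ 6) (Q ^ 6) - 1

def ramRounds : ℕ := a.vote * ramLog n M

def ramTest : ℕ := floorCbrt M (a.test ^ 3 * n ^ 10 * P ^ 6) (Q ^ 6)

/-- A number that exceeds all sample sizes. -/
def ramBound : ℕ :=
  (a.rep + a.vote + 1) * (n + 1) + (a.loc + 2 * a.learn + a.test) * n ^ 4 * P ^ 2 / Q ^ 2

theorem lt_ramBound : n < a.ramBound n P Q := by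
  unfold ramBound
  refine lt_of_lt_of_le ?_ (Nat.le_add_right _ _)
  exact Nat.lt_of_succ_le (Nat.le_mul_of_pos_left _ (by omega))

variable {β ε : ℝ} {n P Q M}

theorem floor_le_ramBound (hε : 0 < ε) (hQ : 0 < Q) (h : β / ε * Q = P) {y : ℝ}
    (hy : y ≤ (a.loc + 2 * a.learn + a.test) * (n ^ 4 * (β / ε) ^ 2)) :
    ⌊y⌋₊ ≤ a.ramBound n P Q := by
  have hQ' : (0 : ℝ) < Q := by exact_mod_cast hQ
  refine le_trans ?_ (Nat.le_add_left _ _)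
  have e : (a.loc + 2 * a.learn + a.test) * (n ^ 4 * (β / ε) ^ 2) =
      (((a.loc + 2 * a.learn + a.test) * n ^ 4 * P ^ 2 : ℕ) : ℝ) / ((Q ^ 2 : ℕ) : ℝ) := by
    push_cast
    rw [← h]
    field_simp
  rw [e] at hy
  calc ⌊y⌋₊ ≤ _ := Nat.floor_le_floor hy
    _ = _ := Nat.floor_div_eq_div _ _

theorem cbrtSq_zero : cbrtSq 0 = 0 := by rw [cbrtSq]; norm_num

theorem cbrtSq_le_self (n : ℕ) : cbrtSq n ≤ n := by
  rcases Nat.eq_zero_or_pos n with rfl | hn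
  · simp [cbrtSq_zero]
  · exact cbrtSq_le hn

theorem cbrtSq_pow_four_le (n : ℕ) : (cbrtSq n ^ 2) ^ 2 ≤ (n : ℝ) ^ 3 := by
  calc (cbrtSq n ^ 2) ^ 2 = cbrtSq n ^ 3 * cbrtSq n := by ring
    _ ≤ (n : ℝ) ^ 2 * n := by
        rw [cbrtSq_pow_three]
        exact mul_le_mul_of_nonneg_left (cbrtSq_le_self n) (by positivity)
    _ = _ := by ring

theorem pow_three_mul_log_le (n : ℕ) :
    (n : ℝ) ^ 3 * ((Nat.log 2 n + 1 : ℕ) : ℝ) ≤ (n : ℝ) ^ 4 := by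
  rcases Nat.eq_zero_or_pos n with rfl | hn
  · simp
  have : Nat.log 2 n + 1 ≤ n := Nat.log_lt_self 2 hn.ne'
  calc (n : ℝ) ^ 3 * ((Nat.log 2 n + 1 : ℕ) : ℝ) ≤ n ^ 3 * n := by gcongr
    _ = _ := by ring

theorem pow_three_le_pow_four (n : ℕ) : (n : ℝ) ^ 3 ≤ (n : ℝ) ^ 4 := by
  refine le_trans (le_mul_of_one_le_right (by positivity) ?_) (pow_three_mul_log_le n)
  exact_mod_cast Nat.succ_pos _

theorem ramLog_ramBound : ramLog n (a.ramBound n P Q) = Nat.log 2 n + 1 :=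
  ramLog_eq (a.lt_ramBound n P Q)

theorem ramLoc_eq (hε : 0 < ε) (hQ : 0 < Q) (h : β / ε * Q = P) :
    a.ramLoc n P Q (a.ramBound n P Q) = a.locSamples n (4 / 3) β ε ∧
    a.locSamples n (4 / 3) β ε ≤ a.ramBound n P Q := by
  have hle : a.locSamples n (4 / 3) β ε ≤ a.ramBound n P Q := by
    rw [locSamples_eq]
    refine a.floor_le_ramBound hε hQ h ?_
    calc a.loc * (cbrtSq n ^ 2 * (β / ε)) ^ 2 * ((Nat.log 2 n + 1 : ℕ) : ℝ) =
        a.loc * (((cbrtSq n ^ 2) ^ 2 * ((Nat.log 2 n + 1 : ℕ) : ℝ)) * (β / ε) ^ 2) := by ring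
      _ ≤ a.loc * ((n : ℝ) ^ 4 * (β / ε) ^ 2) := by
        gcongr
        exact (mul_le_mul_of_nonneg_right (cbrtSq_pow_four_le n) (by positivity)).trans
          (pow_three_mul_log_le n)
      _ ≤ _ := by
        gcongr
        have : (0 : ℝ) ≤ 2 * a.learn + a.test := by positivity
        linarith
  refine ⟨?_, hle⟩
  rw [locSamples_eq] at hle ⊢
  unfold ramLoc
  rw [ramLog_ramBound]
  refine floorCbrt_eq (by positivity) (by positivity) ?_ hle
  push_cast
  rw [← h]
  calc _ = a.loc ^ 3 * (cbrtSq n ^ 3) ^ 4 * (β / ε) ^ 6 * (Nat.log 2 n + 1) ^ 3 * (Q : ℝ) ^ 6 := by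
        ring
    _ = _ := by rw [cbrtSq_pow_three]; ring

theorem ramLearn_eq (hε : 0 < ε) (hQ : 0 < Q) (h : β / ε * Q = P) :
    a.ramLearn n P Q (a.ramBound n P Q) = a.learnSamples n (4 / 3) β ε ∧
    a.learnSamples n (4 / 3) β ε ≤ a.ramBound n P Q := by
  have hy : 2 * (a.learn * (cbrtSq n ^ 2 * (β / ε)) ^ 2) ≤
      (a.loc + 2 * a.learn + a.test) * (n ^ 4 * (β / ε) ^ 2) := by
    calc 2 * (a.learn * (cbrtSq n ^ 2 * (β / ε)) ^ 2) =
        (2 * a.learn) * ((cbrtSq n ^ 2) ^ 2 * (β / ε) ^ 2) := by ring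
      _ ≤ (2 * a.learn) * ((n : ℝ) ^ 4 * (β / ε) ^ 2) := by
        gcongr
        exact (cbrtSq_pow_four_le n).trans (pow_three_le_pow_four n)
      _ ≤ _ := by
        gcongr
        have : (0 : ℝ) ≤ a.loc ∧ (0 : ℝ) ≤ a.test := ⟨by positivity, by positivity⟩
        linarith
  have h0 : 0 ≤ a.learn * (cbrtSq n ^ 2 * (β / ε)) ^ 2 := by positivity
  have hfl := a.floor_le_ramBound hε hQ h hy
  have h2 : 2 * ⌊a.learn * (cbrtSq n ^ 2 * (β / ε)) ^ 2⌋₊ ≤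
      ⌊2 * (a.learn * (cbrtSq n ^ 2 * (β / ε)) ^ 2)⌋₊ := by
    refine Nat.le_floor ?_
    push_cast
    exact mul_le_mul_of_nonneg_left (Nat.floor_le h0) (by norm_num)
  rw [learnSamples_eq]
  refine ⟨?_, by omega⟩
  unfold ramLearn
  rw [floorCbrt_eq h0 (by positivity) ?_ (by omega)]
  push_cast
  rw [← h]
  calc _ = a.learn ^ 3 * (cbrtSq n ^ 3) ^ 4 * (β / ε) ^ 6 * (Q : ℝ) ^ 6 := by ring
    _ = _ := by rw [cbrtSq_pow_three]; ring

theorem ramTest_eq (hβ : 0 ≤ β) (hε : 0 < ε) (hQ : 0 < Q) (h : β / ε * Q = P) :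
    a.ramTest n P Q (a.ramBound n P Q) = a.testSamples n (4 / 3) β ε ∧
    a.testSamples n (4 / 3) β ε ≤ a.ramBound n P Q := by
  have hle : a.testSamples n (4 / 3) β ε ≤ a.ramBound n P Q := by
    rw [testSamples_eq]
    refine a.floor_le_ramBound hε hQ h ?_
    have hs := cbrtSq_le_self n
    have := cbrtSq_nonneg n
    calc a.test * (n ^ 2 * (cbrtSq n * (β / ε)) ^ 2) ≤ a.test * (n ^ 2 * (n * (β / ε)) ^ 2) := by
          gcongr
      _ = a.test * (n ^ 4 * (β / ε) ^ 2) := by ring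
      _ ≤ _ := by
        gcongr
        have : (0 : ℝ) ≤ a.loc + 2 * a.learn := by positivity
        linarith
  refine ⟨?_, hle⟩
  rw [testSamples_eq] at hle ⊢
  unfold ramTest
  refine floorCbrt_eq (by positivity) (by positivity) ?_ hle
  push_cast
  rw [← h]
  calc _ = a.test ^ 3 * n ^ 6 * (cbrtSq n ^ 3) ^ 2 * (β / ε) ^ 6 * (Q : ℝ) ^ 6 := by ring
    _ = _ := by rw [cbrtSq_pow_three]; ring

theorem ramRep_eq : a.ramRep n (a.ramBound n P Q) = a.repetitions n (4 / 3) ∧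
    a.repetitions n (4 / 3) ≤ a.ramBound n P Q := by
  rw [repetitions_eq]
  have hle : ⌈a.rep * cbrtSq n⌉₊ ≤ a.ramBound n P Q := by
    refine Nat.ceil_le.2 ?_
    have h1 : (a.rep : ℝ) * cbrtSq n ≤ ((a.rep * n : ℕ) : ℝ) := by
      push_cast; gcongr; exact cbrtSq_le_self n
    refine h1.trans ?_
    have h2 : a.rep * n ≤ (a.rep + a.vote + 1) * (n + 1) :=
      Nat.mul_le_mul (by omega) (by omega)
    exact_mod_cast h2.trans (Nat.le_add_right _ _)
  refine ⟨card_filter_range_eq hle fun i => ?_, hle⟩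
  rw [Nat.lt_ceil, ← Nat.cast_lt (α := ℝ)]
  push_cast
  rw [← cbrtSq_pow_three, ← mul_pow,
    pow_lt_pow_iff_left₀ (by positivity) (mul_nonneg (by positivity) (cbrtSq_nonneg n))
      (by norm_num)]

theorem ramRounds_eq : a.ramRounds n (a.ramBound n P Q) = a.rounds n ∧
    a.rounds n ≤ a.ramBound n P Q := by
  unfold ramRounds rounds
  rw [ramLog_ramBound]
  refine ⟨rfl, le_trans ?_ (Nat.le_add_right _ _)⟩
  exact Nat.mul_le_mul (by omega) (by have := Nat.log_le_self 2 n; omega)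

/-- The bound is linear in the number of vertices and the total number of spins. -/
theorem ramBound_le (hQ : 0 < Q) (h : β / ε * Q = P) :
    a.ramBound n P Q ≤ (a.rep + a.vote + 1 + (a.loc + 2 * a.learn + a.test)) *
      (a.samples n (4 / 3) β ε * n + n + 1) := by
  set c := a.loc + 2 * a.learn + a.test with hc
  set N := a.samples n (4 / 3) β ε with hN
  have key : c * n ^ 4 * P ^ 2 / Q ^ 2 ≤ c * (N * n + n) := by
    rcases Nat.eq_zero_or_pos n with rfl | hn
    · simp
    have hQ' : (0 : ℝ) < Q := by exact_mod_cast hQ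
    have htest : a.testSamples n (4 / 3) β ε ≤ N := by
      rw [hN, samples]
      have : 1 * a.testSamples n (4 / 3) β ε ≤ a.rounds n * a.testSamples n (4 / 3) β ε :=
        Nat.mul_le_mul_right _ (Nat.mul_pos a.vote_pos (Nat.succ_pos _))
      omega
    -- The bound contains n⁴ (β/ε)², which can be exponential in the bit length of β and ε. But one
    -- test block has about n² s² (β/ε)² ≥ n³ (β/ε)² samples, and the samples are part of the input.
    have h1 : (n : ℝ) ^ 3 * (β / ε) ^ 2 ≤ N + 1 := by
      have h2 : a.test * (n ^ 2 * (cbrtSq n * (β / ε)) ^ 2) < a.testSamples n (4 / 3) β ε + 1 := by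
        rw [testSamples_eq]; exact Nat.lt_floor_add_one _
      have h3 : (a.testSamples n (4 / 3) β ε : ℝ) ≤ N := by exact_mod_cast htest
      have h4 : (n : ℝ) ^ 3 * (β / ε) ^ 2 ≤ n ^ 2 * (cbrtSq n * (β / ε)) ^ 2 := by
        calc (n : ℝ) ^ 3 * (β / ε) ^ 2 = n ^ 2 * (n * (β / ε) ^ 2) := by ring
          _ ≤ n ^ 2 * (cbrtSq n ^ 2 * (β / ε) ^ 2) := by
            gcongr; exact le_cbrtSq_sq hn
          _ = _ := by ring
      have h5 : n ^ 2 * (cbrtSq n * (β / ε)) ^ 2 ≤ a.test * (n ^ 2 * (cbrtSq n * (β / ε)) ^ 2) :=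
        le_mul_of_one_le_left (by positivity) (by exact_mod_cast a.test_pos)
      linarith
    rw [← Nat.cast_le (α := ℝ)]
    refine Nat.cast_div_le.trans ?_
    rw [div_le_iff₀ (by positivity)]
    push_cast
    rw [← h]
    calc (c : ℝ) * n ^ 4 * (β / ε * Q) ^ 2 = c * n * ((n : ℝ) ^ 3 * (β / ε) ^ 2) * (Q : ℝ) ^ 2 := by ring
      _ ≤ c * n * ((N : ℝ) + 1) * (Q : ℝ) ^ 2 := by gcongr
      _ = _ := by ring
  unfold ramBound
  rw [← hc, add_mul (a.rep + a.vote + 1) c]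
  refine add_le_add (Nat.mul_le_mul_left _ (by omega)) (key.trans (Nat.mul_le_mul_left _ (by omega)))

end Constants

end IsingTest

end

noncomputable section

namespace IsingTest

open Finset

/-! ### The answer of the algorithm in integer arithmetic -/

section Counting

variable {n M : ℕ}

/-- Cell of the memory that holds the spin `u` of the sample `j`. -/
def cell (mem : ℕ → ℕ) (j u : ℕ) : ℕ := mem (5 + (j * mem 0 + u))

def ramAgree (mem : ℕ → ℕ) (M o k u v : ℕ) : ℕ :=
  #{i ∈ range M | i < k ∧ cell mem (o + i) u = cell mem (o + i) v}

def ramPlus (mem : ℕ → ℕ) (M k u : ℕ) : ℕ := #{i ∈ range M | i < k ∧ cell mem i u = 1}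

/-- The memory holds the spins of the first `N` samples. -/
def Holds (mem : ℕ → ℕ) (N : ℕ) (x : ℕ → Config n) : Prop :=
  ∀ j < N, ∀ u : Fin n, cell mem j u = (x j u).toNat

theorem card_filter_range_and {k : ℕ} (h : k ≤ M) (p : ℕ → Prop) [DecidablePred p] :
    #{i ∈ range M | i < k ∧ p i} = #{i ∈ range k | p i} := by
  congr 1
  ext i; simp only [mem_filter, mem_range]
  exact ⟨fun h => h.2, fun h' => ⟨h'.1.trans_le h, h'⟩⟩

theorem Holds.agree {mem : ℕ → ℕ} {N : ℕ} {x : ℕ → Config n} (hx : Holds mem N x) {o k : ℕ}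
    (hk : k ≤ M) (ho : o + k ≤ N) (u v : Fin n) :
    ramAgree mem M o k u v = #{i ∈ range k | x (o + i) u = x (o + i) v} := by
  unfold ramAgree
  rw [card_filter_range_and hk]
  congr 1
  refine filter_congr fun i hi => ?_
  have := mem_range.1 hi
  rw [hx _ (by omega), hx _ (by omega)]
  cases x (o + i) u <;> cases x (o + i) v <;> simp

theorem Holds.plus {mem : ℕ → ℕ} {N : ℕ} {x : ℕ → Config n} (hx : Holds mem N x) {k : ℕ}
    (hk : k ≤ M) (ho : k ≤ N) (u : Fin n) :
    ramPlus mem M k u = #{i ∈ range k | x i u = true} := by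
  unfold ramPlus
  rw [card_filter_range_and hk]
  congr 1
  refine filter_congr fun i hi => ?_
  have := mem_range.1 hi
  rw [hx _ (by omega)]
  cases x i u <;> simp

theorem sum_sign_eq (k : ℕ) (p : ℕ → Prop) [DecidablePred p] :
    (∑ i ∈ range k, if p i then (1 : ℝ) else -1) = 2 * #{i ∈ range k | p i} - k := by
  have : ∀ i, (if p i then (1 : ℝ) else -1) = 2 * (if p i then 1 else 0) - 1 := by
    intro i; split_ifs <;> norm_num
  simp only [this, sum_sub_distrib, ← mul_sum, sum_boole, sum_const, card_range, nsmul_eq_mul,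
    mul_one]

theorem spin_mul_spin (b c : Bool) : spin b * spin c = if b = c then 1 else -1 := by
  cases b <;> cases c <;> simp [spin]

theorem empEdge_eq (k : ℕ) (x : ℕ → Config n) (u v : Fin n) :
    empEdge k x u v = (2 * #{i ∈ range k | x i u = x i v} - k) / k := by
  simp only [empEdge, spin_mul_spin, sum_sign_eq]

theorem empNode_eq (k : ℕ) (x : ℕ → Config n) (u : Fin n) :
    empNode k x u = (2 * #{i ∈ range k | x i u = true} - k) / k := by
  simp only [empNode, spin, sum_sign_eq]

theorem weakLearn_eq_ite (k : ℕ) (x : ℕ → Config n) (u v : Fin n) :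
    weakLearn k x u v = if k ≤ 2 * #{i ∈ range k | x i u = x i v} then 1 else -1 := by
  unfold weakLearn
  rw [empEdge_eq]
  refine if_congr ?_ rfl rfl
  rcases Nat.eq_zero_or_pos k with rfl | hk
  · simp
  have : (0 : ℝ) < k := by exact_mod_cast hk
  rw [le_div_iff₀ this, zero_mul, sub_nonneg]
  exact_mod_cast Iff.rfl

theorem cast_tsub_add_tsub (a b : ℕ) : ((a - b + (b - a) : ℕ) : ℝ) = |(a : ℝ) - b| := by
  rcases le_total a b with h | h
  · rw [Nat.sub_eq_zero_of_le h, zero_add, Nat.cast_sub h, abs_sub_comm, abs_of_nonneg]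
    exact sub_nonneg.2 (by exact_mod_cast h)
  · rw [Nat.sub_eq_zero_of_le h, add_zero, Nat.cast_sub h, abs_of_nonneg]
    exact sub_nonneg.2 (by exact_mod_cast h)

/-- A sum of signs over all pairs as a difference of two counts. -/
theorem sum_pairs_eq (hM : n ≤ M) (G : ℕ → ℕ → Prop) [∀ u, DecidablePred (G u)] :
    ((∑ u ∈ range M, #{v ∈ range M | (u < v ∧ v < n) ∧ G u v} : ℕ) : ℝ) -
      ((∑ u ∈ range M, #{v ∈ range M | (u < v ∧ v < n) ∧ ¬ G u v} : ℕ) : ℝ) =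
    ∑ u : Fin n, ∑ v ∈ Ioi u, if G u v then (1 : ℝ) else -1 := by
  have h1 : ∀ u, ((#{v ∈ range M | (u < v ∧ v < n) ∧ G u v} : ℕ) : ℝ) -
      ((#{v ∈ range M | (u < v ∧ v < n) ∧ ¬ G u v} : ℕ) : ℝ) =
      ∑ v ∈ range n, if u < v then (if G u v then (1 : ℝ) else -1) else 0 := by
    intro u
    rw [card_filter, card_filter]
    push_cast
    rw [← sum_sub_distrib, ← sum_subset (range_subset_range.2 hM)]
    · refine sum_congr rfl fun v hv => ?_
      have := mem_range.1 hv
      by_cases h : u < v <;> by_cases h' : G u v <;> simp [h, h', this]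
    · intro v _ hv
      have := mem_range.not.1 hv
      simp [this]
  push_cast
  rw [← sum_sub_distrib]
  simp only [h1]
  rw [← sum_subset (range_subset_range.2 hM), Finset.sum_range]
  · refine sum_congr rfl fun u _ => ?_
    rw [Finset.sum_range, ← sum_filter]
    refine sum_congr ?_ fun _ _ => rfl
    ext v; simp
  · intro u _ hu
    refine sum_eq_zero fun v hv => if_neg ?_
    have := mem_range.not.1 hu
    have := mem_range.1 hv
    omega

end Counting

/-! ### The two tests without denominators and cube roots -/

section Rejection

variable {n : ℕ} {P Q : ℕ} {β ε : ℝ}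

/-- `k²` times the absolute value of the empirical covariance of two spins, for `k` samples with `g`
agreements and `c`, `d` positive spins. -/
def ramCov (k g c d : ℕ) : ℕ :=
  2 * g * k + 2 * k * (c + d) - (2 * k ^ 2 + 4 * c * d) +
    (2 * k ^ 2 + 4 * c * d - (2 * g * k + 2 * k * (c + d)))

/-- Multiply by Q k² and cube both sides; (s²)³ = n⁴. The case k = 0 is excluded on the right
because the real quotient is then 0, whereas the integer inequality would hold. -/
theorem le_cov_iff (hQ : 0 < Q) (h : β / ε * Q = P) {k g c d : ℕ} :
    (1 ≤ 2 * (cbrtSq n ^ 2 * (β / ε)) *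
      |((2 * g - k) / k : ℝ) - (2 * c - k) / k * ((2 * d - k) / k)|) ↔
    0 < k ∧ (Q * k ^ 2) ^ 3 ≤ 8 * P ^ 3 * n ^ 4 * ramCov k g c d ^ 3 := by
  rcases Nat.eq_zero_or_pos k with rfl | hk
  · norm_num
  have hk' : (0 : ℝ) < k := by exact_mod_cast hk
  have hQ' : (0 : ℝ) < Q := by exact_mod_cast hQ
  have e1 : ((2 * g - k) / k : ℝ) - (2 * c - k) / k * ((2 * d - k) / k) =
      (((2 * g * k + 2 * k * (c + d) : ℕ) : ℝ) - ((2 * k ^ 2 + 4 * c * d : ℕ) : ℝ)) / k ^ 2 := by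
    push_cast; field_simp; ring
  rw [e1, abs_div, ← cast_tsub_add_tsub, ← ramCov, abs_of_pos (pow_pos hk' 2)]
  have hb : β / ε = P / Q := by rw [eq_div_iff hQ'.ne', h]
  have e2 : 2 * (cbrtSq n ^ 2 * (β / ε)) * ((ramCov k g c d : ℝ) / k ^ 2) =
      (2 * cbrtSq n ^ 2 * P * ramCov k g c d) / (Q * k ^ 2) := by
    rw [hb]; field_simp
  rw [e2, le_div_iff₀ (by positivity), one_mul,
    ← pow_le_pow_iff_left₀ (by positivity) (by positivity) (n := 3) (by norm_num)]
  have e3 : (2 * cbrtSq n ^ 2 * P * ramCov k g c d : ℝ) ^ 3 =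
      8 * P ^ 3 * n ^ 4 * ramCov k g c d ^ 3 := by
    calc _ = 8 * P ^ 3 * (cbrtSq n ^ 3) ^ 2 * (ramCov k g c d : ℝ) ^ 3 := by ring
      _ = _ := by rw [cbrtSq_pow_three]; ring
  rw [e3, and_iff_right hk]
  exact_mod_cast Iff.rfl

/-- Multiply by Q k and cube; s³ = n². If S ≤ S', the truncated difference is 0 and both sides are
false, and the hypothesis on k = 0 makes the right side false there too. -/
theorem lt_stat_iff (hQ : 0 < Q) (h : β / ε * Q = P) {D k S S' : ℕ} (hk : k = 0 → S = 0) :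
    1 < D * (cbrtSq n * (β / ε)) * (((S : ℝ) - S') / k) ↔
      (Q * k) ^ 3 < D ^ 3 * P ^ 3 * n ^ 2 * (S - S') ^ 3 := by
  have hQ' : (0 : ℝ) < Q := by exact_mod_cast hQ
  have hb : β / ε = P / Q := by rw [eq_div_iff hQ'.ne', h]
  have hs := cbrtSq_nonneg n
  rcases Nat.eq_zero_or_pos k with rfl | hk0
  · rw [hk rfl]; norm_num
  have hk' : (0 : ℝ) < k := by exact_mod_cast hk0
  have e2 : D * (cbrtSq n * (β / ε)) * (((S : ℝ) - S') / k) =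
      (D * cbrtSq n * P * ((S : ℝ) - S')) / (Q * k) := by
    rw [hb]; field_simp
  rw [e2, lt_div_iff₀ (by positivity), one_mul]
  rcases le_total S S' with hle | hle
  · rw [Nat.sub_eq_zero_of_le hle]
    have h1 : (S : ℝ) - S' ≤ 0 := sub_nonpos.2 (by exact_mod_cast hle)
    have h2 : D * cbrtSq n * P * ((S : ℝ) - S') ≤ 0 :=
      mul_nonpos_of_nonneg_of_nonpos (by positivity) h1
    have h3 : (0 : ℝ) < Q * k := by positivity
    refine iff_of_false (by linarith) (by simp)
  rw [← Nat.cast_sub hle,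
    ← pow_lt_pow_iff_left₀ (by positivity) (by positivity) (n := 3) (by norm_num)]
  have e3 : (D * cbrtSq n * P * ((S - S' : ℕ) : ℝ)) ^ 3 =
      D ^ 3 * P ^ 3 * n ^ 2 * ((S - S' : ℕ) : ℝ) ^ 3 := by
    calc _ = D ^ 3 * P ^ 3 * (cbrtSq n ^ 3) * ((S - S' : ℕ) : ℝ) ^ 3 := by ring
      _ = _ := by rw [cbrtSq_pow_three]
  rw [e3]
  exact_mod_cast Iff.rfl

end Rejection

end IsingTest

end

noncomputable section

namespace IsingTest

open Finset

/-! ### The algorithm as a program -/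

namespace Constants

variable (a : Constants) (mem : ℕ → ℕ) (M : ℕ)

/-- Numerator of `β / ε`. -/
def ratioNum (mem : ℕ → ℕ) : ℕ := mem 1 * mem 4

/-- Denominator of `β / ε`. -/
def ratioDen (mem : ℕ → ℕ) : ℕ := mem 2 * mem 3

def memLoc : ℕ := a.ramLoc (mem 0) (ratioNum mem) (ratioDen mem) M

def memLearn : ℕ := a.ramLearn (mem 0) (ratioNum mem) (ratioDen mem) M

def memTest : ℕ := a.ramTest (mem 0) (ratioNum mem) (ratioDen mem) M

def memRep : ℕ := a.ramRep (mem 0) M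

def memRounds : ℕ := a.ramRounds (mem 0) M

/-- Localization in integer arithmetic. -/
def RamLocalizes (k : ℕ) : Prop :=
  ∃ u < M, ∃ v < M, (u < v ∧ v < mem 0) ∧ 0 < k ∧ (ratioDen mem * k ^ 2) ^ 3 ≤
    8 * ratioNum mem ^ 3 * mem 0 ^ 4 *
      ramCov k (ramAgree mem M 0 k u v) (ramPlus mem M k u) (ramPlus mem M k v) ^ 3

/-- Number of samples and pairs of vertices that agree with the signs learned from the block of `k'`
samples at `o'`; the samples are the `k` samples at `o`. -/
def ramMatch (o k o' k' : ℕ) : ℕ :=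
  ∑ i ∈ range M, ∑ u ∈ range M, #{v ∈ range M | (u < v ∧ v < mem 0) ∧ (i < k ∧
    (cell mem (o + i) u = cell mem (o + i) v ↔ k' ≤ 2 * ramAgree mem M o' k' u v))}

/-- Number of samples and pairs of vertices that disagree with the learned signs. -/
def ramMismatch (o k o' k' : ℕ) : ℕ :=
  ∑ i ∈ range M, ∑ u ∈ range M, #{v ∈ range M | (u < v ∧ v < mem 0) ∧ (i < k ∧
    ¬ (cell mem (o + i) u = cell mem (o + i) v ↔ k' ≤ 2 * ramAgree mem M o' k' u v))}

/-- Majority vote in integer arithmetic, on blocks of `k` samples from `o` on. -/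
def RamVotes (o k R o' k' : ℕ) : Prop :=
  R < 2 * #{r ∈ range M | r < R ∧ (ratioDen mem * k) ^ 3 <
    a.thr ^ 3 * ratioNum mem ^ 3 * mem 0 ^ 2 *
      (ramMatch mem M (o + r * k) k o' k' - ramMismatch mem M (o + r * k) k o' k') ^ 3}

/-- The answer of the algorithm in integer arithmetic. -/
def RamRejects : Prop :=
  RamLocalizes mem M (a.memLoc mem M) ∨ ∃ l < M, l < a.memRep mem M ∧
    a.RamVotes mem M (a.memLoc mem M + a.memRep mem M * a.memLearn mem M) (a.memTest mem M)
      (a.memRounds mem M) (a.memLoc mem M + l * a.memLearn mem M) (a.memLearn mem M)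

theorem definable_ratioNum : Definable fun mem _ _ => ratioNum mem :=
  (Definable.load (.const 1)).mul (Definable.load (.const 4))

theorem definable_ratioDen : Definable fun mem _ _ => ratioDen mem :=
  (Definable.load (.const 2)).mul (Definable.load (.const 3))

theorem definable_ramLog : Definable fun mem M _ => ramLog (mem 0) M := by
  unfold ramLog
  -- The head symbol of each goal selects the closure property; reducible transparency prevents
  -- matches that unfold definitions.
  repeat' with_reducible first
    | exact .var _ | exact .const _ | apply Definable.add | apply Definable.mul
    | apply Definable.div | apply Definable.load | apply Definable.card
    | apply DefinablePred.and | apply DefinablePred.not | apply DefinablePred.exists_lt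
    | apply DefinablePred.le | apply DefinablePred.eq

theorem definable_memLoc : Definable fun mem M _ => a.memLoc mem M := by
  unfold memLoc ramLoc floorCbrt
  repeat' with_reducible first
    | exact .var _ | exact .const _ | exact definable_ratioNum | exact definable_ratioDen
    | exact definable_ramLog | apply Definable.add | apply Definable.mul
    | apply Definable.pow | apply Definable.load | apply Definable.card | apply DefinablePred.le

theorem definable_memLearn : Definable fun mem M _ => a.memLearn mem M := by
  unfold memLearn ramLearn floorCbrt
  repeat' with_reducible first
    | exact .var _ | exact .const _ | exact definable_ratioNum | exact definable_ratioDen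
    | apply Definable.add | apply Definable.sub | apply Definable.mul
    | apply Definable.pow | apply Definable.load | apply Definable.card | apply DefinablePred.le

theorem definable_memTest : Definable fun mem M _ => a.memTest mem M := by
  unfold memTest ramTest floorCbrt
  repeat' with_reducible first
    | exact .var _ | exact .const _ | exact definable_ratioNum | exact definable_ratioDen
    | apply Definable.add | apply Definable.mul
    | apply Definable.pow | apply Definable.load | apply Definable.card | apply DefinablePred.le

theorem definable_memRep : Definable fun mem M _ => a.memRep mem M := by
  unfold memRep ramRep
  repeat' with_reducible first
    | exact .var _ | exact .const _ | apply Definable.mul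
    | apply Definable.pow | apply Definable.load | apply Definable.card | apply DefinablePred.lt

theorem definable_memRounds : Definable fun mem M _ => a.memRounds mem M :=
  (Definable.const _).mul definable_ramLog

theorem definable_ramBound :
    Definable fun mem _ _ => a.ramBound (mem 0) (ratioNum mem) (ratioDen mem) := by
  unfold ramBound
  repeat' with_reducible first
    | exact .const _ | exact definable_ratioNum | exact definable_ratioDen
    | apply Definable.add | apply Definable.mul | apply Definable.div
    | apply Definable.pow | apply Definable.load

theorem definablePred_ramLocalizes :
    DefinablePred fun mem M _ => RamLocalizes mem M (a.memLoc mem M) := by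
  unfold RamLocalizes ramCov ramAgree ramPlus cell
  repeat' with_reducible first
    | exact .var _ | exact .const _ | exact definable_ratioNum | exact definable_ratioDen
    | exact a.definable_memLoc | apply Definable.add | apply Definable.sub | apply Definable.mul
    | apply Definable.pow | apply Definable.load | apply Definable.card
    | apply DefinablePred.and | apply DefinablePred.exists_lt
    | apply DefinablePred.lt | apply DefinablePred.le | apply DefinablePred.eq

theorem definablePred_ramRejects : DefinablePred fun mem M _ => a.RamRejects mem M := by
  refine a.definablePred_ramLocalizes.or ?_
  unfold RamVotes ramMatch ramMismatch ramAgree cell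
  repeat' with_reducible first
    | exact .var _ | exact .const _ | exact definable_ratioNum | exact definable_ratioDen
    | exact a.definable_memLoc | exact a.definable_memLearn | exact a.definable_memTest
    | exact a.definable_memRep | exact a.definable_memRounds
    | apply Definable.add | apply Definable.sub | apply Definable.mul
    | apply Definable.pow | apply Definable.load | apply Definable.sum | apply Definable.card
    | apply DefinablePred.and | apply DefinablePred.iff | apply DefinablePred.not
    | apply DefinablePred.exists_lt
    | apply DefinablePred.lt | apply DefinablePred.le | apply DefinablePred.eq

end Constants

end IsingTest

end

noncomputable section

namespace IsingTest

open Finset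

/-! ### Agreement of the integer arithmetic with the algorithm -/

namespace Constants

variable (a : Constants) {n : ℕ} {β ε : ℝ} {mem : ℕ → ℕ} {x : ℕ → Config n}

theorem exists_pairs_iff {n M : ℕ} (hM : n ≤ M) (p : ℕ → ℕ → Prop) :
    (∃ u < M, ∃ v < M, (u < v ∧ v < n) ∧ p u v) ↔ ∃ u v : Fin n, u < v ∧ p u v := by
  constructor
  · rintro ⟨u, -, v, -, ⟨huv, hv⟩, h⟩
    exact ⟨⟨u, huv.trans hv⟩, ⟨v, hv⟩, huv, h⟩
  · rintro ⟨u, v, huv, h⟩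
    exact ⟨u, u.2.trans_le hM, v, v.2.trans_le hM, ⟨huv, v.2⟩, h⟩

theorem ramLocalizes_iff {M N k : ℕ} (hn : mem 0 = n) (hx : Holds mem N x) (hM : n ≤ M)
    (hQ : 0 < ratioDen mem) (h : β / ε * ratioDen mem = ratioNum mem) (hε : 0 < ε)
    (hk : k ≤ M) (hkN : k ≤ N) :
    RamLocalizes mem M k ↔ LocalizationRejects (4 / 3) β ε k x := by
  unfold RamLocalizes
  rw [localizationRejects_iff hε, hn, exists_pairs_iff hM fun u v => 0 < k ∧
    (ratioDen mem * k ^ 2) ^ 3 ≤ 8 * ratioNum mem ^ 3 * n ^ 4 *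
      ramCov k (ramAgree mem M 0 k u v) (ramPlus mem M k u) (ramPlus mem M k v) ^ 3]
  refine exists_congr fun u => exists_congr fun v => and_congr_right fun _ => ?_
  rw [← le_cov_iff hQ h, hx.agree hk (by omega), hx.plus hk hkN, hx.plus hk hkN, empEdge_eq,
    empNode_eq, empNode_eq]
  simp only [zero_add]

/-- The product of a learned sign with X_u X_v is 1 when agreement of the two spins coincides with a
positive learned sign, and -1 otherwise. The statistic is therefore a difference of two counts. -/
theorem ramMatch_sub_ramMismatch {M N o k o' k' : ℕ} (hn : mem 0 = n) (hx : Holds mem N x)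
    (hM : n ≤ M) (hk : k ≤ M) (hkN : o + k ≤ N) (hk' : k' ≤ M) (hkN' : o' + k' ≤ N) :
    (ramMatch mem M o k o' k' : ℝ) - ramMismatch mem M o k o' k' =
      ∑ i ∈ range k, quad (weakLearn k' fun j => x (o' + j)) (x (o + i)) := by
  unfold ramMatch ramMismatch
  rw [hn]
  push_cast
  rw [← sum_sub_distrib, ← sum_subset (range_subset_range.2 hk)]
  · refine sum_congr rfl fun i hi => ?_
    have hi' := mem_range.1 hi
    simp only [hi', true_and]
    have := sum_pairs_eq hM fun u v =>
      (cell mem (o + i) u = cell mem (o + i) v ↔ k' ≤ 2 * ramAgree mem M o' k' u v)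
    push_cast at this
    rw [this, quad]
    refine sum_congr rfl fun u _ => sum_congr rfl fun v _ => ?_
    rw [hx.agree hk' hkN', hx _ (by omega), hx _ (by omega), weakLearn_eq_ite, spin_mul_spin]
    have : (x (o + i) u).toNat = (x (o + i) v).toNat ↔ x (o + i) u = x (o + i) v := by
      cases x (o + i) u <;> cases x (o + i) v <;> simp
    simp only [this]
    by_cases h1 : x (o + i) u = x (o + i) v <;>
      by_cases h2 : k' ≤ 2 * #{j ∈ range k' | x (o' + j) u = x (o' + j) v} <;> simp [h1, h2]
  · intro i _ hi
    have := mem_range.not.1 hi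
    simp [this]

theorem ramMatch_zero (mem : ℕ → ℕ) (M o o' k' : ℕ) : ramMatch mem M o 0 o' k' = 0 := by
  simp [ramMatch]

theorem ramVotes_iff {M N o k R o' k' : ℕ} (hn : mem 0 = n) (hx : Holds mem N x)
    (hQ : 0 < ratioDen mem) (h : β / ε * ratioDen mem = ratioNum mem) (hε : 0 < ε)
    (hM : n ≤ M) (hk : k ≤ M) (hR : R ≤ M) (hkN : o + R * k ≤ N) (hk' : k' ≤ M)
    (hkN' : o' + k' ≤ N) :
    a.RamVotes mem M o k R o' k' ↔
      VoteRejects a.thr (4 / 3) β ε (weakLearn k' fun j => x (o' + j)) R k fun i => x (o + i) := by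
  classical
  unfold RamVotes VoteRejects
  rw [card_filter_range_and hR]
  have : (range R).filter (fun r => (ratioDen mem * k) ^ 3 <
      a.thr ^ 3 * ratioNum mem ^ 3 * mem 0 ^ 2 *
        (ramMatch mem M (o + r * k) k o' k' - ramMismatch mem M (o + r * k) k o' k') ^ 3) =
      (range R).filter fun r => ThresholdRejects a.thr (4 / 3) β ε
        (weakLearn k' fun j => x (o' + j)) k fun i => x (o + (r * k + i)) := by
    refine filter_congr fun r hr => ?_
    have hrk : (r + 1) * k ≤ R * k := Nat.mul_le_mul_right _ (mem_range.1 hr)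
    rw [add_mul, one_mul] at hrk
    rw [thresholdRejects_iff hε, rpow_two_sub, hn,
      ← lt_stat_iff hQ h (by rintro rfl; exact ramMatch_zero _ _ _ _ _),
      ramMatch_sub_ramMismatch hn hx hM hk (by omega) hk' hkN']
    simp only [add_assoc]
  rw [this]

/-- All sizes of the algorithm are at most M, so truncating every sum and quantifier at M loses
nothing. -/
theorem ramRejects_iff (hn : mem 0 = n) (hβ : 0 ≤ β) (hε : 0 < ε) (hQ : 0 < ratioDen mem)
    (h : β / ε * ratioDen mem = ratioNum mem) (hx : Holds mem (a.samples n (4 / 3) β ε) x) :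
    a.RamRejects mem (a.ramBound n (ratioNum mem) (ratioDen mem)) ↔
      SequenceRejects a (4 / 3) β ε x := by
  set M := a.ramBound n (ratioNum mem) (ratioDen mem) with hM
  obtain ⟨e0, l0⟩ := a.ramLoc_eq hε hQ h
  obtain ⟨e1, l1⟩ := a.ramLearn_eq hε hQ h
  obtain ⟨e2, l2⟩ := a.ramTest_eq hβ hε hQ h
  obtain ⟨e3, l3⟩ := a.ramRep_eq (n := n) (P := ratioNum mem) (Q := ratioDen mem)
  obtain ⟨e4, l4⟩ := a.ramRounds_eq (n := n) (P := ratioNum mem) (Q := ratioDen mem)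
  rw [← hM] at e0 e1 e2 e3 e4 l0 l1 l2 l3 l4
  have hnM : n ≤ M := (a.lt_ramBound n _ _).le
  unfold RamRejects SequenceRejects
  simp only [memLoc, memLearn, memTest, memRep, memRounds, hn, e0, e1, e2, e3, e4]
  set k₀ := a.locSamples n (4 / 3) β ε
  set k₁ := a.learnSamples n (4 / 3) β ε
  set k₂ := a.testSamples n (4 / 3) β ε
  set L := a.repetitions n (4 / 3)
  set R := a.rounds n
  have hN : a.samples n (4 / 3) β ε = k₀ + L * k₁ + R * k₂ := rfl
  refine or_congr (ramLocalizes_iff hn hx hnM hQ h hε l0 (by omega)) ?_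
  constructor
  · rintro ⟨l, -, hl, hv⟩
    have hlk : (l + 1) * k₁ ≤ L * k₁ := Nat.mul_le_mul_right _ hl
    rw [add_mul, one_mul] at hlk
    exact ⟨l, hl, (a.ramVotes_iff hn hx hQ h hε hnM l2 l4 (by omega) l1 (by omega)).1 hv⟩
  · rintro ⟨l, hl, hv⟩
    have hlk : (l + 1) * k₁ ≤ L * k₁ := Nat.mul_le_mul_right _ hl
    rw [add_mul, one_mul] at hlk
    exact ⟨l, hl.trans_le l3, hl,
      (a.ramVotes_iff hn hx hQ h hε hnM l2 l4 (by omega) l1 (by omega)).2 hv⟩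

end Constants

/-! ### Running time -/

theorem holds_inputList {n N : ℕ} (β ε : ℚ) (x : Fin N → Config n) :
    Holds (fun i => (inputList β ε x).getD i 0) N fun i => padded i x := by
  intro j hj u
  have hlt : j * n + u < N * n := by
    calc j * n + u < j * n + n := by omega
      _ = (j + 1) * n := by ring
      _ ≤ N * n := Nat.mul_le_mul_right _ hj
  have hn : 0 < n := u.pos
  have e : cell (fun i => (inputList β ε x).getD i 0) j u =
      (List.ofFn fun j : Fin (N * n) => (x j.divNat j.modNat).toNat).getD (j * n + u) 0 := by
    simp only [cell, inputList]
    rw [List.getD_append_right _ _ _ _ (by simp)]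
    simp
  rw [e, List.getD_eq_getElem _ _ (by simpa using hlt), List.getElem_ofFn]
  have h1 : Fin.divNat (⟨j * n + u, hlt⟩ : Fin (N * n)) = ⟨j, hj⟩ := by
    ext
    simp only [Fin.divNat]
    rw [Nat.mul_comm, Nat.mul_add_div hn, Nat.div_eq_of_lt u.2, add_zero]
  have h2 : Fin.modNat (⟨j * n + u, hlt⟩ : Fin (N * n)) = u := by
    ext
    simp only [Fin.modNat]
    rw [Nat.mul_comm, Nat.mul_add_mod, Nat.mod_eq_of_lt u.2]
  rw [h1, h2]
  simp only [padded, dif_pos hj]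

theorem size_getD_le_bitLength (l : List ℕ) (i : ℕ) : (l.getD i 0).size ≤ bitLength l := by
  rcases lt_or_ge i l.length with h | h
  · rw [List.getD_eq_getElem _ _ h]
    have : (l[i]).size + 1 ∈ l.map fun m => m.size + 1 :=
      List.mem_map.2 ⟨_, List.getElem_mem h, rfl⟩
    have := List.le_sum_of_mem this
    unfold bitLength; omega
  · rw [List.getD_eq_default _ _ h]; simp

theorem length_le_bitLength (l : List ℕ) : l.length ≤ bitLength l := by
  unfold bitLength
  induction l with
  | nil => simp
  | cons b l ih => simp only [List.length_cons, List.map_cons, List.sum_cons]; omega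

open Polynomial in
theorem runsInPolynomialTime (a : Constants) : RunsInPolynomialTime a (4 / 3) := by
  classical
  obtain ⟨tM, htM⟩ := a.definable_ramBound
  obtain ⟨tOut, htOut⟩ := a.definablePred_ramRejects
  obtain ⟨P, q, hP⟩ := Term.exists_program tM tOut
  set c := a.rep + a.vote + 1 + (a.loc + 2 * a.learn + a.test) with hc
  -- The number c(n + b + 1), with b the length of the input, bounds both M and the bit length of
  -- every cell.
  refine ⟨P, q.comp (C c * (X + 1)), fun n β ε hβ hε x => ?_⟩
  set mem : ℕ → ℕ := fun i => (inputList β ε x).getD i 0 with hmem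
  have hn : mem 0 = n := rfl
  have m1 : mem 1 = β.num.toNat := rfl
  have m2 : mem 2 = β.den := rfl
  have m3 : mem 3 = ε.num.toNat := rfl
  have m4 : mem 4 = ε.den := rfl
  have hβn : ((β.num.toNat : ℕ) : ℤ) = β.num := Int.toNat_of_nonneg (Rat.num_nonneg.2 hβ)
  have hεn : ((ε.num.toNat : ℕ) : ℤ) = ε.num := Int.toNat_of_nonneg (Rat.num_nonneg.2 hε.le)
  have hεpos : 0 < ε.num.toNat := by have := Rat.num_pos.2 hε; omega
  have hQ : 0 < Constants.ratioDen mem := by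
    rw [Constants.ratioDen, m2, m3]; exact Nat.mul_pos β.den_pos hεpos
  have hβR : (β : ℝ) = (β.num.toNat : ℝ) / β.den := by
    have : ((β.num.toNat : ℕ) : ℝ) = (β.num : ℝ) := by exact_mod_cast congrArg (Int.cast (R := ℝ)) hβn
    rw [this]; exact Rat.cast_def β
  have hεR : (ε : ℝ) = (ε.num.toNat : ℝ) / ε.den := by
    have : ((ε.num.toNat : ℕ) : ℝ) = (ε.num : ℝ) := by exact_mod_cast congrArg (Int.cast (R := ℝ)) hεn
    rw [this]; exact Rat.cast_def ε
  have hβ' : (0 : ℝ) ≤ β := by exact_mod_cast hβ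
  have hε' : (0 : ℝ) < ε := by exact_mod_cast hε
  have h : (β : ℝ) / ε * Constants.ratioDen mem = Constants.ratioNum mem := by
    rw [Constants.ratioDen, Constants.ratioNum, m1, m2, m3, m4, hβR, hεR]
    have z1 : (0 : ℝ) < β.den := by exact_mod_cast β.den_pos
    have z2 : (0 : ℝ) < ε.den := by exact_mod_cast ε.den_pos
    have z3 : (0 : ℝ) < ε.num.toNat := by exact_mod_cast hεpos
    push_cast
    field_simp
  set M := a.ramBound n (Constants.ratioNum mem) (Constants.ratioDen mem) with hM
  set b := bitLength (inputList β ε x) with hb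
  have hlen : a.samples n (4 / 3) β ε * n ≤ b := by
    have := length_le_bitLength (inputList β ε x)
    simp only [inputList, List.length_append, List.length_ofFn] at this
    exact (Nat.le_add_left _ _).trans this
  have hc1 : 1 ≤ c := by omega
  have hMB : M ≤ c * (n + b + 1) :=
    (a.ramBound_le hQ h).trans (Nat.mul_le_mul_left _ (by omega))
  have hbB : b ≤ c * (n + b + 1) := le_trans (by omega) (Nat.le_mul_of_pos_left _ hc1)
  obtain ⟨t, s, he, ht, hs⟩ := hP (inputList β ε x) M (c * (n + b + 1)) (htM mem 0 fun _ => 0).symm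
    hMB fun i => (size_getD_le_bitLength _ i).trans hbB
  rw [htOut] at hs
  have key : a.RamRejects mem M ↔ LearnThenTestRejects a (4 / 3) β ε x :=
    a.ramRejects_iff hn hβ' hε' hQ h (holds_inputList β ε x)
  refine ⟨t, s, he, ?_, fun hr => ?_, fun hr => ?_⟩
  · simpa using ht
  · rw [hs]; exact if_pos (key.2 hr)
  · rw [hs]; exact if_neg (mt key.1 hr)

end IsingTest

end

theorem mainTheorem9 (η : ℝ) (hη : 0 < η) :
    ∃ (a : IsingTest.Constants) (C : ℝ) (d : ℕ),
      -- sample complexity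
      (∀ (n : ℕ) (β ε : ℝ), 0 ≤ β → 0 < ε →
        (a.samples n (4 / 3) β ε : ℝ) ≤
            C * (1 + Real.log n) ^ d * ((n : ℝ) ^ (10 / 3 : ℝ) * β ^ 2 / ε ^ 2) ∧
        ∀ τ : ℝ, 0 < τ →
          (a.samples n (4 / 3) β ε : ℝ) ≤
            C * (1 + Real.log n) ^ d *
              (((n : ℝ) ^ (2 + τ) + (n : ℝ) ^ (6 - 2 * τ)) * β ^ 2 / ε ^ 2)) ∧
      -- correctness
      (∀ (n : ℕ) (p : IsingTest.IsingModel n) (β ε : ℝ),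
        p.NoExternalField → p.HighTemperature η → 0 ≤ β → p.EdgeBound β → 0 < ε →
        (p.law ∈ IsingTest.productLaws n →
          9 / 10 ≤ IsingTest.sampleProb p (a.samples n (4 / 3) β ε)
            {x | ¬ IsingTest.LearnThenTestRejects a (4 / 3) β ε x}) ∧
        (ENNReal.ofReal ε ≤ IsingTest.dSKLProduct p.law →
          9 / 10 ≤ IsingTest.sampleProb p (a.samples n (4 / 3) β ε)
            {x | IsingTest.LearnThenTestRejects a (4 / 3) β ε x})) ∧
      -- running time
      IsingTest.RunsInPolynomialTime a (4 / 3) := by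
  -- The constants of the algorithm are positive integers, so 1/η is replaced by a positive integer
  -- above it.
  obtain ⟨K, hK0, hK⟩ : ∃ K : ℕ, 0 < K ∧ 1 / η ≤ K :=
    ⟨max 1 ⌈1 / η⌉₊, by omega, (Nat.le_ceil _).trans (by exact_mod_cast le_max_right _ _)⟩
  set a := IsingTest.constants K hK0
  refine ⟨a, 2 * (a.loc + (2 * a.rep + 2) * a.learn + a.vote * a.test), 1,
    fun n β ε _ _ => ?_, fun n p β ε hf hp hβ he hε =>
      IsingTest.learnThenTest_correct hη hK0 hK hf hp hβ he hε, IsingTest.runsInPolynomialTime a⟩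
  have h1 := IsingTest.samples_le a n (β := β) (ε := ε)
  rw [← pow_one (1 + Real.log n)] at h1
  refine ⟨h1, fun τ _ => h1.trans (mul_le_mul_of_nonneg_left ?_ ?_)⟩
  · gcongr
    exact IsingTest.rpow_ten_thirds_le n τ
  · have := Real.log_natCast_nonneg n
    positivity
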